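/- Conventions. A 2-category is a strict 2-category; it is *gaunt* if all its invertible 1-morphisms and all its invertible 2-morphisms are identities. A *normal pseudofunctor* $F\colon\mathcal A\to\mathcal B$ between 2-categories is a pseudofunctor that strictly preserves identities, so its only non-strict structure are the invertible compositors $F(g)\circ F(f)\cong F(g\circ f)$; write $2\mathrm{Cat}_{\mathrm{nps}}(\mathcal A,\mathcal B)$ for the set of these. For a 2-category $\mathcal D$ let $\mathbb H^{\simeq}\mathcal D$ be the double category whose objects and horizontal morphisms are the objects and morphisms of $\mathcal D$, whose vertical morphisms are the adjoint equivalences $(u,u^\sharp,\eta,\varepsilon)$ of $\mathcal D$, and whose squares with top $f$, left side $u$, right side $v$ and bottom $g$ are the 2-morphisms $v\circ f\Rightarrow g\circ u$. Let $L^{\simeq}$ be the left adjoint of $\mathbb H^{\simeq}$. Let $\widetilde O_n$ be the 2-category with objects $0,\dots,n$, morphisms freely generated by one morphism $a\to b$ for all $a<b$, and exactly one 2-morphism between any two parallel morphisms; let $\widehat O_n$ be the 2-category with the same objects, morphisms freely generated by one morphism $a\to b$ for all $a\neq b$, and exactly one 2-morphism between any two parallel morphisms. Put $\mathbb X_{i,j,k}=\mathbb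 V\widetilde O_j\otimes\mathbb H\widetilde O_i\otimes\mathbb H\widehat O_k$, the Gray tensor product of double categories; explicitly, $\mathbb X_{i,j,k}$ is the double category with objects $(a,b,c)$, $0\le a\le i$, $0\le b\le j$, $0\le c\le k$, with horizontal morphisms freely generated by $(a,b,c)\to(a',b,c)$ for $a<a'$ and $(a,b,c)\to(a,b,c')$ for $c\ne c'$, with vertical morphisms freely generated by $(a,b,c)\to(a,b',c)$ for $b<b'$, and with exactly one square for each boundary. It is functorial in $([i],[j],[k])\in\Delta\times\Delta\times\Delta$ by acting on the objects (generators are sent to generators or identities). The *bisimplicial nerve* of $\mathcal D$ is the bisimplicial space (bisimplicial object in simplicial sets) $$\mathbf N^{\Delta\times\Delta}_{i,j,k}\mathcal D=\mathrm{DblCat}(\mathbb X_{i,j,k},\mathbb H^{\simeq}\mathcal D)\cong 2\mathrm{Cat}(L^{\simeq}\mathbb X_{i,j,k},\mathcal D).$$ A normal pseudofunctor $F\colon\mathcal A\to\mathcal B$ induces a map $\mathbf N^{\Delta\times\Delta}F\colon\mathbf N^{\Delta\times\Delta}\mathcal A\to\mathbf N^{\Delta\times\Delta}\mathcal B$, $G\mapsto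 F_*G$. Here $F_*G$ sends an object $x$ to $F(Gx)$ and a generating horizontal or vertical morphism $e$ to $F(Ge)$ (where $F$ acts on adjoint equivalences through its compositors), it is extended to all morphisms by freeness, and it sends a square $\alpha$ to $F(G\alpha)$ conjugated by the isomorphisms between $F(Ge_n)\circ\dots\circ F(Ge_1)$ and $F(Ge_n\circ\dots\circ Ge_1)$ built from the compositors. **Proposition.** Let $\mathcal A$ be a gaunt 2-category and $\mathcal B$ any 2-category. Then $$\mathbf N^{\Delta\times\Delta}\colon 2\mathrm{Cat}_{\mathrm{nps}}(\mathcal A,\mathcal B)\longrightarrow \mathrm{sPsh}(\Delta\times\Delta)(\mathbf N^{\Delta\times\Delta}\mathcal A,\mathbf N^{\Delta\times\Delta}\mathcal B),\qquad F\mapsto\mathbf N^{\Delta\times\Delta}F,$$ is a bijection. It is natural in $\mathcal A$ and $\mathcal B$: for all 2-categories $\mathcal A'$, $\mathcal B'$ and all normal pseudofunctors (in particular all 2-functors) $H\colon\mathcal A'\to\mathcal A$, $F\colon\mathcal A\to\mathcal B$ and $K\colon\mathcal B\to\mathcal B'$ one has $\mathbf N^{\Delta\times\Delta}(K\circ F\circ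 H)=\mathbf N^{\Delta\times\Delta}K\circ\mathbf N^{\Delta\times\Delta}F\circ\mathbf N^{\Delta\times\Delta}H$. -/

import Mathlib

open CategoryTheory Bicategory

universe w v u u₁ v₁ v₂ w₁ u₂ v₃ v₄ w₂ u₃ v₅ v₆ w₃

namespace CategoryTheory.Bicategory.Equivalence

variable {B : Type u} [Bicategory.{w, v} B]

/-- Composition of adjoint equivalences. -/
def comp {a b c : B} (e : a ≌ b) (e' : b ≌ c) : a ≌ c where
  hom := e.hom ≫ e'.hom
  inv := e'.inv ≫ e.inv
  unit := e.unit ≪≫ whiskerLeftIso e.hom ((λ_ e.inv).symm ≪≫ whiskerRightIso e'.unit e.inv ≪≫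
    α_ e'.hom e'.inv e.inv) ≪≫ (α_ e.hom e'.hom (e'.inv ≫ e.inv)).symm
  counit := α_ e'.inv e.inv (e.hom ≫ e'.hom) ≪≫ whiskerLeftIso e'.inv
    ((α_ e.inv e.hom e'.hom).symm ≪≫ whiskerRightIso e.counit e'.hom ≪≫ λ_ e'.hom) ≪≫ e'.counit
  left_triangle := by
    ext
    have h := Adjunction.comp_left_triangle_aux
      (⟨e.unit.hom, e.counit.hom, e.left_triangle_hom, e.right_triangle_hom⟩ :
        Adjunction e.hom e.inv)
      (⟨e'.unit.hom, e'.counit.hom, e'.left_triangle_hom, e'.right_triangle_hom⟩ :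
        Adjunction e'.hom e'.inv)
    dsimp only [Adjunction.compUnit, Adjunction.compCounit] at h
    simp only [leftZigzagIso_hom, Iso.trans_hom, whiskerLeftIso_hom, whiskerRightIso_hom,
      Iso.symm_hom]
    rw [← h]
    dsimp only [leftZigzag]
    bicategory

theorem comp_unit_hom {a b c : B} (e : a ≌ b) (e' : b ≌ c) : (e.comp e').unit.hom =
    e.unit.hom ≫ e.hom ◁ ((λ_ e.inv).inv ≫ e'.unit.hom ▷ e.inv ≫ (α_ e'.hom e'.inv e.inv).hom) ≫
      (α_ e.hom e'.hom (e'.inv ≫ e.inv)).inv := rfl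

theorem comp_counit_hom {a b c : B} (e : a ≌ b) (e' : b ≌ c) : (e.comp e').counit.hom =
    (α_ e'.inv e.inv (e.hom ≫ e'.hom)).hom ≫ e'.inv ◁ ((α_ e.inv e.hom e'.hom).inv ≫
      e.counit.hom ▷ e'.hom ≫ (λ_ e'.hom).hom) ≫ e'.counit.hom := rfl

theorem mk_eq {a b : B} {f f' : a ⟶ b} {g g' : b ⟶ a} {η : 𝟙 a ≅ f ≫ g} {η' : 𝟙 a ≅ f' ≫ g'}
    {κ : g ≫ f ≅ 𝟙 b} {κ' : g' ≫ f' ≅ 𝟙 b} {t : leftZigzagIso η κ = λ_ f ≪≫ (ρ_ f).symm}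
    {t' : leftZigzagIso η' κ' = λ_ f' ≪≫ (ρ_ f').symm} (h : f = f') (h' : g = g')
    (hu : η.hom = η'.hom ≫ eqToHom (by rw [h, h']))
    (hc : κ.hom = eqToHom (by rw [h, h']) ≫ κ'.hom) :
    (⟨f, g, η, κ, t⟩ : a ≌ b) = ⟨f', g', η', κ', t'⟩ := by
  subst h h'
  obtain rfl : η = η' := by ext; simpa using hu
  obtain rfl : κ = κ' := by ext; simpa using hc
  rfl

variable [Strict B]

theorem leftUnitor_whiskerRight_eq {a b c : B} (f : a ⟶ b) (g : b ⟶ c) :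
    (λ_ f).hom ▷ g = eqToHom (by rw [Strict.id_comp]) := by
  rw [Strict.leftUnitor_eqToIso]; simp

theorem leftUnitor_inv_whiskerRight_eq {a b c : B} (f : a ⟶ b) (g : b ⟶ c) :
    (λ_ f).inv ▷ g = eqToHom (by rw [Strict.id_comp]) := by
  rw [Strict.leftUnitor_eqToIso]; simp

theorem rightUnitor_whiskerRight_eq {a b c : B} (f : a ⟶ b) (g : b ⟶ c) :
    (ρ_ f).hom ▷ g = eqToHom (by rw [Strict.comp_id]) := by
  rw [Strict.rightUnitor_eqToIso]; simp

theorem rightUnitor_inv_whiskerRight_eq {a b c : B} (f : a ⟶ b) (g : b ⟶ c) :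
    (ρ_ f).inv ▷ g = eqToHom (by rw [Strict.comp_id]) := by
  rw [Strict.rightUnitor_eqToIso]; simp

theorem whiskerLeft_leftUnitor_eq {a b c : B} (f : a ⟶ b) (g : b ⟶ c) :
    f ◁ (λ_ g).hom = eqToHom (by rw [Strict.id_comp]) := by
  rw [Strict.leftUnitor_eqToIso]; simp

theorem whiskerLeft_leftUnitor_inv_eq {a b c : B} (f : a ⟶ b) (g : b ⟶ c) :
    f ◁ (λ_ g).inv = eqToHom (by rw [Strict.id_comp]) := by
  rw [Strict.leftUnitor_eqToIso]; simp

theorem whiskerLeft_rightUnitor_eq {a b c : B} (f : a ⟶ b) (g : b ⟶ c) :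
    f ◁ (ρ_ g).hom = eqToHom (by rw [Strict.comp_id]) := by
  rw [Strict.rightUnitor_eqToIso]; simp

theorem whiskerLeft_rightUnitor_inv_eq {a b c : B} (f : a ⟶ b) (g : b ⟶ c) :
    f ◁ (ρ_ g).inv = eqToHom (by rw [Strict.comp_id]) := by
  rw [Strict.rightUnitor_eqToIso]; simp

theorem associator_whiskerRight_eq {a b c d e : B} (f : a ⟶ b) (g : b ⟶ c) (h : c ⟶ d)
    (k : d ⟶ e) : (α_ f g h).hom ▷ k = eqToHom (by rw [Strict.assoc f g h]) := by
  rw [Strict.associator_eqToIso]; simp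

theorem associator_inv_whiskerRight_eq {a b c d e : B} (f : a ⟶ b) (g : b ⟶ c) (h : c ⟶ d)
    (k : d ⟶ e) : (α_ f g h).inv ▷ k = eqToHom (by rw [Strict.assoc f g h]) := by
  rw [Strict.associator_eqToIso]; simp

theorem whiskerLeft_associator_eq {a b c d e : B} (k : a ⟶ b) (f : b ⟶ c) (g : c ⟶ d)
    (h : d ⟶ e) : k ◁ (α_ f g h).hom = eqToHom (by rw [Strict.assoc f g h]) := by
  rw [Strict.associator_eqToIso]; simp

theorem whiskerLeft_associator_inv_eq {a b c d e : B} (k : a ⟶ b) (f : b ⟶ c) (g : c ⟶ d)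
    (h : d ⟶ e) : k ◁ (α_ f g h).inv = eqToHom (by rw [Strict.assoc f g h]) := by
  rw [Strict.associator_eqToIso]; simp

theorem id_comp' {a b : B} (e : a ≌ b) : (id a).comp e = e := by
  refine mk_eq (Strict.id_comp e.hom) (Strict.comp_id e.inv) ?_ ?_ <;> dsimp only [id]
  · trans e.unit.hom ≫ (λ_ e.hom).inv ▷ e.inv ≫ (𝟙 a ≫ e.hom) ◁ (ρ_ e.inv).inv
    · refine (comp_unit_hom (id a) e).trans ?_
      dsimp only [id, Iso.symm_hom]
      bicategory
    · rw [leftUnitor_inv_whiskerRight_eq, whiskerLeft_rightUnitor_inv_eq, eqToHom_trans]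
  · trans (ρ_ e.inv).hom ▷ (𝟙 a ≫ e.hom) ≫ e.inv ◁ (λ_ e.hom).hom ≫ e.counit.hom
    · refine (comp_counit_hom (id a) e).trans ?_
      dsimp only [id, Iso.symm_hom]
      bicategory
    · rw [rightUnitor_whiskerRight_eq, whiskerLeft_leftUnitor_eq, eqToHom_trans_assoc]

theorem comp_id' {a b : B} (e : a ≌ b) : e.comp (id b) = e := by
  refine mk_eq (Strict.comp_id e.hom) (Strict.id_comp e.inv) ?_ ?_ <;> dsimp only [id]
  · trans e.unit.hom ≫ (ρ_ e.hom).inv ▷ e.inv ≫ (e.hom ≫ 𝟙 b) ◁ (λ_ e.inv).inv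
    · refine (comp_unit_hom e (id b)).trans ?_
      dsimp only [id, Iso.symm_hom]
      bicategory
    · rw [rightUnitor_inv_whiskerRight_eq, whiskerLeft_leftUnitor_inv_eq, eqToHom_trans]
  · trans (λ_ e.inv).hom ▷ (e.hom ≫ 𝟙 b) ≫ e.inv ◁ (ρ_ e.hom).hom ≫ e.counit.hom
    · refine (comp_counit_hom e (id b)).trans ?_
      dsimp only [id, Iso.symm_hom]
      bicategory
    · rw [leftUnitor_whiskerRight_eq, whiskerLeft_rightUnitor_eq, eqToHom_trans_assoc]

theorem assoc' {a b c d : B} (e : a ≌ b) (e' : b ≌ c) (e'' : c ≌ d) :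
    (e.comp e').comp e'' = e.comp (e'.comp e'') := by
  refine mk_eq (Strict.assoc e.hom e'.hom e''.hom) (Strict.assoc e''.inv e'.inv e.inv).symm ?_ ?_
  · trans (e.comp (e'.comp e'')).unit.hom ≫
        (α_ e.hom e'.hom e''.hom).inv ▷ ((e''.inv ≫ e'.inv) ≫ e.inv) ≫
          ((e.hom ≫ e'.hom) ≫ e''.hom) ◁ (α_ e''.inv e'.inv e.inv).hom
    · refine (comp_unit_hom _ _).trans ?_
      rw [comp_unit_hom e e', comp_unit_hom e, comp_unit_hom e' e'']
      dsimp only [comp]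
      bicategory
    · dsimp only [comp]
      rw [associator_inv_whiskerRight_eq, whiskerLeft_associator_eq, eqToHom_trans]
  · trans (α_ e''.inv e'.inv e.inv).inv ▷ ((e.hom ≫ e'.hom) ≫ e''.hom) ≫
        ((e''.inv ≫ e'.inv) ≫ e.inv) ◁ (α_ e.hom e'.hom e''.hom).hom ≫
          (e.comp (e'.comp e'')).counit.hom
    · refine (comp_counit_hom _ _).trans ?_
      rw [comp_counit_hom e e', comp_counit_hom e, comp_counit_hom e' e'']
      dsimp only [comp]
      bicategory
    · dsimp only [comp]
      rw [associator_inv_whiskerRight_eq, whiskerLeft_associator_eq, eqToHom_trans_assoc]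

end CategoryTheory.Bicategory.Equivalence

/-- A (strict) double category: objects, horizontal morphisms, vertical morphisms, and squares,
where `Sq f u v g` is the type of squares with top `f : a → b`, left side `u : a → c`, right side
`v : b → d` and bottom `g : c → d` (horizontal `f`, `g` and vertical `u`, `v`), with strictly
unital and associative horizontal and vertical compositions that satisfy the interchange law. -/
structure DoubleCat where
  Obj : Type u
  Hor : Obj → Obj → Type v₁
  Ver : Obj → Obj → Type v₂
  Sq : ∀ {a b c d : Obj}, Hor a b → Ver a c → Ver b d → Hor c d → Type w
  hid : ∀ a, Hor a a
  hcomp : ∀ {a b c}, Hor a b → Hor b c → Hor a c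
  vid : ∀ a, Ver a a
  vcomp : ∀ {a b c}, Ver a b → Ver b c → Ver a c
  hid_hcomp : ∀ {a b} (f : Hor a b), hcomp (hid a) f = f
  hcomp_hid : ∀ {a b} (f : Hor a b), hcomp f (hid b) = f
  hassoc : ∀ {a b c d} (f : Hor a b) (g : Hor b c) (h : Hor c d),
    hcomp (hcomp f g) h = hcomp f (hcomp g h)
  vid_vcomp : ∀ {a b} (f : Ver a b), vcomp (vid a) f = f
  vcomp_vid : ∀ {a b} (f : Ver a b), vcomp f (vid b) = f
  vassoc : ∀ {a b c d} (f : Ver a b) (g : Ver b c) (h : Ver c d),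
    vcomp (vcomp f g) h = vcomp f (vcomp g h)
  /-- The identity square at a vertical morphism, for horizontal composition. -/
  sqHid : ∀ {a c} (u : Ver a c), Sq (hid a) u u (hid c)
  /-- The identity square at a horizontal morphism, for vertical composition. -/
  sqVid : ∀ {a b} (f : Hor a b), Sq f (vid a) (vid b) f
  sqHcomp : ∀ {a b c a' b' c'} {f : Hor a b} {f' : Hor b c} {u : Ver a a'} {v : Ver b b'}
    {x : Ver c c'} {g : Hor a' b'} {g' : Hor b' c'},
    Sq f u v g → Sq f' v x g' → Sq (hcomp f f') u x (hcomp g g')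
  sqVcomp : ∀ {a b a' b' a'' b''} {f : Hor a b} {u : Ver a a'} {v : Ver b b'} {g : Hor a' b'}
    {u' : Ver a' a''} {v' : Ver b' b''} {h : Hor a'' b''},
    Sq f u v g → Sq g u' v' h → Sq f (vcomp u u') (vcomp v v') h
  sqHid_sqHcomp : ∀ {a b c d} {f : Hor a b} {u : Ver a c} {v : Ver b d} {g : Hor c d}
    (α : Sq f u v g), sqHcomp (sqHid u) α ≍ α
  sqHcomp_sqHid : ∀ {a b c d} {f : Hor a b} {u : Ver a c} {v : Ver b d} {g : Hor c d}
    (α : Sq f u v g), sqHcomp α (sqHid v) ≍ α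
  sqHassoc : ∀ {a b c d a' b' c' d'} {f : Hor a b} {f' : Hor b c} {f'' : Hor c d}
    {u : Ver a a'} {v : Ver b b'} {x : Ver c c'} {y : Ver d d'}
    {g : Hor a' b'} {g' : Hor b' c'} {g'' : Hor c' d'}
    (α : Sq f u v g) (β : Sq f' v x g') (γ : Sq f'' x y g''),
    sqHcomp (sqHcomp α β) γ ≍ sqHcomp α (sqHcomp β γ)
  sqVid_sqVcomp : ∀ {a b c d} {f : Hor a b} {u : Ver a c} {v : Ver b d} {g : Hor c d}
    (α : Sq f u v g), sqVcomp (sqVid f) α ≍ α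
  sqVcomp_sqVid : ∀ {a b c d} {f : Hor a b} {u : Ver a c} {v : Ver b d} {g : Hor c d}
    (α : Sq f u v g), sqVcomp α (sqVid g) ≍ α
  sqVassoc : ∀ {a b a₁ b₁ a₂ b₂ a₃ b₃} {f : Hor a b} {f₁ : Hor a₁ b₁} {f₂ : Hor a₂ b₂}
    {f₃ : Hor a₃ b₃} {u : Ver a a₁} {v : Ver b b₁} {u₁ : Ver a₁ a₂} {v₁ : Ver b₁ b₂}
    {u₂ : Ver a₂ a₃} {v₂ : Ver b₂ b₃}
    (α : Sq f u v f₁) (β : Sq f₁ u₁ v₁ f₂) (γ : Sq f₂ u₂ v₂ f₃),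
    sqVcomp (sqVcomp α β) γ ≍ sqVcomp α (sqVcomp β γ)
  sqHid_vid : ∀ a, sqHid (vid a) = sqVid (hid a)
  sqHid_vcomp : ∀ {a b c} (u : Ver a b) (v : Ver b c),
    sqHid (vcomp u v) = sqVcomp (sqHid u) (sqHid v)
  sqVid_hcomp : ∀ {a b c} (f : Hor a b) (g : Hor b c),
    sqVid (hcomp f g) = sqHcomp (sqVid f) (sqVid g)
  interchange : ∀ {a b c a' b' c' a'' b'' c''} {f : Hor a b} {f' : Hor b c} {u : Ver a a'}
    {v : Ver b b'} {x : Ver c c'} {g : Hor a' b'} {g' : Hor b' c'} {u' : Ver a' a''}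
    {v' : Ver b' b''} {x' : Ver c' c''} {h : Hor a'' b''} {h' : Hor b'' c''}
    (α : Sq f u v g) (β : Sq f' v x g') (γ : Sq g u' v' h) (δ : Sq g' v' x' h'),
    sqVcomp (sqHcomp α β) (sqHcomp γ δ) = sqHcomp (sqVcomp α γ) (sqVcomp β δ)

/-- A (strict) double functor. -/
structure DoubleFunctor (X : DoubleCat.{w₁, u₁, v₁, v₂}) (Y : DoubleCat.{w₂, u₂, v₃, v₄}) where
  obj : X.Obj → Y.Obj
  hor : ∀ {a b}, X.Hor a b → Y.Hor (obj a) (obj b)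
  ver : ∀ {a b}, X.Ver a b → Y.Ver (obj a) (obj b)
  sq : ∀ {a b c d} {f : X.Hor a b} {u : X.Ver a c} {v : X.Ver b d} {g : X.Hor c d},
    X.Sq f u v g → Y.Sq (hor f) (ver u) (ver v) (hor g)
  hor_id : ∀ a, hor (X.hid a) = Y.hid (obj a)
  hor_comp : ∀ {a b c} (f : X.Hor a b) (g : X.Hor b c),
    hor (X.hcomp f g) = Y.hcomp (hor f) (hor g)
  ver_id : ∀ a, ver (X.vid a) = Y.vid (obj a)
  ver_comp : ∀ {a b c} (f : X.Ver a b) (g : X.Ver b c),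
    ver (X.vcomp f g) = Y.vcomp (ver f) (ver g)
  sq_hid : ∀ {a c} (u : X.Ver a c), sq (X.sqHid u) ≍ Y.sqHid (ver u)
  sq_vid : ∀ {a b} (f : X.Hor a b), sq (X.sqVid f) ≍ Y.sqVid (hor f)
  sq_hcomp : ∀ {a b c a' b' c'} {f : X.Hor a b} {f' : X.Hor b c} {u : X.Ver a a'}
    {v : X.Ver b b'} {x : X.Ver c c'} {g : X.Hor a' b'} {g' : X.Hor b' c'}
    (α : X.Sq f u v g) (β : X.Sq f' v x g'),
    sq (X.sqHcomp α β) ≍ Y.sqHcomp (sq α) (sq β)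
  sq_vcomp : ∀ {a b a' b' a'' b''} {f : X.Hor a b} {u : X.Ver a a'} {v : X.Ver b b'}
    {g : X.Hor a' b'} {u' : X.Ver a' a''} {v' : X.Ver b' b''} {h : X.Hor a'' b''}
    (α : X.Sq f u v g) (β : X.Sq g u' v' h),
    sq (X.sqVcomp α β) ≍ Y.sqVcomp (sq α) (sq β)

namespace DoubleFunctor

theorem ext_of_heq {X : DoubleCat.{w₁, u₁, v₁, v₂}} {Y : DoubleCat.{w₂, u₂, v₃, v₄}}
    {F G : DoubleFunctor X Y} (h : F.obj = G.obj)
    (hh : ∀ {a b} (f : X.Hor a b), F.hor f ≍ G.hor f)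
    (hv : ∀ {a b} (f : X.Ver a b), F.ver f ≍ G.ver f)
    (hs : ∀ {a b c d} {f : X.Hor a b} {u : X.Ver a c} {v : X.Ver b d} {g : X.Hor c d}
      (α : X.Sq f u v g), F.sq α ≍ G.sq α) : F = G := by
  obtain ⟨o, m, n, s, _, _, _, _, _, _, _, _⟩ := F
  obtain ⟨o', m', n', s', _, _, _, _, _, _, _, _⟩ := G
  obtain rfl : o = o' := h
  obtain rfl : @m = @m' := by funext a b f; exact eq_of_heq (hh f)
  obtain rfl : @n = @n' := by funext a b f; exact eq_of_heq (hv f)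
  obtain rfl : @s = @s' := by funext a b c d f u v g α; exact eq_of_heq (hs α)
  rfl

theorem sq_heq {X : DoubleCat.{w₁, u₁, v₁, v₂}} {Y : DoubleCat.{w₂, u₂, v₃, v₄}}
    (F : DoubleFunctor X Y) {a b c d : X.Obj} {f f' : X.Hor a b} {u u' : X.Ver a c}
    {v v' : X.Ver b d} {g g' : X.Hor c d} {α : X.Sq f u v g} {β : X.Sq f' u' v' g'}
    (hf : f = f') (hu : u = u') (hv : v = v') (hg : g = g') (h : α ≍ β) :
    F.sq α ≍ F.sq β := by
  subst hf hu hv hg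
  obtain rfl := eq_of_heq h
  rfl

/-- The identity double functor. -/
def id (X : DoubleCat.{w₁, u₁, v₁, v₂}) : DoubleFunctor X X where
  obj a := a
  hor f := f
  ver f := f
  sq α := α
  hor_id _ := rfl
  hor_comp _ _ := rfl
  ver_id _ := rfl
  ver_comp _ _ := rfl
  sq_hid _ := HEq.rfl
  sq_vid _ := HEq.rfl
  sq_hcomp _ _ := HEq.rfl
  sq_vcomp _ _ := HEq.rfl

/-- Composition of double functors. -/
def comp {X : DoubleCat.{w₁, u₁, v₁, v₂}} {Y : DoubleCat.{w₂, u₂, v₃, v₄}}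
    {Z : DoubleCat.{w₃, u₃, v₅, v₆}} (F : DoubleFunctor X Y) (G : DoubleFunctor Y Z) :
    DoubleFunctor X Z where
  obj a := G.obj (F.obj a)
  hor f := G.hor (F.hor f)
  ver f := G.ver (F.ver f)
  sq α := G.sq (F.sq α)
  hor_id _ := by rw [F.hor_id, G.hor_id]
  hor_comp _ _ := by rw [F.hor_comp, G.hor_comp]
  ver_id _ := by rw [F.ver_id, G.ver_id]
  ver_comp _ _ := by rw [F.ver_comp, G.ver_comp]
  sq_hid u := (G.sq_heq (F.hor_id _) rfl rfl (F.hor_id _) (F.sq_hid u)).trans (G.sq_hid _)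
  sq_vid f := (G.sq_heq rfl (F.ver_id _) (F.ver_id _) rfl (F.sq_vid f)).trans (G.sq_vid _)
  sq_hcomp α β := (G.sq_heq (F.hor_comp _ _) rfl rfl (F.hor_comp _ _)
    (F.sq_hcomp α β)).trans (G.sq_hcomp _ _)
  sq_vcomp α β := (G.sq_heq rfl (F.ver_comp _ _) (F.ver_comp _ _) rfl
    (F.sq_vcomp α β)).trans (G.sq_vcomp _ _)

end DoubleFunctor

namespace DoubleCat

theorem sqHcomp_heq (Z : DoubleCat.{w, u, v₁, v₂}) {a b c a' b' c' : Z.Obj}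
    {f₁ g₁ : Z.Hor a b} {f₂ g₂ : Z.Hor b c} {u₁ u₂ : Z.Ver a a'} {v₁ v₂ : Z.Ver b b'}
    {x₁ x₂ : Z.Ver c c'} {k₁ l₁ : Z.Hor a' b'} {k₂ l₂ : Z.Hor b' c'}
    {α : Z.Sq f₁ u₁ v₁ k₁} {β : Z.Sq f₂ v₁ x₁ k₂} {α' : Z.Sq g₁ u₂ v₂ l₁}
    {β' : Z.Sq g₂ v₂ x₂ l₂} (h₁ : f₁ = g₁) (h₂ : f₂ = g₂) (h₃ : u₁ = u₂) (h₄ : v₁ = v₂)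
    (h₅ : x₁ = x₂) (h₆ : k₁ = l₁) (h₇ : k₂ = l₂) (hα : α ≍ α') (hβ : β ≍ β') :
    Z.sqHcomp α β ≍ Z.sqHcomp α' β' := by
  subst h₁ h₂ h₃ h₄ h₅ h₆ h₇
  rw [eq_of_heq hα, eq_of_heq hβ]

theorem sqVcomp_heq (Z : DoubleCat.{w, u, v₁, v₂}) {a b a' b' a'' b'' : Z.Obj}
    {f₁ f₂ : Z.Hor a b} {u₁ u₂ : Z.Ver a a'} {v₁ v₂ : Z.Ver b b'} {g₁ g₂ : Z.Hor a' b'}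
    {x₁ x₂ : Z.Ver a' a''} {y₁ y₂ : Z.Ver b' b''} {k₁ k₂ : Z.Hor a'' b''}
    {α : Z.Sq f₁ u₁ v₁ g₁} {β : Z.Sq g₁ x₁ y₁ k₁} {α' : Z.Sq f₂ u₂ v₂ g₂}
    {β' : Z.Sq g₂ x₂ y₂ k₂} (h₁ : f₁ = f₂) (h₂ : u₁ = u₂) (h₃ : v₁ = v₂) (h₄ : g₁ = g₂)
    (h₅ : x₁ = x₂) (h₆ : y₁ = y₂) (h₇ : k₁ = k₂) (hα : α ≍ α') (hβ : β ≍ β') :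
    Z.sqVcomp α β ≍ Z.sqVcomp α' β' := by
  subst h₁ h₂ h₃ h₄ h₅ h₆ h₇
  rw [eq_of_heq hα, eq_of_heq hβ]

theorem sqHid_heq (Z : DoubleCat.{w, u, v₁, v₂}) {a b : Z.Obj} {p q : Z.Ver a b} (h : p = q) :
    Z.sqHid p ≍ Z.sqHid q := by rw [h]

theorem sqVid_heq (Z : DoubleCat.{w, u, v₁, v₂}) {a b : Z.Obj} {p q : Z.Hor a b} (h : p = q) :
    Z.sqVid p ≍ Z.sqVid q := by rw [h]

section Hsim

variable (D : Type u) [Bicategory.{w, v} D] [Strict D]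

theorem heq_of_eqToHom {D : Type u} [Bicategory.{w, v} D] {a b : D} {f g f' g' : a ⟶ b}
    {α : f ⟶ g} {β : f' ⟶ g'} (hf : f = f') (hg : g = g')
    (h : α = eqToHom hf ≫ β ≫ eqToHom hg.symm) : α ≍ β := by
  subst hf hg
  simpa using h

/-- The double category `ℍ^≃ D` of a 2-category `D`: its objects and horizontal morphisms are the
objects and morphisms of `D`, its vertical morphisms are the adjoint equivalences
`(u, u^♯, η, ε)` of `D`, and its squares with top `f`, left `u`, right `v` and bottom `g` are the
2-morphisms `v ∘ f ⟶ g ∘ u` of `D`. -/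
def Hsim : DoubleCat.{w, u, v, max w v} where
  Obj := D
  Hor a b := a ⟶ b
  Ver a b := a ≌ b
  Sq f u v g := f ≫ v.hom ⟶ u.hom ≫ g
  hid a := 𝟙 a
  hcomp f g := f ≫ g
  vid a := Equivalence.id a
  vcomp u v := u.comp v
  hid_hcomp := Strict.id_comp
  hcomp_hid := Strict.comp_id
  hassoc := Strict.assoc
  vid_vcomp := Equivalence.id_comp'
  vcomp_vid := Equivalence.comp_id'
  vassoc := Equivalence.assoc'
  sqHid u := (λ_ u.hom).hom ≫ (ρ_ u.hom).inv
  sqVid f := (ρ_ f).hom ≫ (λ_ f).inv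
  sqHcomp {_ _ _ _ _ _ f f' u v x g g'} α β :=
    (α_ f f' x.hom).hom ≫ f ◁ β ≫ (α_ f v.hom g').inv ≫ α ▷ g' ≫ (α_ u.hom g g').hom
  sqVcomp {_ _ _ _ _ _ f u v g u' v' h} α β :=
    (α_ f v.hom v'.hom).inv ≫ α ▷ v'.hom ≫ (α_ u.hom g v'.hom).hom ≫ u.hom ◁ β ≫
      (α_ u.hom u'.hom h).inv
  sqHid_sqHcomp {_ _ _ _ f u v g} α := by
    refine heq_of_eqToHom (by rw [Strict.id_comp]) (by rw [Strict.id_comp]) ?_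
    trans (λ_ f).hom ▷ v.hom ≫ α ≫ u.hom ◁ (λ_ g).inv
    · bicategory
    · simp [Strict.leftUnitor_eqToIso]
  sqHcomp_sqHid {_ _ _ _ f u v g} α := by
    refine heq_of_eqToHom (by rw [Strict.comp_id]) (by rw [Strict.comp_id]) ?_
    trans (ρ_ f).hom ▷ v.hom ≫ α ≫ u.hom ◁ (ρ_ g).inv
    · bicategory
    · simp [Strict.rightUnitor_eqToIso]
  sqHassoc {_ _ _ _ _ _ _ _ f f' f'' u v x y g g' g''} α β γ := by
    refine heq_of_eqToHom (by rw [Strict.assoc f f' f'']) (by rw [Strict.assoc g g' g'']) ?_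
    trans (α_ f f' f'').hom ▷ y.hom ≫ ((α_ f (f' ≫ f'') y.hom).hom ≫
      f ◁ ((α_ f' f'' y.hom).hom ≫ f' ◁ γ ≫ (α_ f' x.hom g'').inv ≫ β ▷ g'' ≫
        (α_ v.hom g' g'').hom) ≫ (α_ f v.hom (g' ≫ g'')).inv ≫ α ▷ (g' ≫ g'') ≫
        (α_ u.hom g (g' ≫ g'')).hom) ≫ u.hom ◁ (α_ g g' g'').inv
    · bicategory
    · simp [Strict.associator_eqToIso]
  sqVid_sqVcomp {_ _ _ _ f u v g} α := by
    refine heq_of_eqToHom (congrArg (f ≫ ·) (Strict.id_comp v.hom))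
      (congrArg (· ≫ g) (Strict.id_comp u.hom)) ?_
    dsimp only [Equivalence.id, Equivalence.comp]
    trans f ◁ (λ_ v.hom).hom ≫ α ≫ (λ_ u.hom).inv ▷ g
    · bicategory
    · rw [Equivalence.whiskerLeft_leftUnitor_eq, Equivalence.leftUnitor_inv_whiskerRight_eq]
  sqVcomp_sqVid {_ _ _ _ f u v g} α := by
    refine heq_of_eqToHom (congrArg (f ≫ ·) (Strict.comp_id v.hom))
      (congrArg (· ≫ g) (Strict.comp_id u.hom)) ?_
    dsimp only [Equivalence.id, Equivalence.comp]
    trans f ◁ (ρ_ v.hom).hom ≫ α ≫ (ρ_ u.hom).inv ▷ g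
    · bicategory
    · rw [Equivalence.whiskerLeft_rightUnitor_eq, Equivalence.rightUnitor_inv_whiskerRight_eq]
  sqVassoc {_ _ _ _ _ _ _ _ f f₁ f₂ f₃ u v u₁ v₁ u₂ v₂} α β γ := by
    refine heq_of_eqToHom (congrArg (f ≫ ·) (Strict.assoc v.hom v₁.hom v₂.hom))
      (congrArg (· ≫ f₃) (Strict.assoc u.hom u₁.hom u₂.hom)) ?_
    dsimp only [Equivalence.comp]
    trans f ◁ (α_ v.hom v₁.hom v₂.hom).hom ≫ ((α_ f v.hom (v₁.hom ≫ v₂.hom)).inv ≫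
      α ▷ (v₁.hom ≫ v₂.hom) ≫ (α_ u.hom f₁ (v₁.hom ≫ v₂.hom)).hom ≫
        u.hom ◁ ((α_ f₁ v₁.hom v₂.hom).inv ≫ β ▷ v₂.hom ≫ (α_ u₁.hom f₂ v₂.hom).hom ≫
          u₁.hom ◁ γ ≫ (α_ u₁.hom u₂.hom f₃).inv) ≫
        (α_ u.hom (u₁.hom ≫ u₂.hom) f₃).inv) ≫ (α_ u.hom u₁.hom u₂.hom).inv ▷ f₃
    · bicategory
    · rw [Equivalence.whiskerLeft_associator_eq, Equivalence.associator_inv_whiskerRight_eq]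
  sqHid_vid a := by dsimp only [Equivalence.id]; bicategory
  sqHid_vcomp u v := by dsimp only [Equivalence.comp]; bicategory
  sqVid_hcomp f g := by dsimp only [Equivalence.id]; bicategory
  interchange {_ _ _ _ _ _ _ _ _ f f' u v x g g' u' v' x' h h'} α β γ δ := by
    dsimp only [Equivalence.comp]
    calc
      _ = 𝟙 _ ⊗≫ f ◁ β ▷ x'.hom ⊗≫ (α ▷ (g' ≫ x'.hom) ≫ (u.hom ≫ g) ◁ δ) ⊗≫
          u.hom ◁ γ ▷ h' ⊗≫ 𝟙 _ := by bicategory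
      _ = 𝟙 _ ⊗≫ f ◁ β ▷ x'.hom ⊗≫ ((f ≫ v.hom) ◁ δ ≫ α ▷ (v'.hom ≫ h')) ⊗≫
          u.hom ◁ γ ▷ h' ⊗≫ 𝟙 _ := by rw [whisker_exchange]
      _ = _ := by bicategory

end Hsim

end DoubleCat

/-- Paths in the directed graph on `T` with exactly one edge `x → y` whenever `r x y`. -/
inductive RelPath {T : Type} (r : T → T → Prop) (x : T) : T → Type
  | nil : RelPath r x x
  | cons {y z : T} (p : RelPath r x y) (e : r y z) : RelPath r x z

namespace RelPath

variable {T T' T'' : Type} {r : T → T → Prop} {r' : T' → T' → Prop} {r'' : T'' → T'' → Prop}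

/-- Concatenation of paths. -/
def comp {x y z : T} (p : RelPath r x y) : RelPath r y z → RelPath r x z
  | nil => p
  | cons q e => cons (p.comp q) e

theorem nil_comp {x y : T} (p : RelPath r x y) : nil.comp p = p := by
  induction p with
  | nil => rfl
  | cons p e ih => exact congrArg (cons · e) ih

theorem comp_assoc {x y z t : T} (p : RelPath r x y) (q : RelPath r y z) (s : RelPath r z t) :
    (p.comp q).comp s = p.comp (q.comp s) := by
  induction s with
  | nil => rfl
  | cons s e ih => exact congrArg (cons · e) ih

/-- The path consisting of one edge. -/
def single {x y : T} (e : r x y) : RelPath r x y := cons nil e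

/-- Append an edge, or nothing in the case of an equality. -/
def snoc [DecidableEq T] {x y z : T} (p : RelPath r x y) (e : y = z ∨ r y z) : RelPath r x z :=
  if h : y = z then h ▸ p else p.cons (e.resolve_left h)

/-- The action on paths of a map of vertices that sends each edge to an edge or collapses it to a
vertex. -/
def map [DecidableEq T'] (φ : T → T') (H : ∀ x y, r x y → φ x = φ y ∨ r' (φ x) (φ y)) {x y : T} :
    RelPath r x y → RelPath r' (φ x) (φ y)
  | nil => nil
  | cons p e => (map φ H p).snoc (H _ _ e)

theorem snoc_of_ne [DecidableEq T] {x y z : T} (p : RelPath r x y) (e : y = z ∨ r y z)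
    (h : y ≠ z) : p.snoc e = p.cons (e.resolve_left h) := dif_neg h

theorem snoc_heq [DecidableEq T] {x y z : T} (p : RelPath r x y) (e : y = z ∨ r y z)
    (h : y = z) : p.snoc e ≍ p := by
  subst h
  simp [snoc]

theorem snoc_self [DecidableEq T] {x y : T} (p : RelPath r x y) (e : y = y ∨ r y y) :
    p.snoc e = p := by simp [snoc]

theorem map_comp_path [DecidableEq T'] (φ : T → T')
    (H : ∀ x y, r x y → φ x = φ y ∨ r' (φ x) (φ y)) {x y z : T}
    (p : RelPath r x y) (q : RelPath r y z) :
    (p.comp q).map φ H = (p.map φ H).comp (q.map φ H) := by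
  induction q with
  | nil => rfl
  | @cons y' z' q e ih =>
    change ((p.comp q).map φ H).snoc _ = (p.map φ H).comp ((q.map φ H).snoc _)
    rw [ih]
    have key : ∀ {a b c d : T'} (p : RelPath r' a b) (q : RelPath r' b c) (e : c = d ∨ r' c d),
        (p.comp q).snoc e = p.comp (q.snoc e) := by
      intro a b c d p q e
      by_cases h : c = d
      · subst h; simp [snoc]
      · simp [snoc, h, comp]
    exact key _ _ _

theorem map_id [DecidableEq T] (hr : ∀ x, ¬ r x x)
    (H : ∀ x y, r x y → x = y ∨ r x y) {x y : T} (p : RelPath r x y) :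
    p.map (fun x => x) H = p := by
  induction p with
  | nil => rfl
  | @cons y z p e ih =>
    change (p.map (fun x => x) H).snoc _ = _
    rw [ih, snoc_of_ne _ _ (by rintro rfl; exact hr _ e)]

theorem map_map [DecidableEq T'] [DecidableEq T''] (φ : T → T') (ψ : T' → T'')
    (H : ∀ x y, r x y → φ x = φ y ∨ r' (φ x) (φ y))
    (H' : ∀ x y, r' x y → ψ x = ψ y ∨ r'' (ψ x) (ψ y))
    (H'' : ∀ x y, r x y → ψ (φ x) = ψ (φ y) ∨ r'' (ψ (φ x)) (ψ (φ y))) {x y : T}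
    (p : RelPath r x y) :
    p.map (fun x => ψ (φ x)) H'' = (p.map φ H).map ψ H' := by
  induction p with
  | nil => rfl
  | @cons y z p e ih =>
    change (p.map (fun x => ψ (φ x)) H'').snoc _ = ((p.map φ H).snoc _).map ψ H'
    rw [ih]
    have key : ∀ {a b c : T'} (p : RelPath r' a b) (e : b = c ∨ r' b c)
        (e' : ψ b = ψ c ∨ r'' (ψ b) (ψ c)), (p.map ψ H').snoc e' = (p.snoc e).map ψ H' := by
      intro a b c p e e'
      by_cases h : b = c
      · subst h; simp [snoc]
      · simp only [snoc_of_ne _ _ h]; rfl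
    exact key _ _ _

end RelPath

namespace DoubleCat

/-- The double category with object set `T` whose horizontal and vertical categories are the free
categories on the graphs `h` and `v`, with exactly one square for every boundary. -/
def free (T : Type) (h v : T → T → Prop) : DoubleCat.{0, 0, 0, 0} where
  Obj := T
  Hor := RelPath h
  Ver := RelPath v
  Sq _ _ _ _ := Unit
  hid _ := .nil
  hcomp := .comp
  vid _ := .nil
  vcomp := .comp
  hid_hcomp := RelPath.nil_comp
  hcomp_hid _ := rfl
  hassoc := RelPath.comp_assoc
  vid_vcomp := RelPath.nil_comp
  vcomp_vid _ := rfl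
  vassoc := RelPath.comp_assoc
  sqHid _ := ()
  sqVid _ := ()
  sqHcomp _ _ := ()
  sqVcomp _ _ := ()
  sqHid_sqHcomp _ := HEq.rfl
  sqHcomp_sqHid _ := HEq.rfl
  sqHassoc _ _ _ := HEq.rfl
  sqVid_sqVcomp _ := HEq.rfl
  sqVcomp_sqVid _ := HEq.rfl
  sqVassoc _ _ _ := HEq.rfl
  sqHid_vid _ := rfl
  sqHid_vcomp _ _ := rfl
  sqVid_hcomp _ _ := rfl
  interchange _ _ _ _ := rfl

/-- The double functor induced by a map of vertices that sends edges to edges or vertices. -/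
def freeMap {T T' : Type} [DecidableEq T'] {h v : T → T → Prop} {h' v' : T' → T' → Prop}
    (φ : T → T') (H : ∀ x y, h x y → φ x = φ y ∨ h' (φ x) (φ y))
    (V : ∀ x y, v x y → φ x = φ y ∨ v' (φ x) (φ y)) :
    DoubleFunctor (free T h v) (free T' h' v') where
  obj := φ
  hor := RelPath.map φ H
  ver := RelPath.map φ V
  sq _ := ()
  hor_id _ := rfl
  hor_comp := RelPath.map_comp_path φ H
  ver_id _ := rfl
  ver_comp := RelPath.map_comp_path φ V
  sq_hid _ := HEq.rfl
  sq_vid _ := HEq.rfl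
  sq_hcomp _ _ := HEq.rfl
  sq_vcomp _ _ := HEq.rfl

/-- The vertices of the `(i, j, k)`-th cosimplicial double category. -/
abbrev Grid (i j k : SimplexCategory) : Type := Fin (i.len + 1) × Fin (j.len + 1) × Fin (k.len + 1)

/-- Generating horizontal morphisms: in direction `i` only upwards, in direction `k` both ways. -/
def gridHor (i j k : SimplexCategory) (x y : Grid i j k) : Prop :=
  (x.1 < y.1 ∧ x.2 = y.2) ∨ (x.1 = y.1 ∧ x.2.1 = y.2.1 ∧ x.2.2 ≠ y.2.2)

/-- Generating vertical morphisms: in direction `j`, upwards. -/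
def gridVer (i j k : SimplexCategory) (x y : Grid i j k) : Prop :=
  x.1 = y.1 ∧ x.2.1 < y.2.1 ∧ x.2.2 = y.2.2

/-- The double category `𝕏_{i,j,k} = V Õ_j ⊗ H Õ_i ⊗ H Ô_k`. Here `Õ_n` is the `n`-th oriental,
truncated to a 2-category with invertible 2-morphisms: its category of morphisms is free on one
morphism `a → b` for all `0 ≤ a < b ≤ n`, and there is exactly one 2-morphism between any two
parallel morphisms. `Ô_n` arises from `Õ_n` by freely turning these generators into adjoint
equivalences: its category of morphisms is free on one morphism `a → b` for all `a ≠ b`, again with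
exactly one 2-morphism between any two parallel morphisms. The Gray tensor product `H A ⊗ H B` is
`H` of the pseudo Gray tensor product of `A` and `B`, whose generating morphisms are those
of `A` and of `B`, whereas `V A ⊗ H B` is the cartesian product of `V A` and `H B`. So `𝕏_{i,j,k}`
is free on the given horizontal and vertical edges of the grid, with exactly one square for every
boundary. -/
def X (i j k : SimplexCategory) : DoubleCat.{0, 0, 0, 0} :=
  free (Grid i j k) (gridHor i j k) (gridVer i j k)

/-- The map of grids induced by three simplicial operators. -/
def gridMap {i j k i' j' k' : SimplexCategory} (α : i ⟶ i') (β : j ⟶ j') (γ : k ⟶ k')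
    (x : Grid i j k) : Grid i' j' k' :=
  (α.toOrderHom x.1, β.toOrderHom x.2.1, γ.toOrderHom x.2.2)

section

variable {i j k i' j' k' i'' j'' k'' : SimplexCategory} (α : i ⟶ i') (β : j ⟶ j') (γ : k ⟶ k')
  (α' : i' ⟶ i'') (β' : j' ⟶ j'') (γ' : k' ⟶ k'')

theorem gridMap_hor (x y : Grid i j k) (e : gridHor i j k x y) :
    gridMap α β γ x = gridMap α β γ y ∨
      gridHor i' j' k' (gridMap α β γ x) (gridMap α β γ y) := by
  obtain ⟨a, b, c⟩ := x
  obtain ⟨a', b', c'⟩ := y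
  simp only [gridHor, gridMap, Prod.mk.injEq] at e ⊢
  rcases e with ⟨h, rfl, rfl⟩ | ⟨rfl, rfl, h⟩
  · have := lt_or_eq_of_le (α.toOrderHom.monotone h.le)
    tauto
  · tauto

theorem gridMap_ver (x y : Grid i j k) (e : gridVer i j k x y) :
    gridMap α β γ x = gridMap α β γ y ∨
      gridVer i' j' k' (gridMap α β γ x) (gridMap α β γ y) := by
  obtain ⟨a, b, c⟩ := x
  obtain ⟨a', b', c'⟩ := y
  simp only [gridVer, gridMap, Prod.mk.injEq] at e ⊢
  obtain ⟨rfl, h, rfl⟩ := e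
  have := lt_or_eq_of_le (β.toOrderHom.monotone h.le)
  tauto

/-- The functoriality of `𝕏` in three simplicial operators. -/
def Xmap : DoubleFunctor (X i j k) (X i' j' k') :=
  freeMap (gridMap α β γ) (gridMap_hor α β γ) (gridMap_ver α β γ)

theorem Xmap_id (i j k : SimplexCategory) : Xmap (𝟙 i) (𝟙 j) (𝟙 k) = DoubleFunctor.id _ := by
  refine DoubleFunctor.ext_of_heq rfl ?_ ?_ ?_
  · intro a b f
    refine heq_of_eq (RelPath.map_id ?_ _ f)
    rintro x (⟨h, _⟩ | ⟨_, _, h⟩)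
    · exact lt_irrefl _ h
    · exact h rfl
  · intro a b f
    refine heq_of_eq (RelPath.map_id ?_ _ f)
    rintro x ⟨_, h, _⟩
    exact lt_irrefl _ h
  · intros; rfl

theorem Xmap_comp : Xmap (α ≫ α') (β ≫ β') (γ ≫ γ') = (Xmap α β γ).comp (Xmap α' β' γ') := by
  refine DoubleFunctor.ext_of_heq rfl ?_ ?_ ?_
  · intro a b f
    exact heq_of_eq (RelPath.map_map (gridMap α β γ) (gridMap α' β' γ') (gridMap_hor α β γ)
      (gridMap_hor α' β' γ') (gridMap_hor (α ≫ α') (β ≫ β') (γ ≫ γ')) f)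
  · intro a b f
    exact heq_of_eq (RelPath.map_map (gridMap α β γ) (gridMap α' β' γ') (gridMap_ver α β γ)
      (gridMap_ver α' β' γ') (gridMap_ver (α ≫ α') (β ≫ β') (γ ≫ γ')) f)
  · intros; rfl

end

end DoubleCat

open Opposite in
/-- The trisimplicial set `(i, j, k) ↦ DblCat(𝕏_{i,j,k}, ℍ^≃ D)`. If `L^≃` denotes the left adjoint
of `ℍ^≃`, this is `(i, j, k) ↦ 2Cat(L^≃ 𝕏_{i,j,k}, D)`. -/
def nerveTri (D : Type u) [Bicategory.{w, v} D] [Strict D] :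
    (SimplexCategory × SimplexCategory)ᵒᵖ × SimplexCategoryᵒᵖ ⥤ Type (max u v w) where
  obj n := DoubleFunctor (DoubleCat.X n.1.unop.1 n.1.unop.2 n.2.unop) (DoubleCat.Hsim D)
  map {m n} f := ↾ fun G => (DoubleCat.Xmap f.1.unop.1 f.1.unop.2 f.2.unop).comp G
  map_id n := by
    ext G
    change (DoubleCat.Xmap (𝟙 _) (𝟙 _) (𝟙 _)).comp G = G
    rw [DoubleCat.Xmap_id]
    rfl
  map_comp f g := by
    ext G
    change (DoubleCat.Xmap (_ ≫ _) (_ ≫ _) (_ ≫ _)).comp G = _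
    rw [DoubleCat.Xmap_comp]
    rfl

/-- The nerve of a 2-category `D` as a bisimplicial space, i.e. as a bisimplicial object
`(i, j) ↦ (k ↦ DblCat(𝕏_{i,j,k}, ℍ^≃ D))` in simplicial sets. -/
def bisimplicialNerve (D : Type u) [Bicategory.{w, v} D] [Strict D] :
    (SimplexCategory × SimplexCategory)ᵒᵖ ⥤ SSet.{max u v w} :=
  Functor.curry.obj (nerveTri D)

namespace CategoryTheory.StrictlyUnitaryPseudofunctor

variable {A B : Type u} [Bicategory.{w, v} A] [Bicategory.{w, v} B]
  (F : StrictlyUnitaryPseudofunctor A B)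

/-- The image of an adjoint equivalence under a normal pseudofunctor. -/
def mapEquiv {a b : A} (e : a ≌ b) : F.obj a ≌ F.obj b where
  hom := F.map e.hom
  inv := F.map e.inv
  unit := (F.mapId a).symm ≪≫ F.map₂Iso e.unit ≪≫ F.mapComp e.hom e.inv
  counit := (F.mapComp e.inv e.hom).symm ≪≫ F.map₂Iso e.counit ≪≫ F.mapId b
  left_triangle := by
    ext
    exact (F.toPseudofunctor.mapAdjunction
      (⟨e.unit.hom, e.counit.hom, e.left_triangle_hom, e.right_triangle_hom⟩ :
        Bicategory.Adjunction e.hom e.inv)).left_triangle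

/-- Given isomorphisms `F f ≅ f'` and `F g ≅ g'`, the isomorphism `F (g ∘ f) ≅ g' ∘ f'` obtained
from the compositor of `F`. -/
def compIso {a b c : A} {f : a ⟶ b} {g : b ⟶ c} {f' : F.obj a ⟶ F.obj b}
    {g' : F.obj b ⟶ F.obj c} (θ : F.map f ≅ f') (θ' : F.map g ≅ g') :
    F.map (f ≫ g) ≅ f' ≫ g' :=
  F.mapComp f g ≪≫ whiskerRightIso θ (F.map g) ≪≫ whiskerLeftIso f' θ'

/-- The 2-morphism `F α`, conjugated by isomorphisms `F f ≅ f'` and `F g ≅ g'`. -/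
def conj {a b : A} {f g : a ⟶ b} {f' g' : F.obj a ⟶ F.obj b} (θ : F.map f ≅ f')
    (θ' : F.map g ≅ g') (α : f ⟶ g) : f' ⟶ g' :=
  θ.inv ≫ F.map₂ α ≫ θ'.hom

section

variable {a b c d : A} {f f₁ f₂ : a ⟶ b} {g g₁ g₂ : b ⟶ c} {h : c ⟶ d}
  {f' f₁' f₂' : F.obj a ⟶ F.obj b} {g' g₁' g₂' : F.obj b ⟶ F.obj c} {h' : F.obj c ⟶ F.obj d}

theorem conj_comp (θ : F.map f ≅ f') (θ₁ : F.map f₁ ≅ f₁') (θ₂ : F.map f₂ ≅ f₂')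
    (α : f ⟶ f₁) (β : f₁ ⟶ f₂) : F.conj θ θ₂ (α ≫ β) = F.conj θ θ₁ α ≫ F.conj θ₁ θ₂ β := by
  simp [conj]

theorem conj_whiskerLeft (θ : F.map f ≅ f') (θ₁ : F.map g₁ ≅ g₁') (θ₂ : F.map g₂ ≅ g₂')
    (α : g₁ ⟶ g₂) : F.conj (F.compIso θ θ₁) (F.compIso θ θ₂) (f ◁ α) = f' ◁ F.conj θ₁ θ₂ α := by
  simp only [conj, compIso, Iso.trans_inv, Iso.trans_hom, whiskerRightIso_inv, whiskerLeftIso_inv,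
    whiskerRightIso_hom, whiskerLeftIso_hom, F.map₂_whisker_left, Category.assoc,
    Iso.inv_hom_id_assoc, Bicategory.whiskerLeft_comp]
  rw [whisker_exchange_assoc θ.hom (F.map₂ α), inv_hom_whiskerRight_assoc]

theorem conj_whiskerRight (θ₁ : F.map f₁ ≅ f₁') (θ₂ : F.map f₂ ≅ f₂') (θ : F.map g ≅ g')
    (α : f₁ ⟶ f₂) : F.conj (F.compIso θ₁ θ) (F.compIso θ₂ θ) (α ▷ g) = F.conj θ₁ θ₂ α ▷ g' := by
  simp only [conj, compIso, Iso.trans_inv, Iso.trans_hom, whiskerRightIso_inv, whiskerLeftIso_inv,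
    whiskerRightIso_hom, whiskerLeftIso_hom, F.map₂_whisker_right, Category.assoc,
    Iso.inv_hom_id_assoc, Bicategory.comp_whiskerRight]
  rw [← whisker_exchange, ← whisker_exchange_assoc, ← whisker_exchange_assoc,
    whiskerLeft_inv_hom_assoc]

theorem conj_associator (θ : F.map f ≅ f') (θ₁ : F.map g ≅ g') (θ₂ : F.map h ≅ h') :
    F.conj (F.compIso (F.compIso θ θ₁) θ₂) (F.compIso θ (F.compIso θ₁ θ₂)) (α_ f g h).hom =
      (α_ f' g' h').hom := by
  simp only [conj, Iso.inv_comp_eq]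
  simp only [compIso, Iso.trans_hom, whiskerRightIso_hom,
    whiskerLeftIso_hom, F.map₂_associator, Category.assoc, Bicategory.whiskerLeft_comp,
    Bicategory.comp_whiskerRight, Iso.inv_hom_id_assoc]
  rw [whisker_exchange_assoc θ.hom (F.mapComp g h).inv, whiskerLeft_inv_hom_assoc]
  simp

theorem conj_id (θ : F.map f ≅ f') : F.conj θ θ (𝟙 f) = 𝟙 f' := by simp [conj]

theorem conj_associator_inv (θ : F.map f ≅ f') (θ₁ : F.map g ≅ g') (θ₂ : F.map h ≅ h') :
    F.conj (F.compIso θ (F.compIso θ₁ θ₂)) (F.compIso (F.compIso θ θ₁) θ₂) (α_ f g h).inv =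
      (α_ f' g' h').inv := by
  rw [← cancel_mono (α_ f' g' h').hom, ← F.conj_associator θ θ₁ θ₂, ← conj_comp,
    Iso.inv_hom_id, conj_id, F.conj_associator, Iso.inv_hom_id]

theorem conj_leftUnitor (θ : F.map f ≅ f') :
    F.conj (F.compIso (F.mapId a) θ) θ (λ_ f).hom = (λ_ f').hom := by
  simp [conj, compIso]

theorem conj_rightUnitor (θ : F.map f ≅ f') :
    F.conj (F.compIso θ (F.mapId b)) θ (ρ_ f).hom = (ρ_ f').hom := by
  simp only [conj, Iso.inv_comp_eq]
  simp only [compIso, Iso.trans_hom, whiskerRightIso_hom, whiskerLeftIso_hom, Category.assoc,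
    F.map₂_right_unitor]
  rw [← whisker_exchange_assoc θ.hom (F.mapId b).hom]
  simp

theorem conj_leftUnitor_inv (θ : F.map f ≅ f') :
    F.conj θ (F.compIso (F.mapId a) θ) (λ_ f).inv = (λ_ f').inv := by
  rw [← cancel_mono (λ_ f').hom, ← F.conj_leftUnitor θ, ← conj_comp,
    Iso.inv_hom_id, conj_id, F.conj_leftUnitor, Iso.inv_hom_id]

theorem conj_rightUnitor_inv (θ : F.map f ≅ f') :
    F.conj θ (F.compIso θ (F.mapId b)) (ρ_ f).inv = (ρ_ f').inv := by
  rw [← cancel_mono (ρ_ f').hom, ← F.conj_rightUnitor θ, ← conj_comp,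
    Iso.inv_hom_id, conj_id, F.conj_rightUnitor, Iso.inv_hom_id]

end

section

variable {a b c a' b' c' : A}

theorem conj_sqHid {u : a ⟶ b} {u' : F.obj a ⟶ F.obj b} (θ : F.map u ≅ u') :
    F.conj (F.compIso (F.mapId a) θ) (F.compIso θ (F.mapId b)) ((λ_ u).hom ≫ (ρ_ u).inv) =
      (λ_ u').hom ≫ (ρ_ u').inv := by
  rw [F.conj_comp _ θ, F.conj_leftUnitor, F.conj_rightUnitor_inv]

theorem conj_sqVid {f : a ⟶ b} {f' : F.obj a ⟶ F.obj b} (θ : F.map f ≅ f') :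
    F.conj (F.compIso θ (F.mapId b)) (F.compIso (F.mapId a) θ) ((ρ_ f).hom ≫ (λ_ f).inv) =
      (ρ_ f').hom ≫ (λ_ f').inv := by
  rw [F.conj_comp _ θ, F.conj_rightUnitor, F.conj_leftUnitor_inv]

theorem conj_sqHcomp {f₁ : a ⟶ b} {f₂ : b ⟶ c} {u : a ⟶ a'} {v : b ⟶ b'} {x : c ⟶ c'}
    {g₁ : a' ⟶ b'} {g₂ : b' ⟶ c'} {f₁' : F.obj a ⟶ F.obj b} {f₂' : F.obj b ⟶ F.obj c}
    {u' : F.obj a ⟶ F.obj a'} {v' : F.obj b ⟶ F.obj b'} {x' : F.obj c ⟶ F.obj c'}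
    {g₁' : F.obj a' ⟶ F.obj b'} {g₂' : F.obj b' ⟶ F.obj c'}
    (θf₁ : F.map f₁ ≅ f₁') (θf₂ : F.map f₂ ≅ f₂') (θu : F.map u ≅ u') (θv : F.map v ≅ v')
    (θx : F.map x ≅ x') (θg₁ : F.map g₁ ≅ g₁') (θg₂ : F.map g₂ ≅ g₂')
    (α : f₁ ≫ v ⟶ u ≫ g₁) (β : f₂ ≫ x ⟶ v ≫ g₂) :
    F.conj (F.compIso (F.compIso θf₁ θf₂) θx) (F.compIso θu (F.compIso θg₁ θg₂))
      ((α_ f₁ f₂ x).hom ≫ f₁ ◁ β ≫ (α_ f₁ v g₂).inv ≫ α ▷ g₂ ≫ (α_ u g₁ g₂).hom) =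
    (α_ f₁' f₂' x').hom ≫ f₁' ◁ F.conj (F.compIso θf₂ θx) (F.compIso θv θg₂) β ≫
      (α_ f₁' v' g₂').inv ≫ F.conj (F.compIso θf₁ θv) (F.compIso θu θg₁) α ▷ g₂' ≫
      (α_ u' g₁' g₂').hom := by
  rw [F.conj_comp _ (F.compIso θf₁ (F.compIso θf₂ θx)), F.conj_associator,
    F.conj_comp _ (F.compIso θf₁ (F.compIso θv θg₂)), F.conj_whiskerLeft,
    F.conj_comp _ (F.compIso (F.compIso θf₁ θv) θg₂), F.conj_associator_inv,
    F.conj_comp _ (F.compIso (F.compIso θu θg₁) θg₂), F.conj_whiskerRight, F.conj_associator]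

theorem conj_sqVcomp {f : a ⟶ a'} {u₁ : a ⟶ b} {v₁ : a' ⟶ b'} {g : b ⟶ b'} {u₂ : b ⟶ c}
    {v₂ : b' ⟶ c'} {h : c ⟶ c'} {f' : F.obj a ⟶ F.obj a'} {u₁' : F.obj a ⟶ F.obj b}
    {v₁' : F.obj a' ⟶ F.obj b'} {g' : F.obj b ⟶ F.obj b'} {u₂' : F.obj b ⟶ F.obj c}
    {v₂' : F.obj b' ⟶ F.obj c'} {h' : F.obj c ⟶ F.obj c'}
    (θf : F.map f ≅ f') (θu₁ : F.map u₁ ≅ u₁') (θv₁ : F.map v₁ ≅ v₁') (θg : F.map g ≅ g')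
    (θu₂ : F.map u₂ ≅ u₂') (θv₂ : F.map v₂ ≅ v₂') (θh : F.map h ≅ h')
    (α : f ≫ v₁ ⟶ u₁ ≫ g) (β : g ≫ v₂ ⟶ u₂ ≫ h) :
    F.conj (F.compIso θf (F.compIso θv₁ θv₂)) (F.compIso (F.compIso θu₁ θu₂) θh)
      ((α_ f v₁ v₂).inv ≫ α ▷ v₂ ≫ (α_ u₁ g v₂).hom ≫ u₁ ◁ β ≫ (α_ u₁ u₂ h).inv) =
    (α_ f' v₁' v₂').inv ≫ F.conj (F.compIso θf θv₁) (F.compIso θu₁ θg) α ▷ v₂' ≫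
      (α_ u₁' g' v₂').hom ≫ u₁' ◁ F.conj (F.compIso θg θv₂) (F.compIso θu₂ θh) β ≫
      (α_ u₁' u₂' h').inv := by
  rw [F.conj_comp _ (F.compIso (F.compIso θf θv₁) θv₂), F.conj_associator_inv,
    F.conj_comp _ (F.compIso (F.compIso θu₁ θg) θv₂), F.conj_whiskerRight,
    F.conj_comp _ (F.compIso θu₁ (F.compIso θg θv₂)), F.conj_associator,
    F.conj_comp _ (F.compIso θu₁ (F.compIso θu₂ θh)), F.conj_whiskerLeft, F.conj_associator_inv]

end

theorem mapEquiv_id (a : A) : F.mapEquiv (Equivalence.id a) = Equivalence.id (F.obj a) := by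
  refine Equivalence.mk_eq (F.map_id a) (F.map_id a) ?_ ?_
  · have h := F.conj_rightUnitor_inv (F.mapId a)
    simp only [conj, compIso, Iso.trans_hom, whiskerRightIso_hom, whiskerLeftIso_hom] at h
    dsimp only [Equivalence.id]
    simp only [Iso.symm_hom, Iso.trans_hom]
    rw [← h]
    simp only [F.mapId_eq_eqToIso, eqToIso.hom, eqToIso.inv, eqToHom_whiskerRight,
      whiskerLeft_eqToHom, Category.assoc, eqToHom_trans]
    erw [eqToHom_trans, eqToHom_refl, Category.comp_id (F.mapComp (𝟙 a) (𝟙 a)).hom]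
    rfl
  · have h := F.conj_rightUnitor (F.mapId a)
    simp only [conj, compIso, Iso.trans_inv, whiskerRightIso_inv, whiskerLeftIso_inv] at h
    dsimp only [Equivalence.id]
    simp only [Iso.symm_hom, Iso.trans_hom]
    rw [← h]
    simp only [F.mapId_eq_eqToIso, eqToIso.hom, eqToIso.inv, eqToHom_whiskerRight,
      whiskerLeft_eqToHom, Category.assoc, eqToHom_trans_assoc]
    erw [eqToHom_trans_assoc, eqToHom_refl,
      Category.id_comp ((F.mapComp (𝟙 a) (𝟙 a)).inv ≫ F.map₂ (ρ_ (𝟙 a)).hom ≫ _)]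
    rfl

/-- A morphism `a ⟶ b` of `A` together with a morphism `F a ⟶ F b` isomorphic to its image. -/
structure RepHor (a b : A) where
  base : a ⟶ b
  rep : F.obj a ⟶ F.obj b
  iso : F.map base ≅ rep

/-- An adjoint equivalence `a ≌ b` of `A` together with an adjoint equivalence `F a ≌ F b`
whose underlying morphism is isomorphic to the image. -/
structure RepVer (a b : A) where
  base : a ≌ b
  rep : F.obj a ≌ F.obj b
  iso : F.map base.hom ≅ rep.hom

section

variable {F}

theorem RepHor.ext' {a b : A} {x y : F.RepHor a b} (h : x.base = y.base) (h' : x.rep = y.rep)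
    (hi : F.conj x.iso y.iso (eqToHom h) = eqToHom h') : x = y := by
  obtain ⟨f, f', i⟩ := x
  obtain ⟨g, g', j⟩ := y
  obtain rfl : f = g := h
  obtain rfl : f' = g' := h'
  obtain rfl : i = j := by
    ext
    simpa [conj, Iso.eq_inv_comp, eq_comm] using hi
  rfl

theorem RepVer.ext' {a b : A} {x y : F.RepVer a b} (h : x.base = y.base) (h' : x.rep = y.rep)
    (hi : F.conj x.iso y.iso (eqToHom (by rw [h])) = eqToHom (by rw [h'])) : x = y := by
  obtain ⟨f, f', i⟩ := x
  obtain ⟨g, g', j⟩ := y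
  obtain rfl : f = g := h
  obtain rfl : f' = g' := h'
  obtain rfl : i = j := by
    ext
    simpa [conj, Iso.eq_inv_comp, eq_comm] using hi
  rfl

end

theorem repHor_id {a : A} {f : a ⟶ a} (h : 𝟙 a = f) :
    (⟨𝟙 a, 𝟙 (F.obj a), F.mapId a⟩ : F.RepHor a a) = ⟨f, F.map f, Iso.refl _⟩ := by
  subst h
  refine RepHor.ext' rfl (F.map_id _).symm ?_
  simp [conj, F.mapId_eq_eqToIso]

theorem repVer_id {a : A} {f : Bicategory.Equivalence a a} (h : Equivalence.id a = f) :
    (⟨Equivalence.id a, Equivalence.id (F.obj a), F.mapId a⟩ : F.RepVer a a) =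
      ⟨f, F.mapEquiv f, Iso.refl _⟩ := by
  subst h
  refine RepVer.ext' rfl (F.mapEquiv_id _).symm ?_
  have h : F.mapId a = eqToIso (F.map_id a) := F.mapId_eq_eqToIso a
  dsimp only [conj]
  rw [h]
  simp only [eqToIso.inv, eqToHom_refl, PrelaxFunctor.map₂_id, Iso.refl_hom]
  erw [Category.comp_id, Category.comp_id]
  rfl

variable [Strict A] [Strict B]

section

variable {a b c d : A} {f : a ⟶ b} {g : b ⟶ c} {h : c ⟶ d}
  {f' : F.obj a ⟶ F.obj b} {g' : F.obj b ⟶ F.obj c} {h' : F.obj c ⟶ F.obj d}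

theorem conj_id_comp (θ : F.map f ≅ f') :
    F.conj (F.compIso (F.mapId a) θ) θ (eqToHom (Strict.id_comp f)) =
      eqToHom (Strict.id_comp f') := by
  have h := F.conj_leftUnitor θ
  simpa only [Strict.leftUnitor_eqToIso, eqToIso.hom] using h

theorem conj_comp_id (θ : F.map f ≅ f') :
    F.conj (F.compIso θ (F.mapId b)) θ (eqToHom (Strict.comp_id f)) =
      eqToHom (Strict.comp_id f') := by
  have h := F.conj_rightUnitor θ
  simpa only [Strict.rightUnitor_eqToIso, eqToIso.hom] using h

theorem conj_assoc (θ : F.map f ≅ f') (θ₁ : F.map g ≅ g') (θ₂ : F.map h ≅ h') :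
    F.conj (F.compIso (F.compIso θ θ₁) θ₂) (F.compIso θ (F.compIso θ₁ θ₂))
      (eqToHom (Strict.assoc f g h)) = eqToHom (Strict.assoc f' g' h') := by
  have h := F.conj_associator θ θ₁ θ₂
  simpa only [Strict.associator_eqToIso, eqToIso.hom] using h

end

/-- The double category of morphisms, adjoint equivalences and squares of `A`, where all
morphisms and adjoint equivalences come with a replacement of their image under `F`. -/
def Rep : DoubleCat.{w, u, max v w, max v w} where
  Obj := A
  Hor := F.RepHor
  Ver := F.RepVer
  Sq f u v g := f.base ≫ v.base.hom ⟶ u.base.hom ≫ g.base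
  hid a := ⟨𝟙 a, 𝟙 (F.obj a), F.mapId a⟩
  hcomp f g := ⟨f.base ≫ g.base, f.rep ≫ g.rep, F.compIso f.iso g.iso⟩
  vid a := ⟨Equivalence.id a, Equivalence.id (F.obj a), F.mapId a⟩
  vcomp u v := ⟨u.base.comp v.base, u.rep.comp v.rep, F.compIso u.iso v.iso⟩
  hid_hcomp f := RepHor.ext' (Strict.id_comp _) (Strict.id_comp _) (F.conj_id_comp f.iso)
  hcomp_hid f := RepHor.ext' (Strict.comp_id _) (Strict.comp_id _) (F.conj_comp_id f.iso)
  hassoc f g h := RepHor.ext' (Strict.assoc _ _ _) (Strict.assoc _ _ _)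
    (F.conj_assoc f.iso g.iso h.iso)
  vid_vcomp f := RepVer.ext' (Equivalence.id_comp' _) (Equivalence.id_comp' _)
    (F.conj_id_comp f.iso)
  vcomp_vid f := RepVer.ext' (Equivalence.comp_id' _) (Equivalence.comp_id' _)
    (F.conj_comp_id f.iso)
  vassoc f g h := RepVer.ext' (Equivalence.assoc' _ _ _) (Equivalence.assoc' _ _ _)
    (F.conj_assoc f.iso g.iso h.iso)
  sqHid u := (DoubleCat.Hsim A).sqHid u.base
  sqVid f := (DoubleCat.Hsim A).sqVid f.base
  sqHcomp α β := (DoubleCat.Hsim A).sqHcomp α β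
  sqVcomp α β := (DoubleCat.Hsim A).sqVcomp α β
  sqHid_sqHcomp α := (DoubleCat.Hsim A).sqHid_sqHcomp α
  sqHcomp_sqHid α := (DoubleCat.Hsim A).sqHcomp_sqHid α
  sqHassoc α β γ := (DoubleCat.Hsim A).sqHassoc α β γ
  sqVid_sqVcomp α := (DoubleCat.Hsim A).sqVid_sqVcomp α
  sqVcomp_sqVid α := (DoubleCat.Hsim A).sqVcomp_sqVid α
  sqVassoc α β γ := (DoubleCat.Hsim A).sqVassoc α β γ
  sqHid_vid a := (DoubleCat.Hsim A).sqHid_vid a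
  sqHid_vcomp u v := (DoubleCat.Hsim A).sqHid_vcomp u.base v.base
  sqVid_hcomp f g := (DoubleCat.Hsim A).sqVid_hcomp f.base g.base
  interchange α β γ δ := (DoubleCat.Hsim A).interchange α β γ δ

/-- The double functor sending a morphism with a replacement of its image to that replacement, and
a square `α` to `F α` conjugated by the isomorphisms of its boundary with its replacement, which
involve the compositors of `F`. -/
def repImage : DoubleFunctor F.Rep (DoubleCat.Hsim B) where
  obj := F.obj
  hor f := f.rep
  ver u := u.rep
  sq {_ _ _ _ f u v g} α := F.conj (F.compIso f.iso v.iso) (F.compIso u.iso g.iso) α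
  hor_id _ := rfl
  hor_comp _ _ := rfl
  ver_id _ := rfl
  ver_comp _ _ := rfl
  sq_hid u := heq_of_eq (F.conj_sqHid u.iso)
  sq_vid f := heq_of_eq (F.conj_sqVid f.iso)
  sq_hcomp {_ _ _ _ _ _ f f' u v x g g'} α β :=
    heq_of_eq (F.conj_sqHcomp f.iso f'.iso u.iso v.iso x.iso g.iso g'.iso α β)
  sq_vcomp {_ _ _ _ _ _ f u v g u' v' h} α β :=
    heq_of_eq (F.conj_sqVcomp f.iso u.iso v.iso g.iso u'.iso v'.iso h.iso α β)

section

variable {T : Type} {h v : T → T → Prop}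
  (G : DoubleFunctor (DoubleCat.free T h v) (DoubleCat.Hsim A))

/-- The image under `G` of a path of horizontal morphisms, with the composite of the images
`F (G e)` of its edges as a replacement of its image. -/
def liftHor {x y : T} : RelPath h x y → F.RepHor (G.obj x) (G.obj y)
  | .nil => F.Rep.hid (G.obj x)
  | .cons p e => F.Rep.hcomp (liftHor p)
      ⟨G.hor (RelPath.single e), F.map (G.hor (RelPath.single e)), Iso.refl _⟩

/-- The image under `G` of a path of vertical morphisms, with the composite of the images
`F (G e)` of its edges as a replacement of its image. -/
def liftVer {x y : T} : RelPath v x y → F.RepVer (G.obj x) (G.obj y)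
  | .nil => F.Rep.vid (G.obj x)
  | .cons p e => F.Rep.vcomp (liftVer p)
      ⟨G.ver (RelPath.single e), F.mapEquiv (G.ver (RelPath.single e)), Iso.refl _⟩

theorem liftHor_base {x y : T} (p : RelPath h x y) : (F.liftHor G p).base = G.hor p := by
  induction p with
  | nil => exact (G.hor_id x).symm
  | cons p e ih =>
    refine Eq.trans ?_ (G.hor_comp p (RelPath.single e)).symm
    exact congrArg (· ≫ _) ih

theorem liftVer_base {x y : T} (p : RelPath v x y) : (F.liftVer G p).base = G.ver p := by
  induction p with
  | nil => exact (G.ver_id x).symm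
  | cons p e ih =>
    refine Eq.trans ?_ (G.ver_comp p (RelPath.single e)).symm
    exact congrArg (fun e' => (DoubleCat.Hsim A).vcomp e' (G.ver (RelPath.single e))) ih

theorem liftHor_comp {x y z : T} (p : RelPath h x y) (q : RelPath h y z) :
    F.liftHor G (p.comp q) = F.Rep.hcomp (F.liftHor G p) (F.liftHor G q) := by
  induction q with
  | nil => exact (F.Rep.hcomp_hid _).symm
  | cons q e ih => exact (congrArg (F.Rep.hcomp · _) ih).trans (F.Rep.hassoc _ _ _)

theorem liftVer_comp {x y z : T} (p : RelPath v x y) (q : RelPath v y z) :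
    F.liftVer G (p.comp q) = F.Rep.vcomp (F.liftVer G p) (F.liftVer G q) := by
  induction q with
  | nil => exact (F.Rep.vcomp_vid _).symm
  | cons q e ih => exact (congrArg (F.Rep.vcomp · _) ih).trans (F.Rep.vassoc _ _ _)

theorem liftSq_type {x y x' y' : T} (f : RelPath h x y) (u : RelPath v x x')
    (w : RelPath v y y') (g : RelPath h x' y') :
    (DoubleCat.Hsim A).Sq (G.hor f) (G.ver u) (G.ver w) (G.hor g) =
      (DoubleCat.Hsim A).Sq (F.liftHor G f).base (F.liftVer G u).base (F.liftVer G w).base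
        (F.liftHor G g).base := by
  rw [liftHor_base, liftHor_base, liftVer_base, liftVer_base]

/-- The canonical lift of a double functor on a free double category. -/
def lift : DoubleFunctor (DoubleCat.free T h v) F.Rep where
  obj := G.obj
  hor := F.liftHor G
  ver := F.liftVer G
  sq {_ _ _ _ f u w g} α := cast (F.liftSq_type G f u w g) (G.sq α)
  hor_id _ := rfl
  hor_comp := F.liftHor_comp G
  ver_id _ := rfl
  ver_comp := F.liftVer_comp G
  sq_hid u := by
    refine (cast_heq _ _).trans ((G.sq_hid u).trans ?_)
    exact DoubleCat.sqHid_heq _ (F.liftVer_base G u).symm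
  sq_vid f := by
    refine (cast_heq _ _).trans ((G.sq_vid f).trans ?_)
    exact DoubleCat.sqVid_heq _ (F.liftHor_base G f).symm
  sq_hcomp α β := by
    refine (cast_heq _ _).trans ((G.sq_hcomp α β).trans ?_)
    exact DoubleCat.sqHcomp_heq _ (F.liftHor_base G _).symm (F.liftHor_base G _).symm
      (F.liftVer_base G _).symm (F.liftVer_base G _).symm (F.liftVer_base G _).symm
      (F.liftHor_base G _).symm (F.liftHor_base G _).symm (cast_heq _ _).symm (cast_heq _ _).symm
  sq_vcomp α β := by
    refine (cast_heq _ _).trans ((G.sq_vcomp α β).trans ?_)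
    exact DoubleCat.sqVcomp_heq _ (F.liftHor_base G _).symm (F.liftVer_base G _).symm
      (F.liftVer_base G _).symm (F.liftHor_base G _).symm (F.liftVer_base G _).symm
      (F.liftVer_base G _).symm (F.liftHor_base G _).symm (cast_heq _ _).symm (cast_heq _ _).symm

/-- The double functor `F_* G` for a normal pseudofunctor `F` and a double functor `G` on a free
double category. It sends an object `x` to `F (G x)` and a generating horizontal or vertical
morphism `e` to `F (G e)`; this is extended to all morphisms by freeness. A square `α` is sent
to `F (G α)`, composed on both sides with the isomorphisms
`F (G e₁) ≫ ⋯ ≫ F (G eₙ) ≅ F (G e₁ ≫ ⋯ ≫ G eₙ)` given by the compositors of `F`. -/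
def postcomp : DoubleFunctor (DoubleCat.free T h v) (DoubleCat.Hsim B) :=
  (F.lift G).comp F.repImage

theorem liftHor_snoc [DecidableEq T] {x y z : T} (p : RelPath h x y) (e : y = z ∨ h y z) :
    F.liftHor G (p.snoc e) = F.Rep.hcomp (F.liftHor G p)
      ⟨G.hor (RelPath.snoc .nil e), F.map (G.hor (RelPath.snoc .nil e)), Iso.refl _⟩ := by
  by_cases hy : y = z
  · subst hy
    rw [RelPath.snoc_self, RelPath.snoc_self]
    refine (F.Rep.hcomp_hid _).symm.trans (congrArg (F.Rep.hcomp _) ?_)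
    exact F.repHor_id (G.hor_id y).symm
  · rw [RelPath.snoc_of_ne _ _ hy, RelPath.snoc_of_ne _ _ hy]
    rfl

theorem liftVer_snoc [DecidableEq T] {x y z : T} (p : RelPath v x y) (e : y = z ∨ v y z) :
    F.liftVer G (p.snoc e) = F.Rep.vcomp (F.liftVer G p)
      ⟨G.ver (RelPath.snoc .nil e), F.mapEquiv (G.ver (RelPath.snoc .nil e)), Iso.refl _⟩ := by
  by_cases hy : y = z
  · subst hy
    rw [RelPath.snoc_self, RelPath.snoc_self]
    refine (F.Rep.vcomp_vid _).symm.trans (congrArg (F.Rep.vcomp _) ?_)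
    exact F.repVer_id (G.ver_id y).symm
  · rw [RelPath.snoc_of_ne _ _ hy, RelPath.snoc_of_ne _ _ hy]
    rfl

theorem lift_freeMap [DecidableEq T] {T' : Type} {h' v' : T' → T' → Prop} (φ : T' → T)
    (H : ∀ x y, h' x y → φ x = φ y ∨ h (φ x) (φ y))
    (V : ∀ x y, v' x y → φ x = φ y ∨ v (φ x) (φ y)) :
    F.lift ((DoubleCat.freeMap φ H V).comp G) = (DoubleCat.freeMap φ H V).comp (F.lift G) := by
  refine DoubleFunctor.ext_of_heq rfl ?_ ?_ ?_
  · intro a b p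
    refine heq_of_eq ?_
    induction p with
    | nil => rfl
    | cons p e ih =>
      refine Eq.trans ?_ (F.liftHor_snoc G (p.map φ H) (H _ _ e)).symm
      exact congrArg (F.Rep.hcomp · _) ih
  · intro a b p
    refine heq_of_eq ?_
    induction p with
    | nil => rfl
    | cons p e ih =>
      refine Eq.trans ?_ (F.liftVer_snoc G (p.map φ V) (V _ _ e)).symm
      exact congrArg (F.Rep.vcomp · _) ih
  · intro a b c d f u w g α
    exact (cast_heq _ _).trans (cast_heq _ _).symm

end

/-- The map of trisimplicial sets `G ↦ F_* G` induced by a normal pseudofunctor `F`. -/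
def nerveTriMap : nerveTri A ⟶ nerveTri B where
  app _ := ↾ fun G => F.postcomp G
  naturality {m n} f := by
    ext G
    exact congrArg (fun L => DoubleFunctor.comp L F.repImage) (F.lift_freeMap G _ _ _)

/-- The map of bisimplicial spaces `N A ⟶ N B` induced by a normal pseudofunctor `F`. -/
def nerveMap : bisimplicialNerve A ⟶ bisimplicialNerve B :=
  Functor.curry.map F.nerveTriMap

end CategoryTheory.StrictlyUnitaryPseudofunctor

/-- A 2-category is gaunt if all its invertible 1-morphisms and all its invertible 2-morphisms are
identities. -/
structure IsGaunt (A : Type u) [Bicategory.{w, v} A] : Prop where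
  eq_id : ∀ {a b : A} (f : a ⟶ b) (g : b ⟶ a), f ≫ g = 𝟙 a → g ≫ f = 𝟙 b → a = b ∧ f ≍ 𝟙 a
  eq_id₂ : ∀ {a b : A} {f g : a ⟶ b} (η : f ≅ g), f = g ∧ η.hom ≍ 𝟙 f

/-! In a gaunt 2-category every adjoint equivalence is an identity, and every 2-morphism that comes
from a pair of mutually inverse squares is an identity. A double functor `G` from a grid `𝕏_{i,j,k}`
to `ℍ^≃ A` is therefore rigid. Parallel horizontal paths have equal images, vertical paths go to
identities, and direction `k` contributes nothing, because its edges have opposites. What remains is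
strict data: `i` composable columns of `j` composable 2-morphisms of `A`. In particular the
restriction of `G` to a vertex, an edge, a square of edges or a triangle is the standard simplex
given by an object, a morphism, a 2-morphism or a composable pair.

The target is not rigid, but a grid is a free double category with one square for each boundary. For
`k = 0` every square is pasted from squares of edges and from triangles that replace two consecutive
edges by one, so a double functor is determined by its values on these (`DoubleFunctor.free_ext`,
`DoubleFunctor.grid_ext`). With naturality this shows that a map `Φ` out of the nerve of `A` is
determined by its values on the standard simplices (`NerveHom.ext_of_gaunt`). The vertical data
carries no information: it is degenerate in `A`, so `Φ` makes it degenerate in `B`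
(`NerveHom.vEdge_app`, `NerveHom.vTri_app`).

Conversely these values form a normal pseudofunctor. Points give objects, edges give morphisms,
squares of edges give 2-morphisms, and triangles give compositors, which are invertible because the
square with the opposite boundary is present as well. Each axiom is an equation between two pastings
inside one simplex: (1,2,0) for vertical composition, (2,1,0) for naturality of compositors, (3,0,0)
for associativity, and degenerate simplices for the unit laws. Strict unitality comes from the
degenerate edge at a point.

For a pseudofunctor `F`, the map `N F` takes on the standard simplices exactly the values `F.map`,
`F.map₂` and `F.mapComp` (`nerveHom_edge`, `nerveHom_quad`, `nerveHom_triInv`). Hence `F` can be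
recovered from `N F`, and the pseudofunctor read off from `Φ` has nerve `Φ`. Naturality is the
identity `(K ∘ F)_* G = K_* (F_* G)` (`postcomp_comp`), where the isomorphisms on the boundary of a
square compose accordingly. -/

namespace DoubleCat

/-! ### Morphisms and squares with varying boundary -/

/-- A horizontal morphism with arbitrary endpoints. -/
structure TotalHor (Z : DoubleCat.{w, u, v₁, v₂}) where
  {src tgt : Z.Obj}
  hor : Z.Hor src tgt

/-- A vertical morphism with arbitrary endpoints. -/
structure TotalVer (Z : DoubleCat.{w, u, v₁, v₂}) where
  {src tgt : Z.Obj}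
  ver : Z.Ver src tgt

/-- A square with arbitrary boundary. -/
structure TotalSq (Z : DoubleCat.{w, u, v₁, v₂}) where
  {a b c d : Z.Obj}
  {f : Z.Hor a b}
  {u : Z.Ver a c}
  {v : Z.Ver b d}
  {g : Z.Hor c d}
  sq : Z.Sq f u v g

section Total

variable (Z : DoubleCat.{w, u, v₁, v₂})

/-- A horizontal morphism, regarded as one with arbitrary endpoints. -/
abbrev tHor {a b : Z.Obj} (f : Z.Hor a b) : Z.TotalHor := ⟨f⟩

/-- A vertical morphism, regarded as one with arbitrary endpoints. -/
abbrev tVer {a b : Z.Obj} (f : Z.Ver a b) : Z.TotalVer := ⟨f⟩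

/-- A square, regarded as one with arbitrary boundary. -/
abbrev tSq {a b c d : Z.Obj} {f : Z.Hor a b} {u : Z.Ver a c} {v : Z.Ver b d} {g : Z.Hor c d}
    (α : Z.Sq f u v g) : Z.TotalSq := ⟨α⟩

variable {Z}

/-- The top side of a square. -/
def TotalSq.top (S : Z.TotalSq) : Z.TotalHor := ⟨S.f⟩

/-- The bottom side of a square. -/
def TotalSq.bot (S : Z.TotalSq) : Z.TotalHor := ⟨S.g⟩

/-- The left side of a square. -/
def TotalSq.left (S : Z.TotalSq) : Z.TotalVer := ⟨S.u⟩

/-- The right side of a square. -/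
def TotalSq.right (S : Z.TotalSq) : Z.TotalVer := ⟨S.v⟩

/-- Most comparisons below are between cells whose boundaries agree only propositionally. As
elements of a total type such cells are simply equal, and case analysis on the equation identifies
the whole boundary at once, without transports. -/
theorem tHor_hcomp {a b c a' b' c' : Z.Obj} {f : Z.Hor a b} {g : Z.Hor b c} {f' : Z.Hor a' b'}
    {g' : Z.Hor b' c'} (h : Z.tHor f = Z.tHor f') (h' : Z.tHor g = Z.tHor g') :
    Z.tHor (Z.hcomp f g) = Z.tHor (Z.hcomp f' g') := by
  cases h; cases h'; rfl

theorem tVer_vcomp {a b c a' b' c' : Z.Obj} {f : Z.Ver a b} {g : Z.Ver b c} {f' : Z.Ver a' b'}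
    {g' : Z.Ver b' c'} (h : Z.tVer f = Z.tVer f') (h' : Z.tVer g = Z.tVer g') :
    Z.tVer (Z.vcomp f g) = Z.tVer (Z.vcomp f' g') := by
  cases h; cases h'; rfl

theorem tSq_hcomp {a b c a' b' c' : Z.Obj} {f : Z.Hor a b} {f' : Z.Hor b c} {u : Z.Ver a a'}
    {v : Z.Ver b b'} {x : Z.Ver c c'} {g : Z.Hor a' b'} {g' : Z.Hor b' c'}
    {α : Z.Sq f u v g} {β : Z.Sq f' v x g'}
    {a₁ b₁ c₁ a₁' b₁' c₁' : Z.Obj} {f₁ : Z.Hor a₁ b₁} {f₁' : Z.Hor b₁ c₁} {u₁ : Z.Ver a₁ a₁'}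
    {v₁ : Z.Ver b₁ b₁'} {x₁ : Z.Ver c₁ c₁'} {g₁ : Z.Hor a₁' b₁'} {g₁' : Z.Hor b₁' c₁'}
    {α₁ : Z.Sq f₁ u₁ v₁ g₁} {β₁ : Z.Sq f₁' v₁ x₁ g₁'}
    (hα : Z.tSq α = Z.tSq α₁) (hβ : Z.tSq β = Z.tSq β₁) :
    Z.tSq (Z.sqHcomp α β) = Z.tSq (Z.sqHcomp α₁ β₁) := by
  cases hα; cases hβ; rfl

theorem tSq_vcomp {a b a' b' a'' b'' : Z.Obj} {f : Z.Hor a b} {u : Z.Ver a a'} {v : Z.Ver b b'}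
    {g : Z.Hor a' b'} {u' : Z.Ver a' a''} {v' : Z.Ver b' b''} {k : Z.Hor a'' b''}
    {α : Z.Sq f u v g} {β : Z.Sq g u' v' k}
    {a₁ b₁ a₁' b₁' a₁'' b₁'' : Z.Obj} {f₁ : Z.Hor a₁ b₁} {u₁ : Z.Ver a₁ a₁'} {v₁ : Z.Ver b₁ b₁'}
    {g₁ : Z.Hor a₁' b₁'} {u₁' : Z.Ver a₁' a₁''} {v₁' : Z.Ver b₁' b₁''} {k₁ : Z.Hor a₁'' b₁''}
    {α₁ : Z.Sq f₁ u₁ v₁ g₁} {β₁ : Z.Sq g₁ u₁' v₁' k₁}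
    (hα : Z.tSq α = Z.tSq α₁) (hβ : Z.tSq β = Z.tSq β₁) :
    Z.tSq (Z.sqVcomp α β) = Z.tSq (Z.sqVcomp α₁ β₁) := by
  cases hα; cases hβ; rfl

theorem tSq_hid {a b a' b' : Z.Obj} {p : Z.Ver a b} {q : Z.Ver a' b'} (h : Z.tVer p = Z.tVer q) :
    Z.tSq (Z.sqHid p) = Z.tSq (Z.sqHid q) := by
  cases h; rfl

theorem tSq_vid {a b a' b' : Z.Obj} {p : Z.Hor a b} {q : Z.Hor a' b'} (h : Z.tHor p = Z.tHor q) :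
    Z.tSq (Z.sqVid p) = Z.tSq (Z.sqVid q) := by
  cases h; rfl

theorem tSq_eq_of_heq {a b c d : Z.Obj} {f f' : Z.Hor a b} {u u' : Z.Ver a c}
    {v v' : Z.Ver b d} {g g' : Z.Hor c d} {α : Z.Sq f u v g} {β : Z.Sq f' u' v' g'}
    (hf : f = f') (hu : u = u') (hv : v = v') (hg : g = g') (h : α ≍ β) :
    Z.tSq α = Z.tSq β := by
  subst hf hu hv hg
  obtain rfl := eq_of_heq h
  rfl

theorem tHor_id {a b : Z.Obj} (h : a = b) : Z.tHor (Z.hid a) = Z.tHor (Z.hid b) := by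
  subst h; rfl

theorem tVer_id {a b : Z.Obj} (h : a = b) : Z.tVer (Z.vid a) = Z.tVer (Z.vid b) := by
  subst h; rfl

theorem exists_tHor_eq {a b : Z.Obj} {S : Z.TotalHor} (h : S.src = a) (h' : S.tgt = b) :
    ∃ f : Z.Hor a b, Z.tHor f = S := by
  subst h h'; exact ⟨S.hor, rfl⟩

theorem tHor_src {a b a' b' : Z.Obj} {f : Z.Hor a b} {g : Z.Hor a' b'}
    (h : Z.tHor f = Z.tHor g) : a = a' := by cases h; rfl

theorem tHor_tgt {a b a' b' : Z.Obj} {f : Z.Hor a b} {g : Z.Hor a' b'}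
    (h : Z.tHor f = Z.tHor g) : b = b' := by cases h; rfl

theorem eq_of_tHor {a b : Z.Obj} {f g : Z.Hor a b} (h : Z.tHor f = Z.tHor g) : f = g := by
  cases h; rfl

theorem eq_of_tSq {a b c d : Z.Obj} {f : Z.Hor a b} {u : Z.Ver a c} {v : Z.Ver b d}
    {g : Z.Hor c d} {α β : Z.Sq f u v g} (h : Z.tSq α = Z.tSq β) : α = β := by
  cases h; rfl

theorem tSq_hid_hcomp {a b c d : Z.Obj} {f : Z.Hor a b} {u : Z.Ver a c} {v : Z.Ver b d}
    {g : Z.Hor c d} (α : Z.Sq f u v g) : Z.tSq (Z.sqHcomp (Z.sqHid u) α) = Z.tSq α :=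
  tSq_eq_of_heq (Z.hid_hcomp f) rfl rfl (Z.hid_hcomp g) (Z.sqHid_sqHcomp α)

theorem tSq_hcomp_hid {a b c d : Z.Obj} {f : Z.Hor a b} {u : Z.Ver a c} {v : Z.Ver b d}
    {g : Z.Hor c d} (α : Z.Sq f u v g) : Z.tSq (Z.sqHcomp α (Z.sqHid v)) = Z.tSq α :=
  tSq_eq_of_heq (Z.hcomp_hid f) rfl rfl (Z.hcomp_hid g) (Z.sqHcomp_sqHid α)

theorem tSq_vid_vcomp {a b c d : Z.Obj} {f : Z.Hor a b} {u : Z.Ver a c} {v : Z.Ver b d}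
    {g : Z.Hor c d} (α : Z.Sq f u v g) : Z.tSq (Z.sqVcomp (Z.sqVid f) α) = Z.tSq α :=
  tSq_eq_of_heq rfl (Z.vid_vcomp u) (Z.vid_vcomp v) rfl (Z.sqVid_sqVcomp α)

theorem tSq_vcomp_vid {a b c d : Z.Obj} {f : Z.Hor a b} {u : Z.Ver a c} {v : Z.Ver b d}
    {g : Z.Hor c d} (α : Z.Sq f u v g) : Z.tSq (Z.sqVcomp α (Z.sqVid g)) = Z.tSq α :=
  tSq_eq_of_heq rfl (Z.vcomp_vid u) (Z.vcomp_vid v) rfl (Z.sqVcomp_sqVid α)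

end Total

end DoubleCat

namespace DoubleFunctor

variable {X : DoubleCat.{w₁, u₁, v₁, v₂}} {Z : DoubleCat.{w₂, u₂, v₃, v₄}}
  (P : DoubleFunctor X Z)

theorem tHor_congr {a b a' b' : X.Obj} {f : X.Hor a b} {g : X.Hor a' b'}
    (h : X.tHor f = X.tHor g) : Z.tHor (P.hor f) = Z.tHor (P.hor g) := by
  cases h; rfl

theorem tSq_hcomp {a b c a' b' c' : X.Obj} {f : X.Hor a b} {f' : X.Hor b c} {u : X.Ver a a'}
    {v : X.Ver b b'} {x : X.Ver c c'} {g : X.Hor a' b'} {g' : X.Hor b' c'}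
    (α : X.Sq f u v g) (β : X.Sq f' v x g') :
    Z.tSq (P.sq (X.sqHcomp α β)) = Z.tSq (Z.sqHcomp (P.sq α) (P.sq β)) :=
  DoubleCat.tSq_eq_of_heq (P.hor_comp _ _) rfl rfl (P.hor_comp _ _) (P.sq_hcomp α β)

theorem tSq_vcomp {a b a' b' a'' b'' : X.Obj} {f : X.Hor a b} {u : X.Ver a a'} {v : X.Ver b b'}
    {g : X.Hor a' b'} {u' : X.Ver a' a''} {v' : X.Ver b' b''} {h : X.Hor a'' b''}
    (α : X.Sq f u v g) (β : X.Sq g u' v' h) :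
    Z.tSq (P.sq (X.sqVcomp α β)) = Z.tSq (Z.sqVcomp (P.sq α) (P.sq β)) :=
  DoubleCat.tSq_eq_of_heq rfl (P.ver_comp _ _) (P.ver_comp _ _) rfl (P.sq_vcomp α β)

theorem tSq_hid {a b : X.Obj} (p : X.Ver a b) :
    Z.tSq (P.sq (X.sqHid p)) = Z.tSq (Z.sqHid (P.ver p)) :=
  DoubleCat.tSq_eq_of_heq (P.hor_id _) rfl rfl (P.hor_id _) (P.sq_hid p)

theorem tSq_vid {a b : X.Obj} (p : X.Hor a b) :
    Z.tSq (P.sq (X.sqVid p)) = Z.tSq (Z.sqVid (P.hor p)) :=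
  DoubleCat.tSq_eq_of_heq rfl (P.ver_id _) (P.ver_id _) rfl (P.sq_vid p)

theorem ext_of_total {P Q : DoubleFunctor X Z} (ho : ∀ x, P.obj x = Q.obj x)
    (hh : ∀ {a b} (f : X.Hor a b), Z.tHor (P.hor f) = Z.tHor (Q.hor f))
    (hv : ∀ {a b} (f : X.Ver a b), Z.tVer (P.ver f) = Z.tVer (Q.ver f))
    (hs : ∀ {a b c d} {f : X.Hor a b} {u : X.Ver a c} {v : X.Ver b d} {g : X.Hor c d}
      (α : X.Sq f u v g), Z.tSq (P.sq α) = Z.tSq (Q.sq α)) : P = Q := by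
  refine ext_of_heq (funext ho) ?_ ?_ ?_
  · intro a b f
    exact (DoubleCat.TotalHor.mk.inj (hh f)).2.2
  · intro a b f
    exact (DoubleCat.TotalVer.mk.inj (hv f)).2.2
  · intro a b c d f u v g α
    exact (DoubleCat.TotalSq.mk.inj (hs α)).2.2.2.2.2.2.2.2

end DoubleFunctor

/-! ### Double functors on free double categories -/

namespace RelPath

theorem le_of_path {T : Type} {r : T → T → Prop} (ht : ∀ x y z, r x y → r y z → r x z) {x y : T}
    (p : RelPath r x y) :
    x = y ∨ r x y := by
  induction p with
  | nil => exact Or.inl rfl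
  | cons p e ih =>
    rcases ih with rfl | ih
    · exact Or.inr e
    · exact Or.inr (ht _ _ _ ih e)

variable {T T' : Type} [DecidableEq T] [DecidableEq T'] {r : T → T → Prop} {r' : T' → T' → Prop}

/-- The path consisting of one edge, or of no edge in the case of an equality. -/
def ofLe {x y : T} (e : x = y ∨ r x y) : RelPath r x y := nil.snoc e

theorem ofLe_self {x : T} (e : x = x ∨ r x x) : ofLe e = nil := snoc_self _ _

theorem ofLe_of_ne {x y : T} (e : x = y ∨ r x y) (h : x ≠ y) :
    ofLe e = single (e.resolve_left h) := snoc_of_ne _ _ h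

theorem map_ofLe (φ : T → T') (H : ∀ x y, r x y → φ x = φ y ∨ r' (φ x) (φ y)) {x y : T}
    (e : x = y ∨ r x y) (e' : φ x = φ y ∨ r' (φ x) (φ y)) : (ofLe e).map φ H = ofLe e' := by
  by_cases h : x = y
  · subst h
    rw [ofLe_self, ofLe_self]
    rfl
  · rw [ofLe_of_ne e h]
    rfl

end RelPath

namespace DoubleFunctor

variable {T : Type} {h v : T → T → Prop} {Z : DoubleCat.{w, u, v₁, v₂}}
  (P Q : DoubleFunctor (DoubleCat.free T h v) Z)

/-- The image of the square with a given boundary. -/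
def square {a b c d : T} (f : RelPath h a b) (p : RelPath v a c) (q : RelPath v b d)
    (g : RelPath h c d) : Z.TotalSq :=
  Z.tSq (P.sq (f := f) (u := p) (v := q) (g := g) ())

variable {P Q}

/-- Every boundary carries exactly one square, so its image can be computed by cutting along any
intermediate path. That path is the explicit argument here and in `square_vcomp`. -/
theorem square_hcomp {a b c a' b' c' : T} {f : RelPath h a b} {f' : RelPath h b c}
    {p : RelPath v a a'} (q : RelPath v b b') {s : RelPath v c c'}
    {g : RelPath h a' b'} {g' : RelPath h b' c'} :
    P.square (f.comp f') p s (g.comp g') =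
      Z.tSq (Z.sqHcomp (P.sq (f := f) (u := p) (v := q) (g := g) ())
        (P.sq (f := f') (u := q) (v := s) (g := g') ())) :=
  P.tSq_hcomp _ _

theorem square_vcomp {a b a' b' a'' b'' : T} {f : RelPath h a b} {p : RelPath v a a'}
    {q : RelPath v b b'} (g : RelPath h a' b') {p' : RelPath v a' a''} {q' : RelPath v b' b''}
    {k : RelPath h a'' b''} :
    P.square f (p.comp p') (q.comp q') k =
      Z.tSq (Z.sqVcomp (P.sq (f := f) (u := p) (v := q) (g := g) ())
        (P.sq (f := g) (u := p') (v := q') (g := k) ())) :=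
  P.tSq_vcomp _ _

theorem square_hid {a b : T} (p : RelPath v a b) :
    P.square .nil p p .nil = Z.tSq (Z.sqHid (P.ver p)) :=
  P.tSq_hid p

theorem square_vid {a b : T} (p : RelPath h a b) :
    P.square p .nil .nil p = Z.tSq (Z.sqVid (P.hor p)) :=
  P.tSq_vid p

/-- Objects are corners of squares on empty paths, and morphisms are sides of identity squares, so
nothing besides the squares has to be compared. -/
theorem eq_of_square (H : ∀ {a b c d : T} (f : RelPath h a b) (p : RelPath v a c)
    (q : RelPath v b d) (g : RelPath h c d), P.square f p q g = Q.square f p q g) : P = Q :=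
  ext_of_total (fun x => congrArg (fun S => S.top.src) (H (a := x) .nil .nil .nil .nil))
    (fun f => congrArg DoubleCat.TotalSq.top (H f .nil .nil f))
    (fun p => congrArg DoubleCat.TotalSq.left (H .nil p p .nil))
    (fun {_ _ _ _ f p q g} _ => H f p q g)

theorem square_hcomp_congr {a b c a' b' c' : T} {f : RelPath h a b} {f' : RelPath h b c}
    {p : RelPath v a a'} (q : RelPath v b b') {s : RelPath v c c'}
    {g : RelPath h a' b'} {g' : RelPath h b' c'} (h₁ : P.square f p q g = Q.square f p q g)
    (h₂ : P.square f' q s g' = Q.square f' q s g') :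
    P.square (f.comp f') p s (g.comp g') = Q.square (f.comp f') p s (g.comp g') := by
  rw [square_hcomp q, square_hcomp q]
  exact DoubleCat.tSq_hcomp h₁ h₂

theorem square_vcomp_congr {a b a' b' a'' b'' : T} {f : RelPath h a b} {p : RelPath v a a'}
    {q : RelPath v b b'} (g : RelPath h a' b') {p' : RelPath v a' a''} {q' : RelPath v b' b''}
    {k : RelPath h a'' b''} (h₁ : P.square f p q g = Q.square f p q g)
    (h₂ : P.square g p' q' k = Q.square g p' q' k) :
    P.square f (p.comp p') (q.comp q') k = Q.square f (p.comp p') (q.comp q') k := by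
  rw [square_vcomp g, square_vcomp g]
  exact DoubleCat.tSq_vcomp h₁ h₂

theorem tHor_path_congr (ho : ∀ x, P.obj x = Q.obj x)
    (hh : ∀ {x y} (e : h x y), Z.tHor (P.hor (.single e)) = Z.tHor (Q.hor (.single e)))
    {x y : T} (p : RelPath h x y) : Z.tHor (P.hor p) = Z.tHor (Q.hor p) := by
  induction p with
  | nil =>
    rw [show P.hor (.nil : RelPath h x x) = _ from P.hor_id x,
      show Q.hor (.nil : RelPath h x x) = _ from Q.hor_id x]
    exact DoubleCat.tHor_id (ho x)
  | cons p e ih =>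
    rw [show P.hor (p.cons e) = _ from P.hor_comp p (.single e),
      show Q.hor (p.cons e) = _ from Q.hor_comp p (.single e)]
    exact DoubleCat.tHor_hcomp ih (hh e)

theorem tVer_path_congr (ho : ∀ x, P.obj x = Q.obj x)
    (hh : ∀ {x y} (e : v x y), Z.tVer (P.ver (.single e)) = Z.tVer (Q.ver (.single e)))
    {x y : T} (p : RelPath v x y) : Z.tVer (P.ver p) = Z.tVer (Q.ver p) := by
  induction p with
  | nil =>
    rw [show P.ver (.nil : RelPath v x x) = _ from P.ver_id x,
      show Q.ver (.nil : RelPath v x x) = _ from Q.ver_id x]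
    exact DoubleCat.tVer_id (ho x)
  | cons p e ih =>
    rw [show P.ver (p.cons e) = _ from P.ver_comp p (.single e),
      show Q.ver (p.cons e) = _ from Q.ver_comp p (.single e)]
    exact DoubleCat.tVer_vcomp ih (hh e)

/-- A path is contracted to one edge by induction: contract all but the last edge, whisker with that
edge, then apply a triangle. The opposite square is obtained by the same steps in reverse order,
which is why both directions are carried along. -/
theorem square_globular_congr [DecidableEq T] (ht : ∀ x y z, h x y → h y z → h x z)
    (hi : ∀ x, ¬ h x x) (hh : ∀ {x y} (p : RelPath h x y), Z.tHor (P.hor p) = Z.tHor (Q.hor p))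
    (tri : ∀ {x y z} (e : h x y) (e' : h y z) (e'' : h x z),
      P.square ((RelPath.single e).comp (.single e')) .nil .nil (.single e'') =
        Q.square ((RelPath.single e).comp (.single e')) .nil .nil (.single e''))
    (tri' : ∀ {x y z} (e : h x y) (e' : h y z) (e'' : h x z),
      P.square (.single e'') .nil .nil ((RelPath.single e).comp (.single e')) =
        Q.square (.single e'') .nil .nil ((RelPath.single e).comp (.single e')))
    {x y : T} (p : RelPath h x y) (e : x = y ∨ h x y) :
    P.square p .nil .nil (.ofLe e) = Q.square p .nil .nil (.ofLe e) ∧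
      P.square (.ofLe e) .nil .nil p = Q.square (.ofLe e) .nil .nil p := by
  have hid : ∀ {x y} (p : RelPath h x y), P.square p .nil .nil p = Q.square p .nil .nil p := by
    intro x y p
    rw [square_vid, square_vid]
    exact DoubleCat.tSq_vid (hh p)
  induction p with
  | nil => rw [RelPath.ofLe_self]; exact ⟨hid _, hid _⟩
  | @cons y z p e' ih =>
    have e₁ := p.le_of_path ht
    -- By transitivity and irreflexivity a path of positive length cannot return to its start, so
    -- its contraction is a genuine edge.
    have hxz : x ≠ z := by
      rintro rfl
      rcases e₁ with rfl | e₁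
      · exact hi _ e'
      · exact hi _ (ht _ _ _ e₁ e')
    rw [RelPath.ofLe_of_ne e hxz]
    have ih := ih e₁
    have key : P.square ((RelPath.ofLe e₁).comp (.single e')) .nil .nil
          (.single (e.resolve_left hxz)) = Q.square ((RelPath.ofLe e₁).comp (.single e')) .nil .nil
          (.single (e.resolve_left hxz)) ∧
        P.square (.single (e.resolve_left hxz)) .nil .nil
          ((RelPath.ofLe e₁).comp (.single e')) = Q.square (.single (e.resolve_left hxz)) .nil .nil
          ((RelPath.ofLe e₁).comp (.single e')) := by
      by_cases hxy : x = y
      · subst hxy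
        rw [RelPath.ofLe_self, RelPath.nil_comp]
        exact ⟨hid _, hid _⟩
      · rw [RelPath.ofLe_of_ne e₁ hxy]
        exact ⟨tri _ _ _, tri' _ _ _⟩
    exact ⟨square_vcomp_congr (p := .nil) (q := .nil) (p' := .nil) (q' := .nil) _
        (square_hcomp_congr (f' := .single e') .nil ih.1 (hid _)) key.1,
      square_vcomp_congr (p := .nil) (q := .nil) (p' := .nil) (q' := .nil) _ key.2
        (square_hcomp_congr (f' := .single e') .nil ih.2 (hid _))⟩

theorem square_vGlobular_congr [DecidableEq T] (ht : ∀ x y z, v x y → v y z → v x z)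
    (hi : ∀ x, ¬ v x x) (hh : ∀ {x y} (p : RelPath v x y), Z.tVer (P.ver p) = Z.tVer (Q.ver p))
    (tri : ∀ {x y z} (e : v x y) (e' : v y z) (e'' : v x z),
      P.square .nil ((RelPath.single e).comp (.single e')) (.single e'') .nil =
        Q.square .nil ((RelPath.single e).comp (.single e')) (.single e'') .nil)
    (tri' : ∀ {x y z} (e : v x y) (e' : v y z) (e'' : v x z),
      P.square .nil (.single e'') ((RelPath.single e).comp (.single e')) .nil =
        Q.square .nil (.single e'') ((RelPath.single e).comp (.single e')) .nil)
    {x y : T} (p : RelPath v x y) (e : x = y ∨ v x y) :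
    P.square .nil p (.ofLe e) .nil = Q.square .nil p (.ofLe e) .nil ∧
      P.square .nil (.ofLe e) p .nil = Q.square .nil (.ofLe e) p .nil := by
  have hid : ∀ {x y} (p : RelPath v x y), P.square .nil p p .nil = Q.square .nil p p .nil := by
    intro x y p
    rw [square_hid, square_hid]
    exact DoubleCat.tSq_hid (hh p)
  induction p with
  | nil => rw [RelPath.ofLe_self]; exact ⟨hid _, hid _⟩
  | @cons y z p e' ih =>
    have e₁ := p.le_of_path ht
    have hxz : x ≠ z := by
      rintro rfl
      rcases e₁ with rfl | e₁
      · exact hi _ e'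
      · exact hi _ (ht _ _ _ e₁ e')
    rw [RelPath.ofLe_of_ne e hxz]
    have ih := ih e₁
    have key : P.square .nil ((RelPath.ofLe e₁).comp (.single e'))
          (.single (e.resolve_left hxz)) .nil = Q.square .nil ((RelPath.ofLe e₁).comp (.single e'))
          (.single (e.resolve_left hxz)) .nil ∧
        P.square .nil (.single (e.resolve_left hxz))
          ((RelPath.ofLe e₁).comp (.single e')) .nil = Q.square .nil (.single (e.resolve_left hxz))
          ((RelPath.ofLe e₁).comp (.single e')) .nil := by
      by_cases hxy : x = y
      · subst hxy
        rw [RelPath.ofLe_self, RelPath.nil_comp]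
        exact ⟨hid _, hid _⟩
      · rw [RelPath.ofLe_of_ne e₁ hxy]
        exact ⟨tri _ _ _, tri' _ _ _⟩
    exact ⟨square_hcomp_congr (f := .nil) (f' := .nil) (g := .nil) (g' := .nil) _
        (square_vcomp_congr (p' := .single e') .nil ih.1 (hid _)) key.1,
      square_hcomp_congr (f := .nil) (f' := .nil) (g := .nil) (g' := .nil) _ key.2
        (square_vcomp_congr (p' := .single e') .nil ih.2 (hid _))⟩

/-- Double functors on a free double category agree if they agree on objects, edges, squares of
edges and triangles of edges. -/
theorem free_ext [DecidableEq T] (ht : ∀ x y z, h x y → h y z → h x z) (hi : ∀ x, ¬ h x x)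
    (vt : ∀ x y z, v x y → v y z → v x z) (vi : ∀ x, ¬ v x x)
    (compat : ∀ {x y x' y'}, (x = y ∨ h x y) → (x = x' ∨ v x x') → (y = y' ∨ v y y') →
      (x' = y' ∨ h x' y') → (x = y ↔ x' = y') ∧ (x = x' ↔ y = y'))
    (ho : ∀ x, P.obj x = Q.obj x)
    (hh : ∀ {x y} (e : h x y), Z.tHor (P.hor (.single e)) = Z.tHor (Q.hor (.single e)))
    (hv : ∀ {x y} (e : v x y), Z.tVer (P.ver (.single e)) = Z.tVer (Q.ver (.single e)))
    (hs : ∀ {x y x' y'} (e : h x y) (p : v x x') (q : v y y') (e' : h x' y'),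
      P.square (.single e) (.single p) (.single q) (.single e') =
        Q.square (.single e) (.single p) (.single q) (.single e'))
    (tri : ∀ {x y z} (e : h x y) (e' : h y z) (e'' : h x z),
      P.square ((RelPath.single e).comp (.single e')) .nil .nil (.single e'') =
        Q.square ((RelPath.single e).comp (.single e')) .nil .nil (.single e''))
    (tri' : ∀ {x y z} (e : h x y) (e' : h y z) (e'' : h x z),
      P.square (.single e'') .nil .nil ((RelPath.single e).comp (.single e')) =
        Q.square (.single e'') .nil .nil ((RelPath.single e).comp (.single e')))
    (vtri : ∀ {x y z} (e : v x y) (e' : v y z) (e'' : v x z),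
      P.square .nil ((RelPath.single e).comp (.single e')) (.single e'') .nil =
        Q.square .nil ((RelPath.single e).comp (.single e')) (.single e'') .nil)
    (vtri' : ∀ {x y z} (e : v x y) (e' : v y z) (e'' : v x z),
      P.square .nil (.single e'') ((RelPath.single e).comp (.single e')) .nil =
        Q.square .nil (.single e'') ((RelPath.single e).comp (.single e')) .nil) : P = Q := by
  have hp : ∀ {x y} (p : RelPath h x y), Z.tHor (P.hor p) = Z.tHor (Q.hor p) :=
    tHor_path_congr ho hh
  have vp : ∀ {x y} (p : RelPath v x y), Z.tVer (P.ver p) = Z.tVer (Q.ver p) :=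
    tVer_path_congr ho hv
  refine eq_of_square fun {a b c d} f p q g => ?_
  have ef := RelPath.le_of_path ht f
  have eg := RelPath.le_of_path ht g
  have ep := RelPath.le_of_path vt p
  have eq := RelPath.le_of_path vt q
  -- `compat` rules out squares with only one of two opposite sides trivial. So the square is an
  -- identity in one of the two directions, or all four sides are edges.
  have key : P.square (.ofLe ef) (.ofLe ep) (.ofLe eq) (.ofLe eg) =
      Q.square (.ofLe ef) (.ofLe ep) (.ofLe eq) (.ofLe eg) := by
    obtain ⟨h₁, h₂⟩ := compat ef ep eq eg
    by_cases hab : a = b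
    · have hcd := h₁.1 hab
      subst hab hcd
      rw [RelPath.ofLe_self, RelPath.ofLe_self, square_hid, square_hid]
      exact DoubleCat.tSq_hid (vp _)
    · by_cases hac : a = c
      · have hbd := h₂.1 hac
        subst hac hbd
        rw [RelPath.ofLe_self, RelPath.ofLe_self, square_vid, square_vid]
        exact DoubleCat.tSq_vid (hp _)
      · rw [RelPath.ofLe_of_ne ef hab, RelPath.ofLe_of_ne eg (mt h₁.2 hab),
          RelPath.ofLe_of_ne ep hac, RelPath.ofLe_of_ne eq (mt h₂.2 hac)]
        exact hs _ _ _ _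
  -- Vertical sides first: paste the contraction of `p` on the left and the expansion to `q` on the
  -- right. The horizontal sides `f` and `g` are treated likewise afterwards.
  have key₂ : P.square (.ofLe ef) p q (.ofLe eg) = Q.square (.ofLe ef) p q (.ofLe eg) := by
    have := square_hcomp_congr (f := .nil) (g := .nil) _
      (square_vGlobular_congr vt vi vp vtri vtri' p ep).1
      (square_hcomp_congr (f' := .nil) (g' := .nil) _ key
        (square_vGlobular_congr vt vi vp vtri vtri' q eq).2)
    -- The other unit law, `p.comp .nil = p`, holds by reduction, since concatenation recurses on
    -- its second argument.
    rw [RelPath.nil_comp, RelPath.nil_comp] at this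
    exact this
  have := square_vcomp_congr (p := .nil) (q := .nil) _
    (square_globular_congr ht hi hp tri tri' f ef).1
    (square_vcomp_congr (p' := .nil) (q' := .nil) _ key₂
      (square_globular_congr ht hi hp tri tri' g eg).2)
  rw [RelPath.nil_comp, RelPath.nil_comp] at this
  exact this

end DoubleFunctor

/-! ### Squares with trivial vertical sides as 2-morphisms -/

namespace DoubleCat

theorem exists_tSq_eq {Z : DoubleCat.{w, u, v₁, v₂}} {a b a' b' : Z.Obj} {f : Z.Hor a b}
    {u : Z.Ver a a'} {v : Z.Ver b b'} {g : Z.Hor a' b'} {S : Z.TotalSq} (ht : S.top = Z.tHor f)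
    (hl : S.left = Z.tVer u) (hr : S.right = Z.tVer v) (hb : S.bot = Z.tHor g) :
    ∃ α : Z.Sq f u v g, Z.tSq α = S := by
  obtain @⟨a₁, b₁, c₁, d₁, f₁, u₁, v₁, g₁, α⟩ := S
  cases ht
  cases hb
  cases hl
  cases hr
  exact ⟨α, rfl⟩

/-- This and the three variants below cancel a square that is an identity only after its boundary is
identified. This is the form in which degenerate squares arise. -/
theorem tSq_vcomp_of_vid {Z : DoubleCat.{w, u, v₁, v₂}} {a b a' b' a'' b'' : Z.Obj}
    {f : Z.Hor a b} {u : Z.Ver a a'} {v : Z.Ver b b'} {g : Z.Hor a' b'} {u' : Z.Ver a' a''}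
    {v' : Z.Ver b' b''} {k : Z.Hor a'' b''} {α : Z.Sq f u v g} (β : Z.Sq g u' v' k)
    (h : Z.tSq α = Z.tSq (Z.sqVid g)) : Z.tSq (Z.sqVcomp α β) = Z.tSq β :=
  (tSq_vcomp h rfl).trans (tSq_vid_vcomp β)

theorem tSq_vcomp_of_vid' {Z : DoubleCat.{w, u, v₁, v₂}} {a b a' b' a'' b'' : Z.Obj}
    {f : Z.Hor a b} {u : Z.Ver a a'} {v : Z.Ver b b'} {g : Z.Hor a' b'} {u' : Z.Ver a' a''}
    {v' : Z.Ver b' b''} {k : Z.Hor a'' b''} (α : Z.Sq f u v g) {β : Z.Sq g u' v' k}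
    (h : Z.tSq β = Z.tSq (Z.sqVid g)) : Z.tSq (Z.sqVcomp α β) = Z.tSq α :=
  (tSq_vcomp rfl h).trans (tSq_vcomp_vid α)

theorem tSq_hcomp_of_hid {Z : DoubleCat.{w, u, v₁, v₂}} {a b c a' b' c' : Z.Obj}
    {f : Z.Hor a b} {f' : Z.Hor b c} {u : Z.Ver a a'} {v : Z.Ver b b'} {x : Z.Ver c c'}
    {g : Z.Hor a' b'} {g' : Z.Hor b' c'} {α : Z.Sq f u v g} (β : Z.Sq f' v x g')
    (h : Z.tSq α = Z.tSq (Z.sqHid v)) : Z.tSq (Z.sqHcomp α β) = Z.tSq β :=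
  (tSq_hcomp h rfl).trans (tSq_hid_hcomp β)

theorem tSq_hcomp_of_hid' {Z : DoubleCat.{w, u, v₁, v₂}} {a b c a' b' c' : Z.Obj}
    {f : Z.Hor a b} {f' : Z.Hor b c} {u : Z.Ver a a'} {v : Z.Ver b b'} {x : Z.Ver c c'}
    {g : Z.Hor a' b'} {g' : Z.Hor b' c'} (α : Z.Sq f u v g) {β : Z.Sq f' v x g'}
    (h : Z.tSq β = Z.tSq (Z.sqHid v)) : Z.tSq (Z.sqHcomp α β) = Z.tSq α :=
  (tSq_hcomp rfl h).trans (tSq_hcomp_hid α)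

section Glob

variable {D : Type u} [Bicategory.{w, v} D] [Strict D]

/-- A 2-morphism, regarded as a square with trivial vertical sides. -/
def glob {a b : D} {f g : a ⟶ b} (η : f ⟶ g) :
    (Hsim D).Sq f (Equivalence.id a) (Equivalence.id b) g :=
  (ρ_ f).hom ≫ η ≫ (λ_ g).inv

/-- A 2-morphism, regarded as a square with trivial vertical sides and arbitrary boundary. -/
def tGlob {a b : D} {f g : a ⟶ b} (η : f ⟶ g) : (Hsim D).TotalSq := (Hsim D).tSq (glob η)

theorem glob_id {a b : D} (f : a ⟶ b) : glob (𝟙 f) = (Hsim D).sqVid f := by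
  exact congrArg ((ρ_ f).hom ≫ ·) (Category.id_comp (λ_ f).inv)

theorem tGlob_id {a b : D} (f : a ⟶ b) : tGlob (𝟙 f) = (Hsim D).tSq ((Hsim D).sqVid f) := by
  exact congrArg (Hsim D).tSq (glob_id f)

theorem glob_injective {a b : D} {f g : a ⟶ b} {η θ : f ⟶ g} (h : glob η = glob θ) : η = θ := by
  have h : (ρ_ f).hom ≫ η ≫ (λ_ g).inv = (ρ_ f).hom ≫ θ ≫ (λ_ g).inv := h
  simpa using h

theorem tGlob_injective {a b : D} {f g : a ⟶ b} {η θ : f ⟶ g} (h : tGlob η = tGlob θ) : η = θ :=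
  glob_injective (eq_of_tSq h)

/-- The vertical sides of the composite are composites of two identity equivalences, so the two
squares have different boundaries until the unit law is applied. -/
theorem sqVcomp_glob {a b : D} {f g k : a ⟶ b} (η : f ⟶ g) (θ : g ⟶ k) :
    (Hsim D).tSq ((Hsim D).sqVcomp (glob η) (glob θ)) = tGlob (η ≫ θ) := by
  refine tSq_eq_of_heq rfl (Equivalence.id_comp' _) (Equivalence.id_comp' _) rfl ?_
  have e : (Hsim D).sqVcomp (glob η) (glob θ) = f ◁ (λ_ (𝟙 b)).hom ≫
      ((ρ_ f).hom ≫ (η ≫ θ) ≫ (λ_ k).inv) ≫ (λ_ (𝟙 a)).inv ▷ k := by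
    dsimp only [Hsim, glob, Equivalence.id, Equivalence.comp]
    bicategory
  refine heq_of_eqToHom (congrArg (f ≫ ·) (Strict.id_comp (𝟙 b)))
    (congrArg (· ≫ k) (Strict.id_comp (𝟙 a))) (e.trans ?_)
  rw [Equivalence.whiskerLeft_leftUnitor_eq, Equivalence.leftUnitor_inv_whiskerRight_eq]
  rfl

theorem sqHcomp_glob {a b c : D} {f g : a ⟶ b} {f' g' : b ⟶ c} (η : f ⟶ g) (θ : f' ⟶ g') :
    (Hsim D).tSq ((Hsim D).sqHcomp (glob η) (glob θ)) = tGlob (f ◁ θ ≫ η ▷ g') := by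
  refine congrArg (Hsim D).tSq ?_
  dsimp only [Hsim, glob, Equivalence.id]
  bicategory

theorem tGlob_comp_eqToHom {a b : D} {f g g' : a ⟶ b} (η : f ⟶ g) (h : g = g') :
    tGlob (η ≫ eqToHom h) = tGlob η := by
  subst h; simp

theorem tGlob_eqToHom_comp {a b : D} {f f' g : a ⟶ b} (h : f = f') (η : f' ⟶ g) :
    tGlob (eqToHom h ≫ η) = tGlob η := by
  subst h; simp

theorem exists_tGlob_eq {a b : D} {f g : a ⟶ b} {S : (Hsim D).TotalSq}
    (ht : S.top = (Hsim D).tHor f) (hb : S.bot = (Hsim D).tHor g)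
    (hl : S.left = (Hsim D).tVer (Equivalence.id a))
    (hr : S.right = (Hsim D).tVer (Equivalence.id b)) : ∃ η : f ⟶ g, tGlob η = S := by
  obtain ⟨α, rfl⟩ := exists_tSq_eq ht hl hr hb
  let α' : f ≫ 𝟙 b ⟶ 𝟙 a ≫ g := α
  refine ⟨(ρ_ f).inv ≫ α' ≫ (λ_ g).hom, congrArg (Hsim D).tSq ?_⟩
  change (ρ_ f).hom ≫ ((ρ_ f).inv ≫ α' ≫ (λ_ g).hom) ≫ (λ_ g).inv = α'
  simp

/-- Eckmann–Hilton: for endomorphisms of an identity, horizontal composition is vertical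
composition. -/
theorem tGlob_endo_id {a : D} (θ η : 𝟙 a ⟶ 𝟙 a) :
    tGlob (𝟙 a ◁ θ ≫ η ▷ 𝟙 a) = tGlob (θ ≫ η) := by
  have e : 𝟙 a ◁ θ ≫ η ▷ 𝟙 a = (λ_ (𝟙 a)).hom ≫ (θ ≫ η) ≫ (λ_ (𝟙 a)).inv := by
    simp [← unitors_equal, ← unitors_inv_equal]
  rw [e, Strict.leftUnitor_eqToIso]
  exact (tGlob_eqToHom_comp (Strict.id_comp _) _).trans
    (tGlob_comp_eqToHom _ (Strict.id_comp _).symm)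

end Glob

end DoubleCat

open DoubleCat

namespace DoubleFunctor

variable {D : Type u} [Bicategory.{w, v} D] [Strict D] {T : Type} {h v : T → T → Prop}
  (G : DoubleFunctor (free T h v) (Hsim D))

/-- The action on objects of a double functor to `ℍ^≃ D`, as an object of `D`. -/
def objD {X : DoubleCat.{w₁, u₁, v₁, v₂}} (G : DoubleFunctor X (Hsim D)) (x : X.Obj) : D :=
  G.obj x

/-- The action on horizontal morphisms of a double functor to `ℍ^≃ D`, as a morphism of `D`. -/
def horD {X : DoubleCat.{w₁, u₁, v₁, v₂}} (G : DoubleFunctor X (Hsim D)) {x y : X.Obj}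
    (f : X.Hor x y) : G.objD x ⟶ G.objD y :=
  G.hor f

/-- Pasting the square from `p` to `q` with the one from `q` to `p` gives the only square from `p`
to `p`, which is the identity. So the two images are mutually inverse. -/
theorem square_globular {x y : T} (p q : RelPath h x y) :
    ∃ η : G.horD (X := free T h v) p ≅ G.horD (X := free T h v) q,
      G.square p .nil .nil q = tGlob η.hom ∧
      G.square q .nil .nil p = tGlob η.inv := by
  have key : ∀ p q : RelPath h x y, ∃ η : G.horD (X := free T h v) p ⟶
      G.horD (X := free T h v) q, tGlob η = G.square p .nil .nil q := by
    intro p q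
    exact exists_tGlob_eq rfl rfl (congrArg (Hsim D).tVer (G.ver_id x))
      (congrArg (Hsim D).tVer (G.ver_id y))
  have comp : ∀ (p q : RelPath h x y) (η : G.horD (X := free T h v) p ⟶ G.horD (X := free T h v) q)
      (θ : G.horD (X := free T h v) q ⟶ G.horD (X := free T h v) p),
      tGlob η = G.square p .nil .nil q → tGlob θ = G.square q .nil .nil p → η ≫ θ = 𝟙 _ := by
    intro p q η θ hη hθ
    apply tGlob_injective
    refine (sqVcomp_glob _ _).symm.trans ((DoubleCat.tSq_vcomp hη hθ).trans ?_)
    refine (square_vcomp (p := .nil) (q := .nil) (p' := .nil) (q' := .nil) q).symm.trans ?_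
    exact (square_vid p).trans (tGlob_id _).symm
  obtain ⟨η, hη⟩ := key p q
  obtain ⟨θ, hθ⟩ := key q p
  exact ⟨⟨η, θ, comp p q η θ hη hθ, comp q p θ η hθ hη⟩, hη.symm, hθ.symm⟩

end DoubleFunctor

/-! ### Rigidity of double functors to a gaunt 2-category -/

namespace IsGaunt

variable {A : Type u} [Bicategory.{w, v} A]

theorem iso_hom_eq (hA : IsGaunt A) {a b : A} {f g : a ⟶ b} (η : f ≅ g) :
    η.hom = eqToHom (hA.eq_id₂ η).1 := by
  obtain ⟨h, h'⟩ := hA.eq_id₂ η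
  subst h
  exact eq_of_heq h'

theorem tHor_eq [Strict A] (hA : IsGaunt A) {a b : A} (f : a ⟶ b) (g : b ⟶ a) (h : f ≫ g = 𝟙 a)
    (h' : g ≫ f = 𝟙 b) : a = b ∧ (Hsim A).tHor f = (Hsim A).tHor (𝟙 a) := by
  obtain ⟨h₁, h₂⟩ := hA.eq_id f g h h'
  subst h₁
  rw [eq_of_heq h₂]
  exact ⟨rfl, rfl⟩

theorem tGlob_iso [Strict A] (hA : IsGaunt A) {a b : A} {f g : a ⟶ b} (η : f ≅ g) :
    tGlob η.hom = (Hsim A).tSq ((Hsim A).sqVid f) := by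
  rw [hA.iso_hom_eq η]
  obtain rfl := (hA.eq_id₂ η).1
  exact tGlob_id f

/-- The unit and counit are invertible, hence identities, so the two morphisms are mutually inverse
and hence identities too. The remaining unit and counit then agree with the unitors that define
`Equivalence.id`. -/
theorem tVer_eq [Strict A] (hA : IsGaunt A) {a b : A} (e : Bicategory.Equivalence a b) :
    a = b ∧ (Hsim A).tVer e = (Hsim A).tVer (Equivalence.id a) := by
  obtain ⟨f, g, η, κ, t⟩ := e
  obtain ⟨h₁, h₂⟩ := hA.eq_id f g (hA.eq_id₂ η).1.symm (hA.eq_id₂ κ).1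
  have h₃ := (hA.eq_id g f (hA.eq_id₂ κ).1 (hA.eq_id₂ η).1.symm).2
  subst h₁
  obtain rfl := eq_of_heq h₂
  obtain rfl := eq_of_heq h₃
  refine ⟨rfl, congrArg (Hsim A).tVer ?_⟩
  refine Equivalence.mk_eq rfl rfl ?_ ?_
  · exact (hA.iso_hom_eq η).trans (by rw [hA.iso_hom_eq (ρ_ (𝟙 a)).symm, eqToHom_trans])
  · exact (hA.iso_hom_eq κ).trans (by rw [hA.iso_hom_eq (ρ_ (𝟙 a)), eqToHom_trans])

variable [Strict A] {T : Type} {h v : T → T → Prop}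
  (G : DoubleFunctor (free T h v) (Hsim A))

/-- Parallel paths are joined by an invertible 2-morphism, which is an identity by gauntness. -/
theorem hor_eq (hA : IsGaunt A) {x y : T} (p q : RelPath h x y) : G.hor p = G.hor q :=
  (hA.eq_id₂ (G.square_globular p q).choose).1

theorem square_globular (hA : IsGaunt A) {x y : T} (p q : RelPath h x y) :
    G.square p .nil .nil q = (Hsim A).tSq ((Hsim A).sqVid (G.hor p)) := by
  obtain ⟨η, hη, _⟩ := G.square_globular p q
  exact hη.trans (hA.tGlob_iso η)

/-- Globular squares are identities, so pasting them on top and bottom replaces the horizontal sides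
without changing the image. Only the corners and the vertical paths matter. -/
theorem square_congr (hA : IsGaunt A) {x y x' y' : T} (f f' : RelPath h x y) (p : RelPath v x x')
    (q : RelPath v y y') (g g' : RelPath h x' y') : G.square f p q g = G.square f' p q g' := by
  have h₁ := (DoubleFunctor.square_vcomp (P := G) (p := .nil) (q := .nil) (p' := p) (q' := q)
    (f := f) f' (k := g)).trans (tSq_vcomp_of_vid _ ((hA.square_globular G f f').trans
      (by rw [hA.hor_eq G f f'])))
  have h₂ := (DoubleFunctor.square_vcomp (P := G) (p := p) (q := q) (p' := .nil) (q' := .nil)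
    (f := f') g (k := g')).trans (tSq_vcomp_of_vid' _ (hA.square_globular G g g'))
  rw [RelPath.nil_comp, RelPath.nil_comp] at h₁
  exact h₁.trans h₂.symm

theorem tVer_path (hA : IsGaunt A) {x y : T} (p : RelPath v x y) :
    G.obj x = G.obj y ∧
      (Hsim A).tVer (G.ver p) = (Hsim A).tVer ((Hsim A).vid (G.obj x)) :=
  hA.tVer_eq (G.ver p)

/-- The composites of `p` and `q` are loops, parallel to empty paths, so `p` and `q` have mutually
inverse images. -/
theorem tHor_path (hA : IsGaunt A) {x y : T} (p : RelPath h x y) (q : RelPath h y x) :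
    G.obj x = G.obj y ∧
      (Hsim A).tHor (G.hor p) = (Hsim A).tHor ((Hsim A).hid (G.obj x)) :=
  hA.tHor_eq (G.hor p) (G.hor q)
    ((G.hor_comp p q).symm.trans ((hA.hor_eq G (p.comp q) .nil).trans (G.hor_id x)))
    ((G.hor_comp q p).symm.trans ((hA.hor_eq G (q.comp p) .nil).trans (G.hor_id y)))

/-- A square whose horizontal sides are invertible up to squares is sent to an identity. -/
theorem square_unit (hA : IsGaunt A) {x y x' y' : T} (f : RelPath h x y) (f' : RelPath h y x)
    (p : RelPath v x x') (q : RelPath v y y') (g : RelPath h x' y') (g' : RelPath h y' x') :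
    G.square f p q g = (Hsim A).tSq ((Hsim A).sqHid ((Hsim A).vid (G.obj x))) := by
  have hxy : G.obj x = G.obj y := (hA.tHor_path G f f').1
  have hxx : G.obj x = G.obj x' := (hA.tVer_path G p).1
  have hyy : G.obj y = G.obj y' := (hA.tVer_path G q).1
  -- All four sides of the image are identities, so the square is an endomorphism of an identity
  -- morphism. The square on the opposite horizontal paths will supply its inverse.
  obtain ⟨η, hη⟩ : ∃ η : 𝟙 (G.objD x) ⟶ 𝟙 (G.objD x), tGlob η = G.square f p q g :=
    exists_tGlob_eq (hA.tHor_path G f f').2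
      ((hA.tHor_path G g g').2.trans (tHor_id hxx.symm)) (hA.tVer_path G p).2
      ((hA.tVer_path G q).2.trans (tVer_id hxy.symm))
  obtain ⟨θ, hθ⟩ : ∃ θ : 𝟙 (G.objD x) ⟶ 𝟙 (G.objD x), tGlob θ = G.square f' q p g' :=
    exists_tGlob_eq ((hA.tHor_path G f' f).2.trans (tHor_id hxy.symm))
      ((hA.tHor_path G g' g).2.trans (tHor_id (hxy.trans hyy).symm))
      ((hA.tVer_path G q).2.trans (tVer_id hxy.symm)) (hA.tVer_path G p).2
  -- The horizontal pastings of the two squares have loops as horizontal sides; these loops may be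
  -- replaced by empty paths.
  have unit : ∀ {z z' : T} (r : RelPath v z z') (k : RelPath h z z) (l : RelPath h z' z'),
      G.square k r r l = (Hsim A).tSq ((Hsim A).sqHid ((Hsim A).vid (G.obj z))) := by
    intro z z' r k l
    rw [hA.square_congr G k .nil r r l .nil, DoubleFunctor.square_hid]
    exact tSq_hid (hA.tVer_path G r).2
  -- Eckmann–Hilton turns the horizontal composite into a vertical one, so that `η` and `θ` become
  -- inverse 2-morphisms.
  have key : ∀ η θ : 𝟙 (G.objD x) ⟶ 𝟙 (G.objD x),
      (Hsim A).tSq ((Hsim A).sqHcomp (glob η) (glob θ)) =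
        (Hsim A).tSq ((Hsim A).sqHid ((Hsim A).vid (G.obj x))) → θ ≫ η = 𝟙 _ := by
    intro η θ e
    refine tGlob_injective ((tGlob_endo_id θ η).symm.trans ((sqHcomp_glob _ _).symm.trans ?_))
    rw [tGlob_id, e, (Hsim A).sqHid_vid]
    rfl
  have e₁ : θ ≫ η = 𝟙 _ := key η θ <|
    (tSq_hcomp hη hθ).trans ((DoubleFunctor.square_hcomp q).symm.trans (unit p _ _))
  have e₂ : η ≫ θ = 𝟙 _ := key θ η <|
    (tSq_hcomp hθ hη).trans ((DoubleFunctor.square_hcomp p).symm.trans ((unit q _ _).trans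
      (tSq_hid (tVer_id hxy.symm))))
  rw [← hη, (Hsim A).sqHid_vid]
  exact hA.tGlob_iso ⟨η, θ, e₂, e₁⟩

/-- Double functors from a free double category to a gaunt 2-category agree if they agree on
objects, horizontal edges and squares of edges. -/
theorem free_ext (hA : IsGaunt A) [DecidableEq T] {P Q : DoubleFunctor (free T h v) (Hsim A)}
    (ht : ∀ x y z, h x y → h y z → h x z) (hi : ∀ x, ¬ h x x)
    (vt : ∀ x y z, v x y → v y z → v x z) (vi : ∀ x, ¬ v x x)
    (compat : ∀ {x y x' y'}, (x = y ∨ h x y) → (x = x' ∨ v x x') → (y = y' ∨ v y y') →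
      (x' = y' ∨ h x' y') → (x = y ↔ x' = y') ∧ (x = x' ↔ y = y'))
    (ho : ∀ x, P.obj x = Q.obj x)
    (hh : ∀ {x y} (e : h x y), (Hsim A).tHor (P.hor (.single e)) =
      (Hsim A).tHor (Q.hor (.single e)))
    (hs : ∀ {x y x' y'} (e : h x y) (p : v x x') (q : v y y') (e' : h x' y'),
      P.square (.single e) (.single p) (.single q) (.single e') =
        Q.square (.single e) (.single p) (.single q) (.single e')) : P = Q := by
  have hp : ∀ {x y : T} (p : RelPath h x y), _ := DoubleFunctor.tHor_path_congr ho hh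
  refine DoubleFunctor.free_ext ht hi vt vi compat ho hh ?_ hs ?_ ?_ ?_ ?_
  · intro x y e
    exact (hA.tVer_path P _).2.trans ((tVer_id (ho x)).trans (hA.tVer_path Q _).2.symm)
  · intros
    rw [hA.square_globular, hA.square_globular]
    exact tSq_vid (hp _)
  · intros
    rw [hA.square_globular, hA.square_globular]
    exact tSq_vid (hp _)
  · intro x _ _ _ _ _
    rw [hA.square_unit P .nil .nil _ _ .nil .nil, hA.square_unit Q .nil .nil _ _ .nil .nil, ho x]
  · intro x _ _ _ _ _
    rw [hA.square_unit P .nil .nil _ _ .nil .nil, hA.square_unit Q .nil .nil _ _ .nil .nil, ho x]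

/-- A double functor from a free double category to a gaunt 2-category factors through every
retraction along horizontal paths that have opposites. -/
theorem freeMap_comp (hA : IsGaunt A) [DecidableEq T] (r : T → T)
    (H : ∀ x y, h x y → r x = r y ∨ h (r x) (r y))
    (V : ∀ x y, v x y → r x = r y ∨ v (r x) (r y)) (i : ∀ x, RelPath h (r x) x)
    (j : ∀ x, RelPath h x (r x)) : (freeMap r H V).comp G = G := by
  refine DoubleFunctor.eq_of_square fun {a b c d} f p q g => ?_
  change G.square (f.map r H) (p.map r V) (q.map r V) (g.map r H) = _
  -- The retracted horizontal sides are parallel to detours through the original sides. The detours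
  -- cut the square into the original one and two outer squares, which are identities by
  -- `square_unit`.
  rw [hA.square_congr G _ ((i a).comp (f.comp (j b))) _ _ _ ((i c).comp (g.comp (j d))),
    DoubleFunctor.square_hcomp p]
  have e₁ : G.square (i a) (p.map r V) p (i c) = (Hsim A).tSq ((Hsim A).sqHid (G.ver p)) :=
    (hA.square_unit G _ (j a) _ _ _ (j c)).trans (tSq_hid ((tVer_id
      (hA.tHor_path G (i a) (j a)).1).trans (hA.tVer_path G p).2.symm))
  have e₂ : G.square (j b) q (q.map r V) (j d) = (Hsim A).tSq ((Hsim A).sqHid (G.ver q)) :=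
    (hA.square_unit G _ (i b) _ _ _ (i d)).trans (tSq_hid (hA.tVer_path G q).2.symm)
  refine (tSq_hcomp_of_hid _ e₁).trans ?_
  refine (DoubleFunctor.square_hcomp q).trans ?_
  exact tSq_hcomp_of_hid' _ e₂

end IsGaunt

/-! ### Simplices of the nerve from strict data -/

open scoped Simplicial

namespace DoubleCat

theorem heq_of_tSq {Z : DoubleCat.{w, u, v₁, v₂}} {a b c d a' b' c' d' : Z.Obj} {f : Z.Hor a b}
    {u : Z.Ver a c} {v : Z.Ver b d} {g : Z.Hor c d} {f' : Z.Hor a' b'} {u' : Z.Ver a' c'}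
    {v' : Z.Ver b' d'} {g' : Z.Hor c' d'} {α : Z.Sq f u v g} {β : Z.Sq f' u' v' g'}
    (h : Z.tSq α = Z.tSq β) : α ≍ β :=
  (TotalSq.mk.inj h).2.2.2.2.2.2.2.2

theorem gridHor_path {i j k : SimplexCategory} {x y : Grid i j k}
    (p : RelPath (gridHor i j k) x y) : x.1 ≤ y.1 ∧ x.2.1 = y.2.1 := by
  induction p with
  | nil => exact ⟨le_rfl, rfl⟩
  | cons p e ih =>
    rcases e with ⟨h, h'⟩ | ⟨h, h', _⟩
    · exact ⟨ih.1.trans h.le, ih.2.trans (congrArg Prod.fst h')⟩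
    · exact ⟨ih.1.trans h.le, ih.2.trans h'⟩

theorem gridVer_path {i j k : SimplexCategory} {x y : Grid i j k}
    (p : RelPath (gridVer i j k) x y) : x.1 = y.1 ∧ x.2.1 ≤ y.2.1 := by
  induction p with
  | nil => exact ⟨rfl, le_rfl⟩
  | cons p e ih => exact ⟨ih.1.trans e.1, ih.2.trans e.2.1.le⟩

end DoubleCat

/-- The objects of a 2-category `D`, regarded as a category whose morphisms are sequences of
2-morphisms of `D` indexed by `[j]`, with horizontal composition. -/
def Chain (D : Type u) (_ : SimplexCategory) : Type u := D

namespace Chain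

variable {D : Type u} [Bicategory.{w, v} D] [Strict D] {j : SimplexCategory}

/-- The horizontal composition of sequences of 2-morphisms. -/
@[simps]
def comp {a b c : D} (F : Fin (j.len + 1) ⥤ (a ⟶ b)) (G : Fin (j.len + 1) ⥤ (b ⟶ c)) :
    Fin (j.len + 1) ⥤ (a ⟶ c) where
  obj s := F.obj s ≫ G.obj s
  map {s t} f := F.obj s ◁ G.map f ≫ F.map f ▷ G.obj t
  map_comp {s t r} f g := by
    simp only [Functor.map_comp, Bicategory.whiskerLeft_comp, Bicategory.comp_whiskerRight,
      Category.assoc]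
    rw [whisker_exchange_assoc]

theorem const_id_comp {a b : D} (F : Fin (j.len + 1) ⥤ (a ⟶ b)) :
    comp ((Functor.const _).obj (𝟙 a)) F = F := by
  refine CategoryTheory.Functor.ext (fun s => Strict.id_comp _) fun s t f => ?_
  simp [Strict.leftUnitor_eqToIso]
  rfl

theorem comp_const_id {a b : D} (F : Fin (j.len + 1) ⥤ (a ⟶ b)) :
    comp F ((Functor.const _).obj (𝟙 b)) = F := by
  refine CategoryTheory.Functor.ext (fun s => Strict.comp_id _) fun s t f => ?_
  simp [Strict.rightUnitor_eqToIso]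
  rfl

theorem comp_assoc {a b c d : D} (F : Fin (j.len + 1) ⥤ (a ⟶ b))
    (G : Fin (j.len + 1) ⥤ (b ⟶ c)) (H : Fin (j.len + 1) ⥤ (c ⟶ d)) :
    comp (comp F G) H = comp F (comp G H) := by
  refine CategoryTheory.Functor.ext (fun s => Strict.assoc _ _ _) fun s t f => ?_
  have e : (F.obj s ≫ G.obj s) ◁ H.map f ≫ (F.obj s ◁ G.map f ≫ F.map f ▷ G.obj t) ▷ H.obj t =
      (α_ (F.obj s) (G.obj s) (H.obj s)).hom ≫ (F.obj s ◁ (G.obj s ◁ H.map f ≫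
        G.map f ▷ H.obj t) ≫ F.map f ▷ (G.obj t ≫ H.obj t)) ≫
        (α_ (F.obj t) (G.obj t) (H.obj t)).inv := by
    simp
  rw [Strict.associator_eqToIso, Strict.associator_eqToIso] at e
  exact e

/-- An object of `Chain D j`, as an object of `D`. -/
def toD (a : Chain D j) : D := a

/-- An object of `D`, as an object of `Chain D j`. -/
def ofD (j : SimplexCategory) (a : D) : Chain D j := a

/-- A functor from `[i]` to this category is a row of `i` composable columns of `j` composable
2-morphisms, together with all composites that a simplex needs. -/
instance : Category (Chain D j) where
  Hom a b := Fin (j.len + 1) ⥤ (a.toD ⟶ b.toD)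
  id a := (Functor.const _).obj (𝟙 a.toD)
  comp F G := comp F G
  id_comp F := const_id_comp F
  comp_id F := comp_const_id F
  assoc F G H := comp_assoc F G H

/-- The sequence of 2-morphisms given by a morphism of `Chain D j`. -/
def seq {a b : Chain D j} (F : a ⟶ b) : Fin (j.len + 1) ⥤ (a.toD ⟶ b.toD) := F

/-- The morphism of `Chain D j` given by a sequence of 2-morphisms. -/
def ofSeq {a b : D} (F : Fin (j.len + 1) ⥤ (a ⟶ b)) :
    ofD j a ⟶ ofD j b := F

/-- The identity adjoint equivalence between equal objects. -/
def eqVer {a b : D} (h : a = b) : (Hsim D).Ver a b := h ▸ Equivalence.id a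

theorem eqVer_trans {a b c : D} (h : a = b) (h' : b = c) :
    eqVer (h.trans h') = (Hsim D).vcomp (eqVer h) (eqVer h') := by
  subst h h'
  exact ((Hsim D).vcomp_vid (Equivalence.id _)).symm

variable {i : SimplexCategory} (S : Fin (i.len + 1) ⥤ Chain D j)

/-- The squares of the double functor given by a sequence of sequences of 2-morphisms. -/
def thinSq {a₁ a₂ a₃ a₄ : Fin (i.len + 1)} {b b' : Fin (j.len + 1)} (h : a₁ ≤ a₂) (h' : a₃ ≤ a₄)
    (e : a₁ = a₃) (e' : a₂ = a₄) (hb : b ≤ b') :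
    (Hsim D).Sq ((seq (S.map (homOfLE h))).obj b) (eqVer (congrArg (fun a => (S.obj a).toD) e))
      (eqVer (congrArg (fun a => (S.obj a).toD) e')) ((seq (S.map (homOfLE h'))).obj b') := by
  subst e e'
  exact glob ((seq (S.map (homOfLE h))).map (homOfLE hb))

theorem thinSq_rfl {a a' : Fin (i.len + 1)} {b b' : Fin (j.len + 1)} (h : a ≤ a') (hb : b ≤ b') :
    (Hsim D).tSq (thinSq S h h rfl rfl hb) =
      tGlob ((seq (S.map (homOfLE h))).map (homOfLE hb)) := rfl

theorem tGlob_seq_congr {a b : Chain D j} {F G : a ⟶ b} (h : F = G) {s t : Fin (j.len + 1)}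
    (f : s ⟶ t) : tGlob ((seq F).map f) = tGlob ((seq G).map f) := by
  subst h; rfl

theorem thinSq_hid {a a' : Fin (i.len + 1)} {b b' : Fin (j.len + 1)} (h : a ≤ a) (h' : a' ≤ a')
    (e : a = a') (hb : b ≤ b') : (Hsim D).tSq (thinSq S h h' e e hb) =
      (Hsim D).tSq ((Hsim D).sqHid (eqVer (congrArg (fun a => (S.obj a).toD) e))) := by
  subst e
  rw [thinSq_rfl]
  refine (tGlob_seq_congr (S.map_id a) _).trans ?_
  refine (tGlob_id _).trans ?_
  exact congrArg (Hsim D).tSq ((Hsim D).sqHid_vid (S.obj a).toD).symm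

theorem thinSq_vid {a a' : Fin (i.len + 1)} {b : Fin (j.len + 1)} (h : a ≤ a')
    (hb : b ≤ b) : (Hsim D).tSq (thinSq S h h rfl rfl hb) =
      (Hsim D).tSq ((Hsim D).sqVid ((seq (S.map (homOfLE h))).obj b)) := by
  rw [thinSq_rfl]
  exact (congrArg tGlob ((seq (S.map (homOfLE h))).map_id b)).trans (tGlob_id _)

/-- The equalities `b = c` and `b' = c'` are hypotheses because a horizontal path preserves its
level in direction `j` only propositionally. Past them, this is functoriality of `S` combined with
the formula for horizontal composition in `Chain D j`. -/
theorem thinSq_hcomp {a₁ a₂ a₃ a₁' a₂' a₃' : Fin (i.len + 1)} {b b' c c' : Fin (j.len + 1)}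
    (h : a₁ ≤ a₂) (h' : a₂ ≤ a₃) (h'' : a₁ ≤ a₃) (k : a₁' ≤ a₂') (k' : a₂' ≤ a₃')
    (k'' : a₁' ≤ a₃') (e₁ : a₁ = a₁') (e₂ : a₂ = a₂') (e₃ : a₃ = a₃') (hb : b ≤ b')
    (hc : c ≤ c') (hbc : b = c) (hbc' : b' = c') :
    (Hsim D).tSq (thinSq S h'' k'' e₁ e₃ hb) =
      (Hsim D).tSq ((Hsim D).sqHcomp (thinSq S h k e₁ e₂ hb) (thinSq S h' k' e₂ e₃ hc)) := by
  subst e₁ e₂ e₃ hbc hbc'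
  refine Eq.trans ?_ (sqHcomp_glob _ _).symm
  rw [thinSq_rfl]
  exact tGlob_seq_congr (S.map_comp (homOfLE h) (homOfLE h')) _

theorem thinSq_vcomp {a₁ a₂ a₃ a₄ a₅ a₆ : Fin (i.len + 1)} {b₁ b₂ b₃ : Fin (j.len + 1)}
    (h : a₁ ≤ a₂) (h' : a₃ ≤ a₄) (h'' : a₅ ≤ a₆) (e₁ : a₁ = a₃) (e₂ : a₂ = a₄) (e₃ : a₃ = a₅)
    (e₄ : a₄ = a₆) (hb : b₁ ≤ b₂) (hb' : b₂ ≤ b₃) :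
    (Hsim D).tSq (thinSq S h h'' (e₁.trans e₃) (e₂.trans e₄) (hb.trans hb')) =
      (Hsim D).tSq ((Hsim D).sqVcomp (thinSq S h h' e₁ e₂ hb) (thinSq S h' h'' e₃ e₄ hb')) := by
  subst e₁ e₂ e₃ e₄
  refine Eq.trans ?_ (sqVcomp_glob _ _).symm
  rw [thinSq_rfl]
  exact congrArg tGlob ((seq (S.map (homOfLE h))).map_comp (homOfLE hb) (homOfLE hb'))

theorem hor_comp_aux {a₁ a₂ a₃ : Fin (i.len + 1)} {b c : Fin (j.len + 1)}
    (h : a₁ ≤ a₂) (h' : a₂ ≤ a₃) (h'' : a₁ ≤ a₃) (hb : b = c) :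
    (seq (S.map (homOfLE h''))).obj b =
      (seq (S.map (homOfLE h))).obj b ≫ (seq (S.map (homOfLE h'))).obj c := by
  subst hb
  exact congrArg (fun F => (seq F).obj b) (S.map_comp (homOfLE h) (homOfLE h'))

/-- The double functor on `𝕏_{i,j,k}` given by `i` composable sequences of `j` 2-morphisms. -/
def simplex (k : SimplexCategory) : DoubleFunctor (X i j k) (Hsim D) where
  obj x := (S.obj x.1).toD
  hor {x _} f := (seq (S.map (homOfLE (gridHor_path f).1))).obj x.2.1
  ver f := eqVer (congrArg (fun a => (S.obj a).toD) (gridVer_path f).1)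
  sq {_ _ _ _ f p q g} _ := thinSq S (gridHor_path f).1 (gridHor_path g).1 (gridVer_path p).1
    (gridVer_path q).1 (gridVer_path p).2
  hor_id x := congrArg (fun F => (seq F).obj x.2.1) (S.map_id x.1)
  hor_comp f _ := hor_comp_aux S _ _ _ (gridHor_path f).2
  ver_id _ := rfl
  ver_comp _ _ := eqVer_trans _ _
  sq_hid _ := heq_of_tSq (thinSq_hid S _ _ _ _)
  sq_vid _ := heq_of_tSq (thinSq_vid S _ _)
  sq_hcomp {_ _ _ _ _ _ f _ _ _ _ g _} _ _ :=
    heq_of_tSq (thinSq_hcomp S _ _ _ _ _ _ _ _ _ _ _ (gridHor_path f).2 (gridHor_path g).2)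
  sq_vcomp _ _ := heq_of_tSq (thinSq_vcomp S _ _ _ _ _ _ _ _ _)

end Chain

/-! ### Standard simplices for the data and axioms of a pseudofunctor -/

section Simplices

open Chain

variable {D : Type u} [Bicategory.{w, v} D] [Strict D]

/-- The 0-simplex of the nerve given by an object. -/
def nervePt (x : D) : DoubleFunctor (X ⦋0⦌ ⦋0⦌ ⦋0⦌) (Hsim D) :=
  simplex (i := ⦋0⦌) (j := ⦋0⦌) ((Functor.const _).obj (ofD ⦋0⦌ x)) ⦋0⦌

/-- The simplex of the nerve given by a morphism. -/
def nerveEdge {x y : D} (f : x ⟶ y) : DoubleFunctor (X ⦋1⦌ ⦋0⦌ ⦋0⦌) (Hsim D) :=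
  simplex (i := ⦋1⦌) (j := ⦋0⦌) (ComposableArrows.mk₁ (ofSeq ((Functor.const _).obj f))) ⦋0⦌

/-- The simplex of the nerve given by a 2-morphism. -/
def nerveQuad {x y : D} {f g : x ⟶ y} (η : f ⟶ g) : DoubleFunctor (X ⦋1⦌ ⦋1⦌ ⦋0⦌) (Hsim D) :=
  simplex (i := ⦋1⦌) (j := ⦋1⦌) (ComposableArrows.mk₁ (ofSeq (ComposableArrows.mk₁ η))) ⦋0⦌

/-- The simplex of the nerve given by two vertically composable 2-morphisms. -/
def nerveQuadV {x y : D} {f g h : x ⟶ y} (η : f ⟶ g) (θ : g ⟶ h) :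
    DoubleFunctor (X ⦋1⦌ ⦋2⦌ ⦋0⦌) (Hsim D) :=
  simplex (i := ⦋1⦌) (j := ⦋2⦌) (ComposableArrows.mk₁ (ofSeq (ComposableArrows.mk₂ η θ))) ⦋0⦌

/-- The simplex of the nerve given by two horizontally composable 2-morphisms. -/
def nerveQuadH {x y z : D} {f g : x ⟶ y} (η : f ⟶ g) {f' g' : y ⟶ z} (θ : f' ⟶ g') :
    DoubleFunctor (X ⦋2⦌ ⦋1⦌ ⦋0⦌) (Hsim D) :=
  simplex (i := ⦋2⦌) (j := ⦋1⦌) (ComposableArrows.mk₂ (ofSeq (ComposableArrows.mk₁ η))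
    (ofSeq (ComposableArrows.mk₁ θ))) ⦋0⦌

/-- The simplex of the nerve given by two composable morphisms. -/
def nerveTriangle {x y z : D} (f : x ⟶ y) (g : y ⟶ z) :
    DoubleFunctor (X ⦋2⦌ ⦋0⦌ ⦋0⦌) (Hsim D) :=
  simplex (i := ⦋2⦌) (j := ⦋0⦌) (ComposableArrows.mk₂ (ofSeq ((Functor.const _).obj f))
    (ofSeq ((Functor.const _).obj g))) ⦋0⦌

/-- The simplex of the nerve given by three composable morphisms. -/
def nerveTetra {x y z t : D} (f : x ⟶ y) (g : y ⟶ z) (h : z ⟶ t) :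
    DoubleFunctor (X ⦋3⦌ ⦋0⦌ ⦋0⦌) (Hsim D) :=
  simplex (i := ⦋3⦌) (j := ⦋0⦌) (ComposableArrows.mk₃ (ofSeq ((Functor.const _).obj f))
    (ofSeq ((Functor.const _).obj g)) (ofSeq ((Functor.const _).obj h))) ⦋0⦌

end Simplices

/-! ### Edges, squares and triangles of a grid -/

namespace DoubleCat

variable {i j k : SimplexCategory}

theorem gridHor_le {a a' : Fin (i.len + 1)} (h : a ≤ a') (b : Fin (j.len + 1))
    (c : Fin (k.len + 1)) : ((a, b, c) : Grid i j k) = (a', b, c) ∨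
      gridHor i j k (a, b, c) (a', b, c) := by
  rcases h.lt_or_eq with h | rfl
  · exact Or.inr (Or.inl ⟨h, rfl⟩)
  · exact Or.inl rfl

theorem gridVer_le (a : Fin (i.len + 1)) {b b' : Fin (j.len + 1)} (h : b ≤ b')
    (c : Fin (k.len + 1)) : ((a, b, c) : Grid i j k) = (a, b', c) ∨
      gridVer i j k (a, b, c) (a, b', c) := by
  rcases h.lt_or_eq with h | rfl
  · exact Or.inr ⟨rfl, h, rfl⟩
  · exact Or.inl rfl

/-- The edge in direction `i` of a grid between two vertices, or the path of length zero. -/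
def hle {a a' : Fin (i.len + 1)} (h : a ≤ a') (b : Fin (j.len + 1)) (c : Fin (k.len + 1)) :
    RelPath (gridHor i j k) (a, b, c) (a', b, c) := .ofLe (gridHor_le h b c)

/-- The edge in direction `j` of a grid between two vertices, or the path of length zero. -/
def vle (a : Fin (i.len + 1)) {b b' : Fin (j.len + 1)} (h : b ≤ b') (c : Fin (k.len + 1)) :
    RelPath (gridVer i j k) (a, b, c) (a, b', c) := .ofLe (gridVer_le a h c)

theorem hle_self (a : Fin (i.len + 1)) (h : a ≤ a) (b : Fin (j.len + 1)) (c : Fin (k.len + 1)) :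
    hle h b c = .nil := RelPath.ofLe_self _

theorem vle_self (a : Fin (i.len + 1)) (b : Fin (j.len + 1)) (h : b ≤ b) (c : Fin (k.len + 1)) :
    vle a h c = .nil := RelPath.ofLe_self _

theorem hle_of_lt {a a' : Fin (i.len + 1)} (h : a < a') (b : Fin (j.len + 1))
    (c : Fin (k.len + 1)) : hle h.le b c = .single (Or.inl ⟨h, rfl⟩) :=
  RelPath.ofLe_of_ne _ fun e => h.ne (congrArg Prod.fst e)

theorem vle_of_lt (a : Fin (i.len + 1)) {b b' : Fin (j.len + 1)} (h : b < b')
    (c : Fin (k.len + 1)) : vle a h.le c = .single ⟨rfl, h, rfl⟩ :=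
  RelPath.ofLe_of_ne _ fun e => h.ne (congrArg (fun x => x.2.1) e)

variable {i' j' k' : SimplexCategory} (α : i ⟶ i') (β : j ⟶ j') (γ : k ⟶ k')

/-- Admitting the empty path in `hle` makes this formula valid for every operator, including those
that collapse the edge. Degenerate cases then need no separate treatment. -/
theorem Xmap_hle {a a' : Fin (i.len + 1)} (h : a ≤ a') (b : Fin (j.len + 1))
    (c : Fin (k.len + 1)) : (Xmap α β γ).hor (hle h b c) =
      hle (α.toOrderHom.monotone h) (β.toOrderHom b) (γ.toOrderHom c) :=
  RelPath.map_ofLe _ _ _ _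

theorem Xmap_vle (a : Fin (i.len + 1)) {b b' : Fin (j.len + 1)} (h : b ≤ b')
    (c : Fin (k.len + 1)) : (Xmap α β γ).ver (vle a h c) =
      vle (α.toOrderHom a) (β.toOrderHom.monotone h) (γ.toOrderHom c) :=
  RelPath.map_ofLe _ _ _ _

end DoubleCat

namespace DoubleCat

variable {i j : SimplexCategory}

/-- For `k = 0` only edges in direction `i` survive, so the horizontal relation is a strict order.
Edges in direction `k` go both ways and would destroy this, so the extensionality results below are
confined to `k = 0`. -/
theorem gridHor_iff {x y : Grid i j ⦋0⦌} : gridHor i j ⦋0⦌ x y ↔ x.1 < y.1 ∧ x.2 = y.2 := by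
  have h : x.2.2 = y.2.2 := Subsingleton.elim (α := Fin 1) _ _
  simp [gridHor, h]

theorem gridHor_trans (x y z : Grid i j ⦋0⦌) (h : gridHor i j ⦋0⦌ x y)
    (h' : gridHor i j ⦋0⦌ y z) : gridHor i j ⦋0⦌ x z := by
  rw [gridHor_iff] at *
  exact ⟨h.1.trans h'.1, h.2.trans h'.2⟩

theorem gridHor_irrefl (x : Grid i j ⦋0⦌) : ¬ gridHor i j ⦋0⦌ x x := by
  rw [gridHor_iff]
  exact fun h => lt_irrefl _ h.1

theorem gridVer_trans {k : SimplexCategory} (x y z : Grid i j k) (h : gridVer i j k x y)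
    (h' : gridVer i j k y z) : gridVer i j k x z :=
  ⟨h.1.trans h'.1, h.2.1.trans h'.2.1, h.2.2.trans h'.2.2⟩

theorem gridVer_irrefl {k : SimplexCategory} (x : Grid i j k) : ¬ gridVer i j k x x :=
  fun h => lt_irrefl _ h.2.1

/-- Horizontal edges change only the first coordinate and vertical edges only the second, so
opposite sides of a square are trivial simultaneously. -/
theorem grid_compat {x y x' y' : Grid i j ⦋0⦌} (h : x = y ∨ gridHor i j ⦋0⦌ x y)
    (p : x = x' ∨ gridVer i j ⦋0⦌ x x') (q : y = y' ∨ gridVer i j ⦋0⦌ y y')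
    (h' : x' = y' ∨ gridHor i j ⦋0⦌ x' y') : (x = y ↔ x' = y') ∧ (x = x' ↔ y = y') := by
  have hor : ∀ {x y : Grid i j ⦋0⦌}, (x = y ∨ gridHor i j ⦋0⦌ x y) → x.2 = y.2 := by
    rintro x y (rfl | h)
    · rfl
    · exact (gridHor_iff.1 h).2
  have ver : ∀ {x y : Grid i j ⦋0⦌}, (x = y ∨ gridVer i j ⦋0⦌ x y) → x.1 = y.1 := by
    rintro x y (rfl | h)
    · rfl
    · exact h.1
  have e₁ := hor h
  have e₂ := hor h'
  have e₃ := ver p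
  have e₄ := ver q
  obtain ⟨a₁, b₁⟩ := x
  obtain ⟨a₂, b₂⟩ := y
  obtain ⟨a₃, b₃⟩ := x'
  obtain ⟨a₄, b₄⟩ := y'
  simp only at e₁ e₂ e₃ e₄
  subst e₁ e₂ e₃ e₄
  simp

end DoubleCat

namespace DoubleFunctor

variable {i j k : SimplexCategory} {Z : DoubleCat.{w, u, v₁, v₂}} (P : DoubleFunctor (X i j k) Z)

/-- The image of an edge in direction `i`. -/
def hEdge {a a' : Fin (i.len + 1)} (h : a ≤ a') (b : Fin (j.len + 1)) (c : Fin (k.len + 1)) :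
    Z.TotalHor := Z.tHor (P.hor (hle h b c))

/-- The image of an edge in direction `j`. -/
def vEdge (a : Fin (i.len + 1)) {b b' : Fin (j.len + 1)} (h : b ≤ b') (c : Fin (k.len + 1)) :
    Z.TotalVer := Z.tVer (P.ver (vle a h c))

/-- The image of a square of edges in directions `i` and `j`. -/
def quad {a a' : Fin (i.len + 1)} (h : a ≤ a') {b b' : Fin (j.len + 1)} (h' : b ≤ b')
    (c : Fin (k.len + 1)) : Z.TotalSq :=
  P.square (hle h b c) (vle a h' c) (vle a' h' c) (hle h b' c)

/-- The image of the square from two consecutive edges in direction `i` to one edge. -/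
def tri {a a' a'' : Fin (i.len + 1)} (h : a ≤ a') (h' : a' ≤ a'') (b : Fin (j.len + 1))
    (c : Fin (k.len + 1)) : Z.TotalSq :=
  P.square ((hle h b c).comp (hle h' b c)) .nil .nil (hle (h.trans h') b c)

/-- The image of the square from one edge in direction `i` to two consecutive edges. -/
def triInv {a a' a'' : Fin (i.len + 1)} (h : a ≤ a') (h' : a' ≤ a'') (b : Fin (j.len + 1))
    (c : Fin (k.len + 1)) : Z.TotalSq :=
  P.square (hle (h.trans h') b c) .nil .nil ((hle h b c).comp (hle h' b c))

/-- The image of the square from two consecutive edges in direction `j` to one edge. -/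
def vTri (a : Fin (i.len + 1)) {b b' b'' : Fin (j.len + 1)} (h : b ≤ b') (h' : b' ≤ b'')
    (c : Fin (k.len + 1)) : Z.TotalSq :=
  P.square .nil ((vle a h c).comp (vle a h' c)) (vle a (h.trans h') c) .nil

/-- The image of the square from one edge in direction `j` to two consecutive edges. -/
def vTriInv (a : Fin (i.len + 1)) {b b' b'' : Fin (j.len + 1)} (h : b ≤ b') (h' : b' ≤ b'')
    (c : Fin (k.len + 1)) : Z.TotalSq :=
  P.square .nil (vle a (h.trans h') c) ((vle a h c).comp (vle a h' c)) .nil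

section

variable {i' j' k' : SimplexCategory} (α : i' ⟶ i) (β : j' ⟶ j) (γ : k' ⟶ k)

theorem hEdge_Xmap {a a' : Fin (i'.len + 1)} (h : a ≤ a') (b : Fin (j'.len + 1))
    (c : Fin (k'.len + 1)) : ((Xmap α β γ).comp P).hEdge h b c =
      P.hEdge (α.toOrderHom.monotone h) (β.toOrderHom b) (γ.toOrderHom c) :=
  congrArg (fun f => Z.tHor (P.hor f)) (Xmap_hle α β γ h b c)

theorem vEdge_Xmap (a : Fin (i'.len + 1)) {b b' : Fin (j'.len + 1)} (h : b ≤ b')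
    (c : Fin (k'.len + 1)) : ((Xmap α β γ).comp P).vEdge a h c =
      P.vEdge (α.toOrderHom a) (β.toOrderHom.monotone h) (γ.toOrderHom c) :=
  congrArg (fun f => Z.tVer (P.ver f)) (Xmap_vle α β γ a h c)

theorem quad_Xmap {a a' : Fin (i'.len + 1)} (h : a ≤ a') {b b' : Fin (j'.len + 1)} (h' : b ≤ b')
    (c : Fin (k'.len + 1)) : ((Xmap α β γ).comp P).quad h h' c =
      P.quad (α.toOrderHom.monotone h) (β.toOrderHom.monotone h') (γ.toOrderHom c) := by
  change P.square ((Xmap α β γ).hor (hle h b c)) ((Xmap α β γ).ver (vle a h' c))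
    ((Xmap α β γ).ver (vle a' h' c)) ((Xmap α β γ).hor (hle h b' c)) = _
  rw [Xmap_hle, Xmap_hle, Xmap_vle, Xmap_vle]
  rfl

theorem Xmap_hle_comp {a a' a'' : Fin (i'.len + 1)} (h : a ≤ a') (h' : a' ≤ a'')
    (b : Fin (j'.len + 1)) (c : Fin (k'.len + 1)) :
    (Xmap α β γ).hor ((hle h b c).comp (hle h' b c)) =
      (hle (α.toOrderHom.monotone h) (β.toOrderHom b) (γ.toOrderHom c)).comp
        (hle (α.toOrderHom.monotone h') (β.toOrderHom b) (γ.toOrderHom c)) :=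
  ((Xmap α β γ).hor_comp _ _).trans (congrArg₂ _ (Xmap_hle α β γ h b c) (Xmap_hle α β γ h' b c))

theorem Xmap_vle_comp (a : Fin (i'.len + 1)) {b b' b'' : Fin (j'.len + 1)} (h : b ≤ b')
    (h' : b' ≤ b'') (c : Fin (k'.len + 1)) :
    (Xmap α β γ).ver ((vle a h c).comp (vle a h' c)) =
      (vle (α.toOrderHom a) (β.toOrderHom.monotone h) (γ.toOrderHom c)).comp
        (vle (α.toOrderHom a) (β.toOrderHom.monotone h') (γ.toOrderHom c)) :=
  ((Xmap α β γ).ver_comp _ _).trans (congrArg₂ _ (Xmap_vle α β γ a h c) (Xmap_vle α β γ a h' c))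

theorem tri_Xmap {a a' a'' : Fin (i'.len + 1)} (h : a ≤ a') (h' : a' ≤ a'')
    (b : Fin (j'.len + 1)) (c : Fin (k'.len + 1)) : ((Xmap α β γ).comp P).tri h h' b c =
      P.tri (α.toOrderHom.monotone h) (α.toOrderHom.monotone h') (β.toOrderHom b)
        (γ.toOrderHom c) := by
  change P.square ((Xmap α β γ).hor ((hle h b c).comp (hle h' b c))) .nil .nil
    ((Xmap α β γ).hor (hle (h.trans h') b c)) = _
  rw [Xmap_hle, Xmap_hle_comp]
  rfl

theorem triInv_Xmap {a a' a'' : Fin (i'.len + 1)} (h : a ≤ a') (h' : a' ≤ a'')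
    (b : Fin (j'.len + 1)) (c : Fin (k'.len + 1)) : ((Xmap α β γ).comp P).triInv h h' b c =
      P.triInv (α.toOrderHom.monotone h) (α.toOrderHom.monotone h') (β.toOrderHom b)
        (γ.toOrderHom c) := by
  change P.square ((Xmap α β γ).hor (hle (h.trans h') b c)) .nil .nil
    ((Xmap α β γ).hor ((hle h b c).comp (hle h' b c))) = _
  rw [Xmap_hle, Xmap_hle_comp]
  rfl

theorem vTri_Xmap (a : Fin (i'.len + 1)) {b b' b'' : Fin (j'.len + 1)} (h : b ≤ b')
    (h' : b' ≤ b'') (c : Fin (k'.len + 1)) : ((Xmap α β γ).comp P).vTri a h h' c =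
      P.vTri (α.toOrderHom a) (β.toOrderHom.monotone h) (β.toOrderHom.monotone h')
        (γ.toOrderHom c) := by
  change P.square .nil ((Xmap α β γ).ver ((vle a h c).comp (vle a h' c)))
    ((Xmap α β γ).ver (vle a (h.trans h') c)) .nil = _
  rw [Xmap_vle, Xmap_vle_comp]
  rfl

theorem vTriInv_Xmap (a : Fin (i'.len + 1)) {b b' b'' : Fin (j'.len + 1)} (h : b ≤ b')
    (h' : b' ≤ b'') (c : Fin (k'.len + 1)) : ((Xmap α β γ).comp P).vTriInv a h h' c =
      P.vTriInv (α.toOrderHom a) (β.toOrderHom.monotone h) (β.toOrderHom.monotone h')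
        (γ.toOrderHom c) := by
  change P.square .nil ((Xmap α β γ).ver (vle a (h.trans h') c))
    ((Xmap α β γ).ver ((vle a h c).comp (vle a h' c))) .nil = _
  rw [Xmap_vle, Xmap_vle_comp]
  rfl

end

section Ext

variable {P Q : DoubleFunctor (X i j ⦋0⦌) Z}

theorem forall_gridHor {C : ∀ {x y : Grid i j ⦋0⦌}, RelPath (gridHor i j ⦋0⦌) x y → Prop}
    (H : ∀ {a a'} (h : a < a') b c, C (hle h.le b c)) {x y : Grid i j ⦋0⦌}
    (e : gridHor i j ⦋0⦌ x y) : C (.single e) := by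
  obtain ⟨a, b, c⟩ := x
  obtain ⟨a', b', c'⟩ := y
  have h := gridHor_iff.1 e
  obtain ⟨rfl, rfl⟩ := Prod.mk.inj h.2
  have := H h.1 b c
  rwa [hle_of_lt h.1] at this

theorem forall_gridVer {C : ∀ {x y : Grid i j ⦋0⦌}, RelPath (gridVer i j ⦋0⦌) x y → Prop}
    (H : ∀ a {b b'} (h : b < b') c, C (vle a h.le c)) {x y : Grid i j ⦋0⦌}
    (e : gridVer i j ⦋0⦌ x y) : C (.single e) := by
  obtain ⟨a, b, c⟩ := x
  obtain ⟨a', b', c'⟩ := y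
  obtain ⟨h₁, h₂, h₃⟩ := _root_.id e
  simp only at h₁ h₂ h₃
  subst h₁ h₃
  have := H a h₂ c
  rwa [vle_of_lt a h₂] at this

/-- Opposite sides of a square of edges move the same coordinate between the same values, so `quad`
accounts for all of them. -/
theorem quad_congr_edge
    (hs : ∀ {a a'} (h : a < a') {b b'} (h' : b < b') c, P.quad h.le h'.le c = Q.quad h.le h'.le c)
    {x y x' y' : Grid i j ⦋0⦌} (e : gridHor i j ⦋0⦌ x y) (p : gridVer i j ⦋0⦌ x x')
    (q : gridVer i j ⦋0⦌ y y') (e' : gridHor i j ⦋0⦌ x' y') :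
    P.square (.single e) (.single p) (.single q) (.single e') =
      Q.square (.single e) (.single p) (.single q) (.single e') := by
  obtain ⟨a, b, c⟩ := x
  obtain ⟨a', b', c'⟩ := y
  have h := gridHor_iff.1 e
  obtain ⟨rfl, rfl⟩ := Prod.mk.inj h.2
  obtain ⟨a₁, b₁, c₁⟩ := x'
  obtain ⟨h₁, h₂, h₃⟩ := _root_.id p
  obtain ⟨a₂, b₂, c₂⟩ := y'
  obtain ⟨h₄, h₅, h₆⟩ := _root_.id q
  have h' := gridHor_iff.1 e'
  obtain ⟨h₇, h₈⟩ := Prod.mk.inj h'.2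
  simp only at h₁ h₂ h₃ h₄ h₅ h₆ h₇ h₈
  subst h₁ h₃ h₄ h₆ h₇
  have := hs h.1 h₂ c
  unfold quad at this
  rwa [hle_of_lt h.1, hle_of_lt h.1, vle_of_lt _ h₂, vle_of_lt _ h₂] at this

/-- Double functors on `𝕏_{i,j,0}` agree if they agree on objects, edges, squares of edges and
triangles. -/
theorem grid_ext (ho : ∀ x, P.obj x = Q.obj x)
    (hh : ∀ {a a'} (h : a < a') b c, P.hEdge h.le b c = Q.hEdge h.le b c)
    (hv : ∀ a {b b'} (h : b < b') c, P.vEdge a h.le c = Q.vEdge a h.le c)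
    (hs : ∀ {a a'} (h : a < a') {b b'} (h' : b < b') c, P.quad h.le h'.le c = Q.quad h.le h'.le c)
    (ht : ∀ {a a' a''} (h : a < a') (h' : a' < a'') b c,
      P.tri h.le h'.le b c = Q.tri h.le h'.le b c)
    (ht' : ∀ {a a' a''} (h : a < a') (h' : a' < a'') b c,
      P.triInv h.le h'.le b c = Q.triInv h.le h'.le b c)
    (vt : ∀ a {b b' b''} (h : b < b') (h' : b' < b'') c,
      P.vTri a h.le h'.le c = Q.vTri a h.le h'.le c)
    (vt' : ∀ a {b b' b''} (h : b < b') (h' : b' < b'') c,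
      P.vTriInv a h.le h'.le c = Q.vTriInv a h.le h'.le c) : P = Q := by
  refine free_ext gridHor_trans gridHor_irrefl gridVer_trans gridVer_irrefl grid_compat ho
    (forall_gridHor (C := fun p => Z.tHor (P.hor p) = Z.tHor (Q.hor p)) hh)
    (forall_gridVer (C := fun p => Z.tVer (P.ver p) = Z.tVer (Q.ver p)) hv)
    (quad_congr_edge hs) ?_ ?_ ?_ ?_
  · rintro ⟨a, b, c⟩ ⟨a', b', c'⟩ ⟨a'', b'', c''⟩ e e' e''
    have h := gridHor_iff.1 e
    obtain ⟨rfl, rfl⟩ := Prod.mk.inj h.2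
    have h' := gridHor_iff.1 e'
    obtain ⟨rfl, rfl⟩ := Prod.mk.inj h'.2
    have := ht h.1 h'.1 b c
    unfold tri at this
    rwa [hle_of_lt h.1, hle_of_lt h'.1, hle_of_lt (h.1.trans h'.1)] at this
  · rintro ⟨a, b, c⟩ ⟨a', b', c'⟩ ⟨a'', b'', c''⟩ e e' e''
    have h := gridHor_iff.1 e
    obtain ⟨rfl, rfl⟩ := Prod.mk.inj h.2
    have h' := gridHor_iff.1 e'
    obtain ⟨rfl, rfl⟩ := Prod.mk.inj h'.2
    have := ht' h.1 h'.1 b c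
    unfold triInv at this
    rwa [hle_of_lt h.1, hle_of_lt h'.1, hle_of_lt (h.1.trans h'.1)] at this
  · rintro ⟨a, b, c⟩ ⟨a', b', c'⟩ ⟨a'', b'', c''⟩ e e' e''
    obtain ⟨h₁, h₂, h₃⟩ := _root_.id e
    obtain ⟨h₄, h₅, h₆⟩ := _root_.id e'
    simp only at h₁ h₂ h₃ h₄ h₅ h₆
    subst h₁ h₃ h₄ h₆
    have := vt a h₂ h₅ c
    unfold vTri at this
    rwa [vle_of_lt _ h₂, vle_of_lt _ h₅, vle_of_lt _ (h₂.trans h₅)] at this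
  · rintro ⟨a, b, c⟩ ⟨a', b', c'⟩ ⟨a'', b'', c''⟩ e e' e''
    obtain ⟨h₁, h₂, h₃⟩ := _root_.id e
    obtain ⟨h₄, h₅, h₆⟩ := _root_.id e'
    simp only at h₁ h₂ h₃ h₄ h₅ h₆
    subst h₁ h₃ h₄ h₆
    have := vt' a h₂ h₅ c
    unfold vTriInv at this
    rwa [vle_of_lt _ h₂, vle_of_lt _ h₅, vle_of_lt _ (h₂.trans h₅)] at this

end Ext

end DoubleFunctor

/-! ### Recognizing small simplices of a gaunt nerve -/

namespace IsGaunt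

open DoubleFunctor

variable {A : Type u} [Bicategory.{w, v} A] [Strict A] {i j : SimplexCategory}

/-- Double functors from `𝕏_{i,j,0}` to a gaunt 2-category agree if they agree on objects, edges in
direction `i` and squares of edges. -/
theorem grid_ext (hA : IsGaunt A) {P Q : DoubleFunctor (X i j ⦋0⦌) (Hsim A)}
    (ho : ∀ x, P.obj x = Q.obj x)
    (hh : ∀ {a a'} (h : a < a') b c, P.hEdge h.le b c = Q.hEdge h.le b c)
    (hs : ∀ {a a'} (h : a < a') {b b'} (h' : b < b') c,
      P.quad h.le h'.le c = Q.quad h.le h'.le c) : P = Q :=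
  hA.free_ext gridHor_trans gridHor_irrefl gridVer_trans gridVer_irrefl grid_compat ho
    (forall_gridHor (C := fun p => (Hsim A).tHor (P.hor p) = (Hsim A).tHor (Q.hor p)) hh)
    (quad_congr_edge hs)

/-- The generating edge also fixes both objects, and there are no genuine edges in direction `j`. So
restrictions of simplices to edges can be recognized as `nerveEdge f`. -/
theorem ext_edge (hA : IsGaunt A) {P Q : DoubleFunctor (X ⦋1⦌ ⦋0⦌ ⦋0⦌) (Hsim A)}
    (h : P.hEdge (i := ⦋1⦌) (Fin.zero_le (1 : Fin 2)) 0 0 =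
      Q.hEdge (i := ⦋1⦌) (Fin.zero_le (1 : Fin 2)) 0 0) : P = Q := by
  refine hA.grid_ext ?_ ?_ ?_
  · rintro ⟨a, b, c⟩
    obtain rfl : b = 0 := Subsingleton.elim (α := Fin 1) _ _
    obtain rfl : c = 0 := Subsingleton.elim (α := Fin 1) _ _
    obtain rfl | rfl : a = (0 : Fin 2) ∨ a = (1 : Fin 2) := by
      revert a; decide
    · exact tHor_src h
    · exact tHor_tgt h
  · intro a a' h' b c
    obtain rfl : b = 0 := Subsingleton.elim (α := Fin 1) _ _
    obtain rfl : c = 0 := Subsingleton.elim (α := Fin 1) _ _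
    obtain ⟨rfl, rfl⟩ : a = (0 : Fin 2) ∧ a' = (1 : Fin 2) := by
      revert a a'; decide
    exact h
  · intro a a' h b b' h' c
    exact absurd (Subsingleton.elim (α := Fin 1) b b') h'.ne

theorem ext_triangle (hA : IsGaunt A) {P Q : DoubleFunctor (X ⦋2⦌ ⦋0⦌ ⦋0⦌) (Hsim A)}
    (h : P.hEdge (i := ⦋2⦌) (Fin.zero_le (1 : Fin 3)) 0 0 =
      Q.hEdge (i := ⦋2⦌) (Fin.zero_le (1 : Fin 3)) 0 0)
    (h' : P.hEdge (i := ⦋2⦌) (Fin.le_last (1 : Fin 3)) 0 0 =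
      Q.hEdge (i := ⦋2⦌) (Fin.le_last (1 : Fin 3)) 0 0) : P = Q := by
  refine hA.grid_ext ?_ ?_ ?_
  · rintro ⟨a, b, c⟩
    obtain rfl : b = 0 := Subsingleton.elim (α := Fin 1) _ _
    obtain rfl : c = 0 := Subsingleton.elim (α := Fin 1) _ _
    obtain rfl | rfl | rfl : a = (0 : Fin 3) ∨ a = (1 : Fin 3) ∨ a = (2 : Fin 3) := by
      revert a; decide
    · exact tHor_src h
    · exact tHor_tgt h
    · exact tHor_tgt h'
  · intro a a' h'' b c
    obtain rfl : b = 0 := Subsingleton.elim (α := Fin 1) _ _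
    obtain rfl : c = 0 := Subsingleton.elim (α := Fin 1) _ _
    obtain ⟨rfl, rfl⟩ | ⟨rfl, rfl⟩ | ⟨rfl, rfl⟩ : (a = (0 : Fin 3) ∧ a' = (1 : Fin 3)) ∨
        (a = (1 : Fin 3) ∧ a' = (2 : Fin 3)) ∨ (a = (0 : Fin 3) ∧ a' = (2 : Fin 3)) := by
      revert a a'; decide
    · exact h
    · exact h'
    -- The long edge is parallel to the path of the two short ones, so gauntness makes its image
    -- their composite.
    · have key : ∀ P : DoubleFunctor (X ⦋2⦌ ⦋0⦌ ⦋0⦌) (Hsim A),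
          P.hEdge (i := ⦋2⦌) h''.le 0 0 = (Hsim A).tHor ((Hsim A).hcomp
            (P.hor (hle (i := ⦋2⦌) (Fin.zero_le (1 : Fin 3)) 0 0))
            (P.hor (hle (i := ⦋2⦌) (Fin.le_last (1 : Fin 3)) 0 0))) := fun P =>
        congrArg (Hsim A).tHor ((hA.hor_eq P _ _).trans (P.hor_comp _ _))
      rw [key, key]
      exact tHor_hcomp h h'
  · intro a a' h b b' h' c
    exact absurd (Subsingleton.elim (α := Fin 1) b b') h'.ne

/-- The objects and horizontal edges are the corners and sides of this one square, while the
vertical edges are covered by gauntness. -/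
theorem ext_quad (hA : IsGaunt A) {P Q : DoubleFunctor (X ⦋1⦌ ⦋1⦌ ⦋0⦌) (Hsim A)}
    (h : P.quad (i := ⦋1⦌) (j := ⦋1⦌) (Fin.zero_le (1 : Fin 2)) (Fin.zero_le (1 : Fin 2)) 0 =
      Q.quad (i := ⦋1⦌) (j := ⦋1⦌) (Fin.zero_le (1 : Fin 2)) (Fin.zero_le (1 : Fin 2)) 0) :
    P = Q := by
  refine hA.grid_ext ?_ ?_ ?_
  · rintro ⟨a, b, c⟩
    obtain rfl : c = 0 := Subsingleton.elim (α := Fin 1) _ _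
    obtain rfl | rfl : a = (0 : Fin 2) ∨ a = (1 : Fin 2) := by
      revert a; decide
    all_goals
      obtain rfl | rfl : b = (0 : Fin 2) ∨ b = (1 : Fin 2) := by
        revert b; decide
    · exact congrArg (fun S => S.a) h
    · exact congrArg (fun S => S.c) h
    · exact congrArg (fun S => S.b) h
    · exact congrArg (fun S => S.d) h
  · intro a a' h' b c
    obtain rfl : c = 0 := Subsingleton.elim (α := Fin 1) _ _
    obtain ⟨rfl, rfl⟩ : a = (0 : Fin 2) ∧ a' = (1 : Fin 2) := by
      revert a a'; decide
    obtain rfl | rfl : b = (0 : Fin 2) ∨ b = (1 : Fin 2) := by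
      revert b; decide
    · exact congrArg TotalSq.top h
    · exact congrArg TotalSq.bot h
  · intro a a' h₁ b b' h₂ c
    obtain rfl : c = 0 := Subsingleton.elim (α := Fin 1) _ _
    obtain ⟨rfl, rfl⟩ : a = (0 : Fin 2) ∧ a' = (1 : Fin 2) := by
      revert a a'; decide
    obtain ⟨rfl, rfl⟩ : b = (0 : Fin 2) ∧ b' = (1 : Fin 2) := by
      revert b b'; decide
    exact h

/-- Double functors from `𝕏_{0,j,0}` to a gaunt 2-category are constant. -/
theorem ext_vertical (hA : IsGaunt A) {P Q : DoubleFunctor (X ⦋0⦌ j ⦋0⦌) (Hsim A)}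
    (h : P.obj (0, 0, 0) = Q.obj (0, 0, 0)) : P = Q := by
  have key : ∀ (P : DoubleFunctor (X ⦋0⦌ j ⦋0⦌) (Hsim A)) (a : Fin 1) (b : Fin (j.len + 1))
      (c : Fin 1), P.obj ((a, b, c) : Grid ⦋0⦌ j ⦋0⦌) = P.obj (0, 0, 0) := by
    intro P a b c
    obtain rfl : a = 0 := Subsingleton.elim _ _
    obtain rfl : c = 0 := Subsingleton.elim _ _
    exact (hA.tVer_path P (vle (i := ⦋0⦌) (k := ⦋0⦌) 0 (Fin.zero_le b) 0)).1.symm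
  refine hA.grid_ext ?_ ?_ ?_
  · rintro ⟨a, b, c⟩
    rw [key, key Q, h]
  · intro a a' h
    exact absurd (Subsingleton.elim (α := Fin 1) a a') h.ne
  · intro a a' h
    exact absurd (Subsingleton.elim (α := Fin 1) a a') h.ne

end IsGaunt

/-! ### Maps of nerves are determined by standard simplices -/

namespace SimplexCategory

variable {i : SimplexCategory}

/-- The edge of a simplex between two vertices. -/
def edgeMap {a a' : Fin (i.len + 1)} (h : a ≤ a') : ⦋1⦌ ⟶ i := mkOfLe (n := i.len) a a' h

/-- The triangle in a simplex with given vertices. -/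
def triangleMap {a a' a'' : Fin (i.len + 1)} (h : a ≤ a') (h' : a' ≤ a'') : ⦋2⦌ ⟶ i :=
  mkOfLeComp (n := i.len) a a' a'' h h'

end SimplexCategory

open SimplexCategory

/-- A natural map between the sets of simplices of the nerves of two 2-categories. -/
structure NerveHom (A B : Type u) [Bicategory.{w, v} A] [Strict A] [Bicategory.{w, v} B]
    [Strict B] where
  app : ∀ {i j k : SimplexCategory}, DoubleFunctor (X i j k) (Hsim A) →
    DoubleFunctor (X i j k) (Hsim B)
  nat : ∀ {i j k i' j' k' : SimplexCategory} (α : i ⟶ i') (β : j ⟶ j') (γ : k ⟶ k')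
    (G : DoubleFunctor (X i' j' k') (Hsim A)),
    app ((Xmap α β γ).comp G) = (Xmap α β γ).comp (app G)

namespace DoubleFunctor

variable {D : Type u} [Bicategory.{w, v} D] [Strict D] {T : Type} {h v : T → T → Prop}
  (P : DoubleFunctor (free T h v) (Hsim D))

/-- If 2-morphisms name images of adjacent squares, their composite names the image of the pasted
square. With `tGlob_hcomp` and `tGlob_id_eq`, this translates pastings in a grid into expressions in
`D`. -/
theorem tGlob_vcomp {x y x' y' x'' y'' : T} {f : RelPath h x y} {p : RelPath v x x'}
    {q : RelPath v y y'} (g : RelPath h x' y') {p' : RelPath v x' x''} {q' : RelPath v y' y''}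
    {k : RelPath h x'' y''} {a b : D} {s t r : a ⟶ b} {η : s ⟶ t} {θ : t ⟶ r}
    (hη : tGlob η = P.square f p q g) (hθ : tGlob θ = P.square g p' q' k) :
    tGlob (η ≫ θ) = P.square f (p.comp p') (q.comp q') k :=
  (sqVcomp_glob η θ).symm.trans ((DoubleCat.tSq_vcomp hη hθ).trans (square_vcomp g).symm)

theorem tGlob_hcomp {x y z x' y' z' : T} {f : RelPath h x y} {f' : RelPath h y z}
    {p : RelPath v x x'} (q : RelPath v y y') {s : RelPath v z z'} {g : RelPath h x' y'}
    {g' : RelPath h y' z'} {a b c : D} {k l : a ⟶ b} {k' l' : b ⟶ c} {η : k ⟶ l} {θ : k' ⟶ l'}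
    (hη : tGlob η = P.square f p q g) (hθ : tGlob θ = P.square f' q s g') :
    tGlob (k ◁ θ ≫ η ▷ l') = P.square (f.comp f') p s (g.comp g') :=
  (sqHcomp_glob η θ).symm.trans ((DoubleCat.tSq_hcomp hη hθ).trans (square_hcomp q).symm)

theorem tGlob_id_eq {x y : T} (f : RelPath h x y) {a b : D} {s : a ⟶ b}
    (hs : (Hsim D).tHor s = (Hsim D).tHor (P.hor f)) :
    tGlob (𝟙 s) = P.square f .nil .nil f :=
  (tGlob_id s).trans ((DoubleCat.tSq_vid hs).trans (square_vid f).symm)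

end DoubleFunctor

namespace NerveHom

open DoubleFunctor

variable {A B : Type u} [Bicategory.{w, v} A] [Strict A] [Bicategory.{w, v} B] [Strict B]
  (Φ : NerveHom A B) {i j k : SimplexCategory} (G : DoubleFunctor (X i j k) (Hsim A))

/-- The action on objects of a map of nerves. -/
def obj (x : A) : B := (Φ.app (nervePt x)).objD (0, 0, 0)

/-- Restriction to a vertex yields the standard point, and `Φ` commutes with restriction. -/
theorem obj_app (hA : IsGaunt A) (x : Grid i j k) :
    (Φ.app G).objD (X := X i j k) x = Φ.obj (G.objD (X := X i j k) x) := by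
  have e : (Xmap (const ⦋0⦌ i x.1) (const ⦋0⦌ j x.2.1) (const ⦋0⦌ k x.2.2)).comp G =
      nervePt (G.objD (X := X i j k) x) := hA.ext_vertical rfl
  have := Φ.nat (const ⦋0⦌ i x.1) (const ⦋0⦌ j x.2.1) (const ⦋0⦌ k x.2.2) G
  rw [e] at this
  exact (congrArg (fun P => P.objD (0, 0, 0)) this).symm

/-- Restricted to this edge, `G` is the standard simplex of `f` by gauntness of `A`, and naturality
carries this over to `Φ.app G`. The lemmas on squares and triangles below work in the same way. -/
theorem hEdge_app (hA : IsGaunt A) {a a' : Fin (i.len + 1)} (h : a ≤ a') (b : Fin (j.len + 1))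
    (c : Fin (k.len + 1)) {x y : A} {f : x ⟶ y} (hf : (Hsim A).tHor f = G.hEdge h b c) :
    (Φ.app G).hEdge h b c =
      (Φ.app (nerveEdge f)).hEdge (i := ⦋1⦌) (Fin.zero_le (1 : Fin 2)) 0 0 := by
  have e : (Xmap (edgeMap h) (const ⦋0⦌ j b) (const ⦋0⦌ k c)).comp G = nerveEdge f :=
    hA.ext_edge ((hEdge_Xmap _ _ _ _ _ _ _).trans hf.symm)
  rw [← e, Φ.nat, hEdge_Xmap]
  rfl

theorem quad_app (hA : IsGaunt A) {a a' : Fin (i.len + 1)} (h : a ≤ a') {b b' : Fin (j.len + 1)}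
    (h' : b ≤ b') (c : Fin (k.len + 1)) {x y : A} {f g : x ⟶ y} {η : f ⟶ g}
    (hη : tGlob η = G.quad h h' c) : (Φ.app G).quad h h' c = (Φ.app (nerveQuad η)).quad
      (i := ⦋1⦌) (j := ⦋1⦌) (Fin.zero_le (1 : Fin 2)) (Fin.zero_le (1 : Fin 2)) 0 := by
  have e : (Xmap (edgeMap h) (edgeMap h') (const ⦋0⦌ k c)).comp G = nerveQuad η :=
    hA.ext_quad ((quad_Xmap _ _ _ _ _ _ _).trans hη.symm)
  rw [← e, Φ.nat, quad_Xmap]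
  rfl

theorem tri_app (hA : IsGaunt A) {a a' a'' : Fin (i.len + 1)} (h : a ≤ a') (h' : a' ≤ a'')
    (b : Fin (j.len + 1)) (c : Fin (k.len + 1)) {x y z : A} {f : x ⟶ y} {g : y ⟶ z}
    (hf : (Hsim A).tHor f = G.hEdge h b c) (hg : (Hsim A).tHor g = G.hEdge h' b c) :
    (Φ.app G).tri h h' b c = (Φ.app (nerveTriangle f g)).tri (i := ⦋2⦌)
        (Fin.zero_le (1 : Fin 3)) (Fin.le_last (1 : Fin 3)) 0 0 ∧
      (Φ.app G).triInv h h' b c = (Φ.app (nerveTriangle f g)).triInv (i := ⦋2⦌)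
        (Fin.zero_le (1 : Fin 3)) (Fin.le_last (1 : Fin 3)) 0 0 := by
  have e : (Xmap (triangleMap h h') (const ⦋0⦌ j b) (const ⦋0⦌ k c)).comp G =
      nerveTriangle f g :=
    hA.ext_triangle ((hEdge_Xmap _ _ _ _ _ _ _).trans hf.symm)
      ((hEdge_Xmap _ _ _ _ _ _ _).trans hg.symm)
  rw [← e, Φ.nat, tri_Xmap, triInv_Xmap]
  exact ⟨rfl, rfl⟩

/-- The image of a simplex restricted to the edge in direction `j` at a vertex is constant. -/
theorem vertical_app (hA : IsGaunt A) (a : Fin (i.len + 1)) (c : Fin (k.len + 1))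
    {j' : SimplexCategory} (β : j' ⟶ j) :
    (Xmap (const ⦋0⦌ i a) β (const ⦋0⦌ k c)).comp (Φ.app G) =
      (Xmap (𝟙 ⦋0⦌) (const j' ⦋0⦌ 0) (𝟙 ⦋0⦌)).comp
        (Φ.app (nervePt (G.objD (X := X i j k) (a, β.toOrderHom 0, c)))) := by
  rw [← Φ.nat, ← Φ.nat]
  exact congrArg Φ.app (hA.ext_vertical rfl)

/-- Vertical edges in `B` are arbitrary adjoint equivalences, but this one comes from a degenerate
simplex of `A`. Naturality along `[1] → [0]` makes it degenerate, hence an identity. -/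
theorem vEdge_app (hA : IsGaunt A) (a : Fin (i.len + 1)) {b b' : Fin (j.len + 1)} (h : b ≤ b')
    (c : Fin (k.len + 1)) : (Φ.app G).vEdge a h c =
      (Hsim B).tVer ((Hsim B).vid (Φ.obj (G.objD (X := X i j k) (a, b, c)))) := by
  have := congrArg (fun P => P.vEdge (i := ⦋0⦌) (j := ⦋1⦌) (k := ⦋0⦌) 0
    (Fin.zero_le (1 : Fin 2)) 0) (Φ.vertical_app G hA a c (edgeMap h))
  simp only [vEdge_Xmap] at this
  refine Eq.trans this ?_
  unfold vEdge
  erw [vle_self]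
  exact congrArg (Hsim B).tVer (ver_id _ _)

/-- The restriction to a vertical triangle is pulled back along `[2] → [0]`, which turns all its
edges into empty paths. -/
theorem vTri_app (hA : IsGaunt A) (a : Fin (i.len + 1)) {b b' b'' : Fin (j.len + 1)} (h : b ≤ b')
    (h' : b' ≤ b'') (c : Fin (k.len + 1)) : (Φ.app G).vTri a h h' c =
      (Hsim B).tSq ((Hsim B).sqHid ((Hsim B).vid (Φ.obj (G.objD (X := X i j k) (a, b, c))))) ∧
      (Φ.app G).vTriInv a h h' c =
      (Hsim B).tSq ((Hsim B).sqHid ((Hsim B).vid (Φ.obj (G.objD (X := X i j k) (a, b, c))))) := by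
  have e := Φ.vertical_app G hA a c (triangleMap h h')
  constructor
  · have := congrArg (fun P => P.vTri (i := ⦋0⦌) (j := ⦋2⦌) (k := ⦋0⦌) 0
      (Fin.zero_le (1 : Fin 3)) (Fin.le_last (1 : Fin 3)) 0) e
    simp only [vTri_Xmap] at this
    refine Eq.trans this ?_
    unfold vTri
    erw [vle_self]
    refine (square_hid _).trans (tSq_hid ?_)
    exact congrArg (Hsim B).tVer (ver_id _ _)
  · have := congrArg (fun P => P.vTriInv (i := ⦋0⦌) (j := ⦋2⦌) (k := ⦋0⦌) 0
      (Fin.zero_le (1 : Fin 3)) (Fin.le_last (1 : Fin 3)) 0) e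
    simp only [vTriInv_Xmap] at this
    refine Eq.trans this ?_
    unfold vTriInv
    erw [vle_self]
    refine (square_hid _).trans (tSq_hid ?_)
    exact congrArg (Hsim B).tVer (ver_id _ _)

/-- In direction `k`, all simplices of the nerve of a gaunt 2-category are degenerate. -/
theorem _root_.IsGaunt.degenerate (hA : IsGaunt A) :
    (Xmap (𝟙 i) (𝟙 j) (const k ⦋0⦌ 0)).comp
      ((Xmap (𝟙 i) (𝟙 j) (const ⦋0⦌ k 0)).comp G) = G := by
  have e : ∀ (a : Fin (i.len + 1)) (b : Fin (j.len + 1)) (c c' : Fin (k.len + 1)),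
      ((a, b, c) : Grid i j k) = (a, b, c') ∨ gridHor i j k (a, b, c) (a, b, c') := by
    intro a b c c'
    by_cases h : c = c'
    · exact Or.inl (by rw [h])
    · exact Or.inr (Or.inr ⟨rfl, rfl, h⟩)
  -- The retraction sends every third coordinate to `0`. Each vertex is joined to its retract by
  -- edges in direction `k` both ways, so `freeMap_comp` applies.
  refine Eq.trans ?_ (hA.freeMap_comp G (gridMap (𝟙 i) (𝟙 j) (const k k 0))
    (gridMap_hor _ _ _) (gridMap_ver _ _ _) (fun x => .ofLe (e _ _ _ _))
    (fun x => .ofLe (e _ _ _ _)))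
  exact congrArg (fun F => DoubleFunctor.comp F G)
    (Xmap_comp (𝟙 i) (𝟙 j) (const k ⦋0⦌ 0) (𝟙 i) (𝟙 j) (const ⦋0⦌ k 0)).symm

/-- The vertical sides are identities by gauntness, so the square is the image of a 2-morphism
between morphisms with common endpoints. -/
theorem _root_.IsGaunt.exists_quad_eq (hA : IsGaunt A) {a a' : Fin (i.len + 1)} (h : a ≤ a')
    {b b' : Fin (j.len + 1)} (h' : b ≤ b') (c : Fin (k.len + 1)) :
    ∃ (x y : A) (f g : x ⟶ y) (η : f ⟶ g), tGlob η = G.quad h h' c := by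
  have e := hA.tVer_path G (vle a h' c)
  have e' := hA.tVer_path G (vle a' h' c)
  obtain ⟨g, hg⟩ := exists_tHor_eq (S := G.hEdge h b' c) e.1.symm e'.1.symm
  obtain ⟨η, hη⟩ := exists_tGlob_eq (D := A) (f := G.horD (X := X i j k) (hle h b c)) (g := g)
    (S := G.quad h h' c) rfl hg.symm e.2 e'.2
  exact ⟨_, _, _, _, η, hη⟩

/-- A map from the nerve of a gaunt 2-category is determined by its action on objects, morphisms,
2-morphisms and composable pairs. -/
theorem ext_of_gaunt (hA : IsGaunt A) {Φ Ψ : NerveHom A B} (ho : ∀ x, Φ.obj x = Ψ.obj x)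
    (hh : ∀ {x y : A} (f : x ⟶ y),
      (Φ.app (nerveEdge f)).hEdge (i := ⦋1⦌) (Fin.zero_le (1 : Fin 2)) 0 0 =
        (Ψ.app (nerveEdge f)).hEdge (i := ⦋1⦌) (Fin.zero_le (1 : Fin 2)) 0 0)
    (hs : ∀ {x y : A} {f g : x ⟶ y} (η : f ⟶ g), (Φ.app (nerveQuad η)).quad
      (i := ⦋1⦌) (j := ⦋1⦌) (Fin.zero_le (1 : Fin 2)) (Fin.zero_le (1 : Fin 2)) 0 =
        (Ψ.app (nerveQuad η)).quad (i := ⦋1⦌) (j := ⦋1⦌) (Fin.zero_le (1 : Fin 2))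
          (Fin.zero_le (1 : Fin 2)) 0)
    (ht : ∀ {x y z : A} (f : x ⟶ y) (g : y ⟶ z), (Φ.app (nerveTriangle f g)).tri (i := ⦋2⦌)
        (Fin.zero_le (1 : Fin 3)) (Fin.le_last (1 : Fin 3)) 0 0 =
      (Ψ.app (nerveTriangle f g)).tri (i := ⦋2⦌)
        (Fin.zero_le (1 : Fin 3)) (Fin.le_last (1 : Fin 3)) 0 0)
    (ht' : ∀ {x y z : A} (f : x ⟶ y) (g : y ⟶ z), (Φ.app (nerveTriangle f g)).triInv (i := ⦋2⦌)
        (Fin.zero_le (1 : Fin 3)) (Fin.le_last (1 : Fin 3)) 0 0 =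
      (Ψ.app (nerveTriangle f g)).triInv (i := ⦋2⦌)
        (Fin.zero_le (1 : Fin 3)) (Fin.le_last (1 : Fin 3)) 0 0) : Φ.app G = Ψ.app G := by
  -- For `k = 0` the values on generators suffice, and each of them is computed on a standard
  -- simplex.
  have key : ∀ G : DoubleFunctor (X i j ⦋0⦌) (Hsim A), Φ.app G = Ψ.app G := by
    intro G
    refine DoubleFunctor.grid_ext ?_ ?_ ?_ ?_ ?_ ?_ ?_ ?_
    · intro x
      exact (Φ.obj_app G hA x).trans ((ho _).trans (Ψ.obj_app G hA x).symm)
    · intro a a' h b c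
      rw [Φ.hEdge_app G hA h.le b c (f := G.horD (X := X i j ⦋0⦌) (hle h.le b c)) rfl, hh,
        ← Ψ.hEdge_app G hA h.le b c (f := G.horD (X := X i j ⦋0⦌) (hle h.le b c)) rfl]
    · intro a b b' h c
      rw [Φ.vEdge_app G hA, Ψ.vEdge_app G hA, ho]
    · intro a a' h b b' h' c
      obtain ⟨x, y, f, g, η, hη⟩ := hA.exists_quad_eq G h.le h'.le c
      rw [Φ.quad_app G hA h.le h'.le c hη, hs, ← Ψ.quad_app G hA h.le h'.le c hη]
    · intro a a' a'' h h' b c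
      rw [(Φ.tri_app G hA h.le h'.le b c (f := G.horD (X := X i j ⦋0⦌) (hle h.le b c))
          (g := G.horD (X := X i j ⦋0⦌) (hle h'.le b c)) rfl rfl).1, ht,
        (Ψ.tri_app G hA h.le h'.le b c (f := G.horD (X := X i j ⦋0⦌) (hle h.le b c))
          (g := G.horD (X := X i j ⦋0⦌) (hle h'.le b c)) rfl rfl).1]
    · intro a a' a'' h h' b c
      rw [(Φ.tri_app G hA h.le h'.le b c (f := G.horD (X := X i j ⦋0⦌) (hle h.le b c))
          (g := G.horD (X := X i j ⦋0⦌) (hle h'.le b c)) rfl rfl).2, ht',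
        (Ψ.tri_app G hA h.le h'.le b c (f := G.horD (X := X i j ⦋0⦌) (hle h.le b c))
          (g := G.horD (X := X i j ⦋0⦌) (hle h'.le b c)) rfl rfl).2]
    · intro a b b' b'' h h' c
      rw [(Φ.vTri_app G hA a h.le h'.le c).1, (Ψ.vTri_app G hA a h.le h'.le c).1, ho]
    · intro a b b' b'' h h' c
      rw [(Φ.vTri_app G hA a h.le h'.le c).2, (Ψ.vTri_app G hA a h.le h'.le c).2, ho]
  -- A general simplex is degenerate in direction `k`, so its image is pulled back from the case `k
  -- = 0`.
  rw [← hA.degenerate G, Φ.nat, Ψ.nat, key]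

end NerveHom

/-! ### Reading off a normal pseudofunctor from a map of nerves -/

namespace DoubleFunctor

variable {D : Type u} [Bicategory.{w, v} D] [Strict D] {T : Type} {h v : T → T → Prop}
  (P : DoubleFunctor (free T h v) (Hsim D))

/-- A variant of `square_globular` with prescribed representatives `s`, `t` of the two images. It is
needed because the chosen morphisms of the pseudofunctor equal the images of edges only as total
morphisms. -/
theorem exists_iso_globular {x y : T} (p q : RelPath h x y) {a b : D} {s t : a ⟶ b}
    (hs : (Hsim D).tHor s = (Hsim D).tHor (P.hor p))
    (ht : (Hsim D).tHor t = (Hsim D).tHor (P.hor q)) :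
    ∃ η : s ≅ t, tGlob η.hom = P.square p .nil .nil q ∧ tGlob η.inv = P.square q .nil .nil p := by
  have hx : P.obj x = a := (tHor_src hs).symm
  have hy : P.obj y = b := (tHor_tgt hs).symm
  have hl : (Hsim D).tVer (P.ver (.nil : RelPath v x x)) = (Hsim D).tVer (Equivalence.id a) :=
    (congrArg (Hsim D).tVer (P.ver_id x)).trans (tVer_id hx)
  have hr : (Hsim D).tVer (P.ver (.nil : RelPath v y y)) = (Hsim D).tVer (Equivalence.id b) :=
    (congrArg (Hsim D).tVer (P.ver_id y)).trans (tVer_id hy)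
  obtain ⟨η, hη⟩ := exists_tGlob_eq (S := P.square p .nil .nil q) hs.symm ht.symm hl hr
  obtain ⟨θ, hθ⟩ := exists_tGlob_eq (S := P.square q .nil .nil p) ht.symm hs.symm hl hr
  exact ⟨⟨η, θ, tGlob_injective ((P.tGlob_vcomp (p := .nil) (q := .nil) (p' := .nil)
    (q' := .nil) q hη hθ).trans (P.tGlob_id_eq p hs).symm), tGlob_injective ((P.tGlob_vcomp
    (p := .nil) (q := .nil) (p' := .nil) (q' := .nil) p hθ hη).trans
      (P.tGlob_id_eq q ht).symm)⟩, hη, hθ⟩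

end DoubleFunctor

namespace NerveHom

open DoubleFunctor

variable {A B : Type u} [Bicategory.{w, v} A] [Strict A] [Bicategory.{w, v} B] [Strict B]
  (Φ : NerveHom A B)

theorem exists_map (hA : IsGaunt A) {x y : A} (f : x ⟶ y) :
    ∃ g : Φ.obj x ⟶ Φ.obj y, (Hsim B).tHor g =
    (Φ.app (nerveEdge f)).hEdge (i := ⦋1⦌) (Fin.zero_le (1 : Fin 2)) 0 0 :=
  exists_tHor_eq (Z := Hsim B) (Φ.obj_app (nerveEdge f) hA ((0 : Fin 2), 0, 0))
    (Φ.obj_app (nerveEdge f) hA ((1 : Fin 2), 0, 0))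

/-- The action on morphisms of a map of nerves. -/
noncomputable def map (hA : IsGaunt A) {x y : A} (f : x ⟶ y) : Φ.obj x ⟶ Φ.obj y :=
  (Φ.exists_map hA f).choose

/-- The value chosen on a standard simplex may be read off in any simplex that contains `f` as an
edge. With the analogues for 2-morphisms and compositors, a pseudofunctor axiom is checked in a
single simplex that displays all its terms. -/
theorem tHor_map (hA : IsGaunt A) {i j k : SimplexCategory}
    (G : DoubleFunctor (X i j k) (Hsim A))
    {a a' : Fin (i.len + 1)} (h : a ≤ a') (b : Fin (j.len + 1)) (c : Fin (k.len + 1))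
    {x y : A} {f : x ⟶ y} (hf : (Hsim A).tHor f = G.hEdge h b c) :
    (Hsim B).tHor (Φ.map hA f) = (Φ.app G).hEdge h b c :=
  (Φ.exists_map hA f).choose_spec.trans (Φ.hEdge_app G hA h b c hf).symm

theorem exists_map₂ (hA : IsGaunt A) {x y : A} {f g : x ⟶ y} (η : f ⟶ g) :
    ∃ θ : Φ.map hA f ⟶ Φ.map hA g, tGlob θ = (Φ.app (nerveQuad η)).quad (i := ⦋1⦌) (j := ⦋1⦌)
      (Fin.zero_le (1 : Fin 2))
      (Fin.zero_le (1 : Fin 2)) 0 :=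
  exists_tGlob_eq (D := B)
    (Φ.tHor_map hA (nerveQuad η) (Fin.zero_le (1 : Fin 2)) (0 : Fin 2) 0 rfl).symm
    (Φ.tHor_map hA (nerveQuad η) (Fin.zero_le (1 : Fin 2)) (1 : Fin 2) 0 rfl).symm
    (Φ.vEdge_app (nerveQuad η) hA (0 : Fin 2) (Fin.zero_le (1 : Fin 2)) 0)
    (Φ.vEdge_app (nerveQuad η) hA (1 : Fin 2) (Fin.zero_le (1 : Fin 2)) 0)

/-- The action on 2-morphisms of a map of nerves. -/
noncomputable def map₂ (hA : IsGaunt A) {x y : A} {f g : x ⟶ y} (η : f ⟶ g) :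
    Φ.map hA f ⟶ Φ.map hA g :=
  (Φ.exists_map₂ hA η).choose

theorem tGlob_map₂ (hA : IsGaunt A) {i j k : SimplexCategory}
    (G : DoubleFunctor (X i j k) (Hsim A))
    {a a' : Fin (i.len + 1)} (h : a ≤ a') {b b' : Fin (j.len + 1)} (h' : b ≤ b')
    (c : Fin (k.len + 1)) {x y : A} {f g : x ⟶ y} {η : f ⟶ g} (hη : tGlob η = G.quad h h' c) :
    tGlob (Φ.map₂ hA η) = (Φ.app G).quad h h' c :=
  (Φ.exists_map₂ hA η).choose_spec.trans (Φ.quad_app G hA h h' c hη).symm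

theorem tHor_map_comp (hA : IsGaunt A) {i j k : SimplexCategory}
    (G : DoubleFunctor (X i j k) (Hsim A))
    {a a' a'' : Fin (i.len + 1)} (h : a ≤ a') (h' : a' ≤ a'') (b : Fin (j.len + 1))
    (c : Fin (k.len + 1)) {x y z : A} {f : x ⟶ y} {g : y ⟶ z}
    (hf : (Hsim A).tHor f = G.hEdge h b c) (hg : (Hsim A).tHor g = G.hEdge h' b c) :
    (Hsim B).tHor (Φ.map hA f ≫ Φ.map hA g) =
      (Hsim B).tHor ((Φ.app G).hor ((hle h b c).comp (hle h' b c))) :=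
  (tHor_hcomp (Z := Hsim B) (Φ.tHor_map hA G h b c hf) (Φ.tHor_map hA G h' b c hg)).trans
    (congrArg (Hsim B).tHor ((Φ.app G).hor_comp (hle h b c) (hle h' b c)).symm)

theorem exists_mapComp (hA : IsGaunt A) {x y z : A} (f : x ⟶ y) (g : y ⟶ z) :
    ∃ θ : Φ.map hA (f ≫ g) ≅ Φ.map hA f ≫ Φ.map hA g,
      tGlob θ.hom = (Φ.app (nerveTriangle f g)).triInv (i := ⦋2⦌)
        (Fin.zero_le (1 : Fin 3)) (Fin.le_last (1 : Fin 3)) 0 0 ∧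
      tGlob θ.inv = (Φ.app (nerveTriangle f g)).tri (i := ⦋2⦌)
        (Fin.zero_le (1 : Fin 3)) (Fin.le_last (1 : Fin 3)) 0 0 :=
  exists_iso_globular _ _ _ (Φ.tHor_map hA (nerveTriangle f g) (Fin.zero_le (2 : Fin 3)) 0 0 rfl)
    (Φ.tHor_map_comp hA (nerveTriangle f g) (Fin.zero_le (1 : Fin 3)) (Fin.le_last (1 : Fin 3))
      0 0 rfl rfl)

/-- The compositors of a map of nerves. -/
noncomputable def mapComp (hA : IsGaunt A) {x y z : A} (f : x ⟶ y) (g : y ⟶ z) :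
    Φ.map hA (f ≫ g) ≅ Φ.map hA f ≫ Φ.map hA g := (Φ.exists_mapComp hA f g).choose

theorem tGlob_mapComp_hom (hA : IsGaunt A) {i j k : SimplexCategory}
    (G : DoubleFunctor (X i j k) (Hsim A))
    {a a' a'' : Fin (i.len + 1)} (h : a ≤ a') (h' : a' ≤ a'') (b : Fin (j.len + 1))
    (c : Fin (k.len + 1)) {x y z : A} {f : x ⟶ y} {g : y ⟶ z}
    (hf : (Hsim A).tHor f = G.hEdge h b c) (hg : (Hsim A).tHor g = G.hEdge h' b c) :
    tGlob (Φ.mapComp hA f g).hom = (Φ.app G).triInv h h' b c :=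
  (Φ.exists_mapComp hA f g).choose_spec.1.trans (Φ.tri_app G hA h h' b c hf hg).2.symm

theorem tGlob_mapComp_inv (hA : IsGaunt A) {i j k : SimplexCategory}
    (G : DoubleFunctor (X i j k) (Hsim A))
    {a a' a'' : Fin (i.len + 1)} (h : a ≤ a') (h' : a' ≤ a'') (b : Fin (j.len + 1))
    (c : Fin (k.len + 1)) {x y z : A} {f : x ⟶ y} {g : y ⟶ z}
    (hf : (Hsim A).tHor f = G.hEdge h b c) (hg : (Hsim A).tHor g = G.hEdge h' b c) :
    tGlob (Φ.mapComp hA f g).inv = (Φ.app G).tri h h' b c :=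
  (Φ.exists_mapComp hA f g).choose_spec.2.trans (Φ.tri_app G hA h h' b c hf hg).1.symm

/-- The edge from `0` to `0` in the standard point is the empty path, and a double functor preserves
it strictly. This is where strict unitality comes from. -/
theorem map_id (hA : IsGaunt A) (x : A) : Φ.map hA (𝟙 x) = 𝟙 (Φ.obj x) := by
  refine eq_of_tHor (Z := Hsim B) ?_
  refine (Φ.tHor_map hA (nervePt x) (le_refl (0 : Fin 1)) 0 0 ?_).trans ?_
  · rfl
  · exact congrArg (Hsim B).tHor ((Φ.app (nervePt x)).hor_id _)

theorem map₂_id (hA : IsGaunt A) {x y : A} (f : x ⟶ y) : Φ.map₂ hA (𝟙 f) = 𝟙 (Φ.map hA f) := by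
  apply tGlob_injective
  have e := Φ.tHor_map hA (nerveEdge f) (Fin.zero_le (1 : Fin 2)) 0 0 rfl
  refine Eq.trans ?_ ((Φ.app (nerveEdge f)).tGlob_id_eq _ e).symm
  exact Φ.tGlob_map₂ hA (nerveEdge f) (Fin.zero_le (1 : Fin 2)) (le_refl (0 : Fin 1)) 0 rfl

/-- Two consecutive vertical edges and the long edge are different paths in the grid. The squares
comparing them are identities by `vTri_app`, so pasting them on both sides changes nothing. -/
theorem quad_vcomp_app (hA : IsGaunt A) {i j k : SimplexCategory}
    (G : DoubleFunctor (X i j k) (Hsim A))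
    {a a' : Fin (i.len + 1)} (h : a ≤ a') {b b' b'' : Fin (j.len + 1)} (h₁ : b ≤ b')
    (h₂ : b' ≤ b'') (c : Fin (k.len + 1)) :
    (Φ.app G).square (hle h b c) ((vle a h₁ c).comp (vle a h₂ c))
      ((vle a' h₁ c).comp (vle a' h₂ c)) (hle h b'' c) = (Φ.app G).quad h (h₁.trans h₂) c := by
  have e₁ : (Φ.app G).square .nil ((vle a h₁ c).comp (vle a h₂ c)) (vle a (h₁.trans h₂) c) .nil =
      (Hsim B).tSq ((Hsim B).sqHid ((Φ.app G).ver (vle a (h₁.trans h₂) c))) :=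
    (Φ.vTri_app G hA a h₁ h₂ c).1.trans (tSq_hid (Φ.vEdge_app G hA a (h₁.trans h₂) c).symm)
  have e₂ : (Φ.app G).square .nil (vle a' (h₁.trans h₂) c) ((vle a' h₁ c).comp (vle a' h₂ c))
      .nil = (Hsim B).tSq ((Hsim B).sqHid ((Φ.app G).ver (vle a' (h₁.trans h₂) c))) :=
    (Φ.vTri_app G hA a' h₁ h₂ c).2.trans (tSq_hid (Φ.vEdge_app G hA a' (h₁.trans h₂) c).symm)
  have e := square_hcomp (P := Φ.app G) (f := .nil) (g := .nil) (f' := (hle h b c).comp .nil)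
    (g' := (hle h b'' c).comp .nil) (p := (vle a h₁ c).comp (vle a h₂ c))
    (s := (vle a' h₁ c).comp (vle a' h₂ c)) (vle a (h₁.trans h₂) c)
  rw [RelPath.nil_comp, RelPath.nil_comp] at e
  refine e.trans ((tSq_hcomp_of_hid _ e₁).trans ?_)
  exact (square_hcomp (P := Φ.app G) (vle a' (h₁.trans h₂) c)).trans (tSq_hcomp_of_hid' _ e₂)

theorem map₂_comp (hA : IsGaunt A) {x y : A} {f g h : x ⟶ y} (η : f ⟶ g) (θ : g ⟶ h) :
    Φ.map₂ hA (η ≫ θ) = Φ.map₂ hA η ≫ Φ.map₂ hA θ := by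
  apply tGlob_injective
  have e₁ := Φ.tGlob_map₂ hA (nerveQuadV η θ) (η := η) (Fin.zero_le (1 : Fin 2))
    (Fin.zero_le (1 : Fin 3)) 0 rfl
  have e₂ := Φ.tGlob_map₂ hA (nerveQuadV η θ) (η := θ) (Fin.zero_le (1 : Fin 2))
    (Fin.le_last (1 : Fin 3)) 0 rfl
  have e₃ := Φ.tGlob_map₂ hA (nerveQuadV η θ) (η := η ≫ θ) (Fin.zero_le (1 : Fin 2))
    (Fin.zero_le (2 : Fin 3)) 0 rfl
  rw [e₃, DoubleFunctor.tGlob_vcomp _ _ e₁ e₂]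
  exact (Φ.quad_vcomp_app hA (nerveQuadV η θ) (Fin.zero_le (1 : Fin 2)) (Fin.zero_le (1 : Fin 3))
    (Fin.le_last (1 : Fin 3)) 0).symm

/-- In the simplex of shape (2,1,0), the square on the long edge is pasted from a triangle on top,
two adjacent squares and a triangle at the bottom. Both whiskering axioms are the cases where one of
the 2-morphisms is an identity. -/
theorem map₂_hcomp (hA : IsGaunt A) {x y z : A} {f g : x ⟶ y} {f' g' : y ⟶ z}
    (η : f ⟶ g) (θ : f' ⟶ g') :
    Φ.map₂ hA (f ◁ θ ≫ η ▷ g') = (Φ.mapComp hA f f').hom ≫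
      (Φ.map hA f ◁ Φ.map₂ hA θ ≫ Φ.map₂ hA η ▷ Φ.map hA g') ≫ (Φ.mapComp hA g g').inv := by
  apply tGlob_injective
  have e₁ := Φ.tGlob_map₂ hA (nerveQuadH η θ) (η := η) (Fin.zero_le (1 : Fin 3))
    (Fin.zero_le (1 : Fin 2)) 0 rfl
  have e₂ := Φ.tGlob_map₂ hA (nerveQuadH η θ) (η := θ) (Fin.le_last (1 : Fin 3))
    (Fin.zero_le (1 : Fin 2)) 0 rfl
  have e₃ := Φ.tGlob_map₂ hA (nerveQuadH η θ) (η := f ◁ θ ≫ η ▷ g') (Fin.zero_le (2 : Fin 3))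
    (Fin.zero_le (1 : Fin 2)) 0 rfl
  have e₄ := Φ.tGlob_mapComp_hom hA (nerveQuadH η θ) (f := f) (g := f') (Fin.zero_le (1 : Fin 3))
    (Fin.le_last (1 : Fin 3)) (0 : Fin 2) 0 rfl rfl
  have e₅ := Φ.tGlob_mapComp_inv hA (nerveQuadH η θ) (f := g) (g := g') (Fin.zero_le (1 : Fin 3))
    (Fin.le_last (1 : Fin 3)) (1 : Fin 2) 0 rfl rfl
  have e := DoubleFunctor.tGlob_vcomp _ _ e₄ (DoubleFunctor.tGlob_vcomp (p' := .nil) (q' := .nil)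
    _ _ (DoubleFunctor.tGlob_hcomp _ _ e₁ e₂) e₅)
  rw [RelPath.nil_comp, RelPath.nil_comp] at e
  exact e₃.trans e.symm

theorem map₂_whisker_left (hA : IsGaunt A) {x y z : A} (f : x ⟶ y) {g h : y ⟶ z} (η : g ⟶ h) :
    Φ.map₂ hA (f ◁ η) =
      (Φ.mapComp hA f g).hom ≫ Φ.map hA f ◁ Φ.map₂ hA η ≫ (Φ.mapComp hA f h).inv := by
  have := Φ.map₂_hcomp hA (𝟙 f) η
  simpa [map₂_id] using this

theorem map₂_whisker_right (hA : IsGaunt A) {x y z : A} {f g : x ⟶ y} (η : f ⟶ g) (h : y ⟶ z) :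
    Φ.map₂ hA (η ▷ h) =
      (Φ.mapComp hA f h).hom ≫ Φ.map₂ hA η ▷ Φ.map hA h ≫ (Φ.mapComp hA g h).inv := by
  have := Φ.map₂_hcomp hA η (𝟙 h)
  simpa [map₂_id] using this

theorem tGlob_map₂_eqToHom (hA : IsGaunt A) {x y : A} {f g : x ⟶ y} (h : f = g) :
    tGlob (Φ.map₂ hA (eqToHom h)) = tGlob (𝟙 (Φ.map hA f)) := by
  subst h
  rw [eqToHom_refl, map₂_id]

/-- The compositor of `𝟙 x` and `f` sits at the degenerate triangle `0 ≤ 0 ≤ 1` in the edge `f`,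
where it is an identity square. Since both unitors are identities up to boundary, nothing else is
left. -/
theorem map₂_left_unitor (hA : IsGaunt A) {x y : A} (f : x ⟶ y) : Φ.map₂ hA (λ_ f).hom =
    (Φ.mapComp hA (𝟙 x) f).hom ≫ eqToHom (by rw [Φ.map_id hA x]) ≫ (λ_ (Φ.map hA f)).hom := by
  apply tGlob_injective
  rw [Strict.leftUnitor_eqToIso, Strict.leftUnitor_eqToIso, eqToIso.hom, eqToIso.hom,
    tGlob_map₂_eqToHom, eqToHom_trans, tGlob_comp_eqToHom]
  have e := Φ.tHor_map hA (nerveEdge f) (f := 𝟙 x ≫ f) (Fin.zero_le (1 : Fin 2)) 0 0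
    (congrArg (Hsim A).tHor (Strict.id_comp f))
  refine ((Φ.app (nerveEdge f)).tGlob_id_eq _ e).trans ?_
  refine Eq.trans ?_ (Φ.tGlob_mapComp_hom hA (nerveEdge f) (le_refl (0 : Fin 2))
    (Fin.zero_le (1 : Fin 2)) 0 0 rfl rfl).symm
  unfold triInv
  rw [hle_self, RelPath.nil_comp]

theorem map₂_right_unitor (hA : IsGaunt A) {x y : A} (f : x ⟶ y) : Φ.map₂ hA (ρ_ f).hom =
    (Φ.mapComp hA f (𝟙 y)).hom ≫ eqToHom (by rw [Φ.map_id hA y]) ≫ (ρ_ (Φ.map hA f)).hom := by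
  apply tGlob_injective
  rw [Strict.rightUnitor_eqToIso, Strict.rightUnitor_eqToIso, eqToIso.hom, eqToIso.hom,
    tGlob_map₂_eqToHom, eqToHom_trans, tGlob_comp_eqToHom]
  have e := Φ.tHor_map hA (nerveEdge f) (f := f ≫ 𝟙 y) (Fin.zero_le (1 : Fin 2)) 0 0
    (congrArg (Hsim A).tHor (Strict.comp_id f))
  refine ((Φ.app (nerveEdge f)).tGlob_id_eq _ e).trans ?_
  refine Eq.trans ?_ (Φ.tGlob_mapComp_hom hA (nerveEdge f) (Fin.zero_le (1 : Fin 2))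
    (le_refl (1 : Fin 2)) 0 0 rfl rfl).symm
  unfold triInv
  rw [hle_self (1 : Fin 2)]
  rfl

/-- In the 3-simplex, the composite on the right runs from the edge 03 through 02·23, 01·12·23 and
01·13 back to 03. It is the only square from 03 to itself, hence an identity, as is the image of the
strict associator. -/
theorem map₂_associator (hA : IsGaunt A) {x y z t : A} (f : x ⟶ y) (g : y ⟶ z) (h : z ⟶ t) :
    Φ.map₂ hA (α_ f g h).hom = (Φ.mapComp hA (f ≫ g) h).hom ≫
      (Φ.mapComp hA f g).hom ▷ Φ.map hA h ≫ (α_ (Φ.map hA f) (Φ.map hA g) (Φ.map hA h)).hom ≫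
        Φ.map hA f ◁ (Φ.mapComp hA g h).inv ≫ (Φ.mapComp hA f (g ≫ h)).inv := by
  apply tGlob_injective
  let G := nerveTetra f g h
  let l₀₁ : (0 : Fin 4) ≤ 1 := by decide
  let l₁₂ : (1 : Fin 4) ≤ 2 := by decide
  let l₂₃ : (2 : Fin 4) ≤ 3 := by decide
  let l₀₂ : (0 : Fin 4) ≤ 2 := by decide
  let l₁₃ : (1 : Fin 4) ≤ 3 := by decide
  let l₀₃ : (0 : Fin 4) ≤ 3 := by decide
  have e₁ := Φ.tGlob_mapComp_hom hA G (f := f ≫ g) (g := h) l₀₂ l₂₃ 0 0 rfl rfl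
  have e₂ := Φ.tGlob_mapComp_hom hA G (f := f) (g := g) l₀₁ l₁₂ 0 0 rfl rfl
  have e₃ := Φ.tGlob_mapComp_inv hA G (f := g) (g := h) l₁₂ l₂₃ 0 0 rfl rfl
  have e₄ := Φ.tGlob_mapComp_inv hA G (f := f) (g := g ≫ h) l₀₁ l₁₃ 0 0 rfl rfl
  have i₁ := (Φ.app G).tGlob_id_eq _ (Φ.tHor_map hA G (f := h) l₂₃ 0 0 rfl)
  have i₂ := (Φ.app G).tGlob_id_eq _ (Φ.tHor_map hA G (f := f) l₀₁ 0 0 rfl)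
  have i₃ := (Φ.app G).tGlob_id_eq _ (Φ.tHor_map hA G (f := (f ≫ g) ≫ h) l₀₃ 0 0
    (congrArg (Hsim A).tHor (Strict.assoc f g h)))
  -- `k₁` expands 03 to 01·12·23 through 02, and `k₂` below contracts it again through 13.
  have k₁ := DoubleFunctor.tGlob_vcomp (p := .nil) (q := .nil) (p' := .nil) (q' := .nil) _ _ e₁
    (DoubleFunctor.tGlob_hcomp _ .nil e₂ i₁)
  have k₂ := DoubleFunctor.tGlob_vcomp (p := .nil) (q := .nil) (p' := .nil) (q' := .nil) _ _
    (DoubleFunctor.tGlob_hcomp _ .nil i₂ e₃) e₄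
  rw [Bicategory.whiskerLeft_id, Category.id_comp] at k₁
  rw [Bicategory.id_whiskerRight, Category.comp_id] at k₂
  -- The two bracketings are one path in the grid. On the side of `B` they are matched by an
  -- identity 2-morphism, which takes the place of the associator.
  have k₃ := DoubleFunctor.tGlob_vcomp (p := .nil) (q := .nil) (p' := .nil) (q' := .nil) _ _
    ((tGlob_comp_eqToHom _ (Strict.assoc _ _ _)).trans k₁) k₂
  rw [Strict.associator_eqToIso f g h, eqToIso.hom, tGlob_map₂_eqToHom, i₃,
    Strict.associator_eqToIso, eqToIso.hom]
  refine Eq.trans ?_ (k₃.symm.trans ?_)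
  · rfl
  · simp only [Category.assoc]

/-- The normal pseudofunctor given by a map from the nerve of a gaunt 2-category. -/
noncomputable def toPseudofunctor (hA : IsGaunt A) : StrictlyUnitaryPseudofunctor A B :=
  StrictlyUnitaryPseudofunctor.mk'
    { obj := Φ.obj
      map := Φ.map hA
      map_id := Φ.map_id hA
      map₂ := Φ.map₂ hA
      map₂_id := Φ.map₂_id hA
      map₂_comp := Φ.map₂_comp hA
      mapComp := Φ.mapComp hA
      map₂_whisker_left := Φ.map₂_whisker_left hA
      map₂_whisker_right := Φ.map₂_whisker_right hA
      map₂_left_unitor := Φ.map₂_left_unitor hA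
      map₂_right_unitor := Φ.map₂_right_unitor hA
      map₂_associator := Φ.map₂_associator hA }

end NerveHom

/-! ### The nerve of a pseudofunctor on standard simplices -/

theorem DoubleFunctor.tSq_congr {X : DoubleCat.{w₁, u₁, v₁, v₂}} {Z : DoubleCat.{w₂, u₂, v₃, v₄}}
    (P : DoubleFunctor X Z) {a b c d a' b' c' d' : X.Obj} {f : X.Hor a b} {u : X.Ver a c}
    {v : X.Ver b d} {g : X.Hor c d} {f' : X.Hor a' b'} {u' : X.Ver a' c'} {v' : X.Ver b' d'}
    {g' : X.Hor c' d'} {α : X.Sq f u v g} {β : X.Sq f' u' v' g'} (h : X.tSq α = X.tSq β) :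
    Z.tSq (P.sq α) = Z.tSq (P.sq β) := by
  cases h; rfl

namespace CategoryTheory.StrictlyUnitaryPseudofunctor

variable {A B : Type u} [Bicategory.{w, v} A] [Bicategory.{w, v} B]

/-- The unit constraints need no comparison: strict unitality fixes them as the isomorphisms coming
from `map_id`. -/
theorem ext_of_total [Strict B] {F F' : StrictlyUnitaryPseudofunctor A B}
    (ho : ∀ x, F.obj x = F'.obj x)
    (hh : ∀ {x y : A} (f : x ⟶ y), (Hsim B).tHor (F.map f) = (Hsim B).tHor (F'.map f))
    (hs : ∀ {x y : A} {f g : x ⟶ y} (η : f ⟶ g), tGlob (F.map₂ η) = tGlob (F'.map₂ η))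
    (hc : ∀ {x y z : A} (f : x ⟶ y) (g : y ⟶ z),
      tGlob (F.mapComp f g).hom = tGlob (F'.mapComp f g).hom) : F = F' := by
  obtain ⟨⟨⟨⟨⟨o, m⟩, s⟩, _, _⟩, mi, mc, _, _, _, _, _⟩, i, hi⟩ := F
  obtain ⟨⟨⟨⟨⟨o', m'⟩, s'⟩, _, _⟩, mi', mc', _, _, _, _, _⟩, i', hi'⟩ := F'
  obtain rfl : o = o' := funext ho
  obtain rfl : @m = @m' := by
    funext x y f
    exact eq_of_tHor (Z := Hsim B) (hh f)
  obtain rfl : @s = @s' := by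
    funext x y f g η
    exact tGlob_injective (hs η)
  obtain rfl : @mc = @mc' := by
    funext x y z f g
    exact Iso.ext (tGlob_injective (hc f g))
  obtain rfl : mi = mi' := by
    funext x
    exact (hi x).trans (hi' x).symm
  rfl

variable [Strict A] [Strict B] (F : StrictlyUnitaryPseudofunctor A B)

/-- A morphism together with its image as a replacement of its image. -/
def repHor {a b : A} (f : a ⟶ b) : F.RepHor a b := ⟨f, F.map f, Iso.refl _⟩

theorem tSq_rep_congr {a b c d a' b' c' d' : A} {f : F.RepHor a b} {u : F.RepVer a c}
    {v : F.RepVer b d} {g : F.RepHor c d} {f' : F.RepHor a' b'} {u' : F.RepVer a' c'}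
    {v' : F.RepVer b' d'} {g' : F.RepHor c' d'} {α : F.Rep.Sq f u v g} {β : F.Rep.Sq f' u' v' g'}
    (hf : F.Rep.tHor f = F.Rep.tHor f') (hu : F.Rep.tVer u = F.Rep.tVer u')
    (hv : F.Rep.tVer v = F.Rep.tVer v') (hg : F.Rep.tHor g = F.Rep.tHor g')
    (h : (Hsim A).tSq (f := f.base) (u := u.base) (v := v.base) (g := g.base) α =
      (Hsim A).tSq (f := f'.base) (u := u'.base) (v := v'.base) (g := g'.base) β) :
    F.Rep.tSq α = F.Rep.tSq β := by
  cases hf; cases hu; cases hv; cases hg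
  exact congrArg F.Rep.tSq (eq_of_tSq (Z := Hsim A) h)

theorem tVer_rep_id {a b c : A} {e : Bicategory.Equivalence b c}
    (h : (Hsim A).tVer (Equivalence.id a) = (Hsim A).tVer e) :
    F.Rep.tVer (⟨e, F.mapEquiv e, Iso.refl _⟩ : F.RepVer b c) = F.Rep.tVer (F.Rep.vid a) := by
  cases h
  exact congrArg F.Rep.tVer (F.repVer_id rfl).symm

/-- The unitors in a globular square are absorbed by the isomorphisms at its trivial sides, leaving
only the conjugate of the 2-morphism itself. -/
theorem tSq_repImage_glob {a b : A} {r r' : F.RepHor a b} (η : r.base ⟶ r'.base) :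
    (Hsim B).tSq (F.repImage.sq (f := r) (u := F.Rep.vid a) (v := F.Rep.vid b) (g := r')
      (glob η)) = tGlob (F.conj r.iso r'.iso η) := by
  refine congrArg (Hsim B).tSq ?_
  change F.conj (F.compIso r.iso (F.mapId b)) (F.compIso (F.mapId a) r'.iso)
    ((ρ_ r.base).hom ≫ η ≫ (λ_ r'.base).inv) =
      (ρ_ r.rep).hom ≫ F.conj r.iso r'.iso η ≫ (λ_ r'.rep).inv
  rw [F.conj_comp _ r.iso, F.conj_comp _ r'.iso, F.conj_rightUnitor, F.conj_leftUnitor_inv]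

section

variable {T : Type} {h v : T → T → Prop} (G : DoubleFunctor (free T h v) (Hsim A))

theorem liftHor_single {x y : T} (e : h x y) :
    F.liftHor G (.single e) = F.repHor (G.hor (RelPath.single e)) :=
  F.Rep.hid_hcomp _

theorem liftVer_single {x y : T} (e : v x y) : F.liftVer G (.single e) =
    ⟨G.ver (RelPath.single e), F.mapEquiv (G.ver (RelPath.single e)), Iso.refl _⟩ :=
  F.Rep.vid_vcomp _

theorem tHor_liftHor_single {x y : T} (e : h x y) {a b : A} {f : a ⟶ b}
    (hf : (Hsim A).tHor f = (Hsim A).tHor (G.hor (RelPath.single e))) :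
    F.Rep.tHor (F.liftHor G (.single e)) = F.Rep.tHor (F.repHor f) := by
  rw [F.liftHor_single G]
  generalize G.hor (RelPath.single e) = k at hf ⊢
  cases hf
  rfl

theorem tVer_liftVer_single {x y : T} (e : v x y) {a : A}
    (hf : (Hsim A).tVer (Equivalence.id a) = (Hsim A).tVer (G.ver (RelPath.single e))) :
    F.Rep.tVer (F.liftVer G (.single e)) = F.Rep.tVer (F.Rep.vid a) := by
  rw [F.liftVer_single G]
  exact F.tVer_rep_id hf

/-- Evaluation rule for `F_* G`: the replacements `r`, `r'` record how top and bottom are built from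
generators. A single edge contributes a trivial isomorphism, and a path of two edges contributes a
compositor. -/
theorem square_postcomp {x y x' y' : T} {f : RelPath h x y} {p : RelPath v x x'}
    {q : RelPath v y y'} {g : RelPath h x' y'} {a b : A} {r r' : F.RepHor a b}
    (hf : F.Rep.tHor (F.liftHor G f) = F.Rep.tHor r)
    (hp : F.Rep.tVer (F.liftVer G p) = F.Rep.tVer (F.Rep.vid a))
    (hq : F.Rep.tVer (F.liftVer G q) = F.Rep.tVer (F.Rep.vid b))
    (hg : F.Rep.tHor (F.liftHor G g) = F.Rep.tHor r') {η : r.base ⟶ r'.base}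
    (hη : G.square f p q g = tGlob η) :
    (F.postcomp G).square f p q g = tGlob (F.conj r.iso r'.iso η) := by
  refine Eq.trans ?_ (F.tSq_repImage_glob η)
  refine F.repImage.tSq_congr (F.tSq_rep_congr hf hp hq hg (Eq.trans ?_ hη))
  exact tSq_eq_of_heq (F.liftHor_base G f) (F.liftVer_base G p) (F.liftVer_base G q)
    (F.liftHor_base G g) (cast_heq _ _)

end

/-- The map of nerves induced by a normal pseudofunctor. -/
def nerveHom : NerveHom A B where
  app G := F.postcomp G
  nat _ _ _ G := congrArg (fun L => DoubleFunctor.comp L F.repImage) (F.lift_freeMap G _ _ _)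

section

variable {i j k : SimplexCategory} (G : DoubleFunctor (X i j k) (Hsim A))

theorem tHor_liftHor_hle {a a' : Fin (i.len + 1)} (h : a < a') (b : Fin (j.len + 1))
    (c : Fin (k.len + 1)) {x y : A} {f : x ⟶ y} (hf : (Hsim A).tHor f = G.hEdge h.le b c) :
    F.Rep.tHor (F.liftHor G (hle h.le b c)) = F.Rep.tHor (F.repHor f) := by
  unfold DoubleFunctor.hEdge at hf
  rw [hle_of_lt h] at hf ⊢
  exact F.tHor_liftHor_single G _ hf

theorem tHor_liftHor_hle_comp {a a' a'' : Fin (i.len + 1)} (h : a < a') (h' : a' < a'')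
    (b : Fin (j.len + 1)) (c : Fin (k.len + 1)) {x y z : A} {f : x ⟶ y} {g : y ⟶ z}
    (hf : (Hsim A).tHor f = G.hEdge h.le b c) (hg : (Hsim A).tHor g = G.hEdge h'.le b c) :
    F.Rep.tHor (F.liftHor G ((hle h.le b c).comp (hle h'.le b c))) =
      F.Rep.tHor (F.Rep.hcomp (F.repHor f) (F.repHor g)) := by
  rw [F.liftHor_comp G]
  exact tHor_hcomp (F.tHor_liftHor_hle G h b c hf) (F.tHor_liftHor_hle G h' b c hg)

theorem tVer_liftVer_vle (a : Fin (i.len + 1)) {b b' : Fin (j.len + 1)} (h : b < b')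
    (c : Fin (k.len + 1)) {x : A} (hx : (Hsim A).tVer (Equivalence.id x) = G.vEdge a h.le c) :
    F.Rep.tVer (F.liftVer G (vle a h.le c)) = F.Rep.tVer (F.Rep.vid x) := by
  unfold DoubleFunctor.vEdge at hx
  rw [vle_of_lt a h] at hx ⊢
  exact F.tVer_liftVer_single G _ hx

end

theorem nerveHom_edge {x y : A} (f : x ⟶ y) : (F.nerveHom.app (nerveEdge f)).hEdge (i := ⦋1⦌)
    (Fin.zero_le (1 : Fin 2)) 0 0 = (Hsim B).tHor (F.map f) :=
  F.repImage.tHor_congr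
    (F.tHor_liftHor_hle (nerveEdge f) (show (0 : Fin 2) < 1 by decide) 0 0 (f := f) rfl)

theorem nerveHom_quad {x y : A} {f g : x ⟶ y} (η : f ⟶ g) : (F.nerveHom.app (nerveQuad η)).quad
    (i := ⦋1⦌) (j := ⦋1⦌) (Fin.zero_le (1 : Fin 2)) (Fin.zero_le (1 : Fin 2)) 0 =
      tGlob (F.map₂ η) := by
  have l : (0 : Fin 2) < 1 := by decide
  refine (F.square_postcomp (nerveQuad η) (r := F.repHor f) (r' := F.repHor g) (η := η)
    (F.tHor_liftHor_hle (nerveQuad η) l (0 : Fin 2) 0 (f := f) rfl)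
    (F.tVer_liftVer_vle (nerveQuad η) (0 : Fin 2) l 0 rfl)
    (F.tVer_liftVer_vle (nerveQuad η) (1 : Fin 2) l 0 rfl)
    (F.tHor_liftHor_hle (nerveQuad η) l (1 : Fin 2) 0 (f := g) rfl) rfl).trans ?_
  exact congrArg tGlob (by simp [conj, repHor])

theorem nerveTriangle_tri {x y z : A} (f : x ⟶ y) (g : y ⟶ z) :
    (nerveTriangle f g).tri (i := ⦋2⦌) (Fin.zero_le (1 : Fin 3)) (Fin.le_last (1 : Fin 3)) 0 0 =
        tGlob (𝟙 (f ≫ g)) ∧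
      (nerveTriangle f g).triInv (i := ⦋2⦌) (Fin.zero_le (1 : Fin 3)) (Fin.le_last (1 : Fin 3))
        0 0 = tGlob (𝟙 (f ≫ g)) := by
  constructor <;> exact (Chain.thinSq_vid _ _ _).trans (tGlob_id _).symm

/-- The triangle in `A` commutes strictly, so the 2-morphism to be conjugated is an identity. Only
the compositor from the path of two edges remains. -/
theorem nerveHom_triInv {x y z : A} (f : x ⟶ y) (g : y ⟶ z) :
    (F.nerveHom.app (nerveTriangle f g)).triInv (i := ⦋2⦌) (Fin.zero_le (1 : Fin 3))
      (Fin.le_last (1 : Fin 3)) 0 0 = tGlob (F.mapComp f g).hom := by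
  have l : (0 : Fin 3) < 1 := by decide
  have l' : (1 : Fin 3) < 2 := by decide
  refine (F.square_postcomp (nerveTriangle f g) (r := F.repHor (f ≫ g))
    (r' := F.Rep.hcomp (F.repHor f) (F.repHor g)) (η := 𝟙 (f ≫ g))
    (F.tHor_liftHor_hle (nerveTriangle f g) (l.trans l') 0 0 rfl) rfl rfl
    (F.tHor_liftHor_hle_comp (nerveTriangle f g) l l' 0 0 rfl rfl)
    (nerveTriangle_tri f g).2).trans ?_
  exact congrArg tGlob (by simp [conj, repHor, Rep, compIso])

theorem nerveHom_tri {x y z : A} (f : x ⟶ y) (g : y ⟶ z) :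
    (F.nerveHom.app (nerveTriangle f g)).tri (i := ⦋2⦌) (Fin.zero_le (1 : Fin 3))
      (Fin.le_last (1 : Fin 3)) 0 0 = tGlob (F.mapComp f g).inv := by
  have l : (0 : Fin 3) < 1 := by decide
  have l' : (1 : Fin 3) < 2 := by decide
  refine (F.square_postcomp (nerveTriangle f g) (r := F.Rep.hcomp (F.repHor f) (F.repHor g))
    (r' := F.repHor (f ≫ g)) (η := 𝟙 (f ≫ g))
    (F.tHor_liftHor_hle_comp (nerveTriangle f g) l l' 0 0 rfl rfl) rfl rfl
    (F.tHor_liftHor_hle (nerveTriangle f g) (l.trans l') 0 0 rfl)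
    (nerveTriangle_tri f g).1).trans ?_
  exact congrArg tGlob (by simp [conj, repHor, Rep, compIso])

/-- Objects, morphisms, 2-morphisms and compositors of `F` are recovered by evaluating at points,
edges, squares and triangles. -/
theorem nerveHom_injective {F F' : StrictlyUnitaryPseudofunctor A B}
    (h : ∀ {i j k : SimplexCategory} (G : DoubleFunctor (X i j k) (Hsim A)),
      F.nerveHom.app G = F'.nerveHom.app G) : F = F' := by
  refine ext_of_total (fun x => congrArg (fun P => P.objD (0, 0, 0)) (h (nervePt x)))
    (fun f => ?_) (fun η => ?_) fun f g => ?_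
  · rw [← nerveHom_edge, h, nerveHom_edge]
  · rw [← nerveHom_quad, h, nerveHom_quad]
  · rw [← nerveHom_triInv, h, nerveHom_triInv]

/-- By `ext_of_gaunt` only standard simplices matter, and there both sides take the values by which
the pseudofunctor was defined. -/
theorem nerveHom_toPseudofunctor (hA : IsGaunt A) (Φ : NerveHom A B) {i j k : SimplexCategory}
    (G : DoubleFunctor (X i j k) (Hsim A)) :
    (Φ.toPseudofunctor hA).nerveHom.app G = Φ.app G := by
  refine NerveHom.ext_of_gaunt G hA (fun x => rfl) ?_ ?_ ?_ ?_
  · intro x y f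
    exact (nerveHom_edge _ f).trans (Φ.tHor_map hA _ _ _ _ rfl)
  · intro x y f g η
    exact (nerveHom_quad _ η).trans (Φ.tGlob_map₂ hA _ _ _ _ rfl)
  · intro x y z f g
    exact (nerveHom_tri _ f g).trans (Φ.tGlob_mapComp_inv hA _ _ _ _ _ rfl rfl)
  · intro x y z f g
    exact (nerveHom_triInv _ f g).trans (Φ.tGlob_mapComp_hom hA _ _ _ _ _ rfl rfl)

end CategoryTheory.StrictlyUnitaryPseudofunctor

/-! ### Compatibility with composition of pseudofunctors -/

namespace CategoryTheory.StrictlyUnitaryPseudofunctor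

section Comp

variable {A B C : Type u} [Bicategory.{w, v} A] [Bicategory.{w, v} B] [Bicategory.{w, v} C]
  (F : StrictlyUnitaryPseudofunctor A B) (K : StrictlyUnitaryPseudofunctor B C)

/-- The compositor of `K ∘ F` is that of `K` after the image of that of `F`. Naturality of the
former and interchange sort the factors into an `F`-part and a `K`-part. -/
theorem compIso_comp {a b c : A} {f : a ⟶ b} {g : b ⟶ c} {f' : F.obj a ⟶ F.obj b}
    {g' : F.obj b ⟶ F.obj c} {f'' : K.obj (F.obj a) ⟶ K.obj (F.obj b)}
    {g'' : K.obj (F.obj b) ⟶ K.obj (F.obj c)} (i : F.map f ≅ f') (j : F.map g ≅ g')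
    (θ : K.map f' ≅ f'') (θ' : K.map g' ≅ g'') :
    (F.comp K).compIso (K.map₂Iso i ≪≫ θ) (K.map₂Iso j ≪≫ θ') =
      K.map₂Iso (F.compIso i j) ≪≫ K.compIso θ θ' := by
  ext
  change (K.map₂ (F.mapComp f g).hom ≫ (K.mapComp (F.map f) (F.map g)).hom) ≫
    (K.map₂ i.hom ≫ θ.hom) ▷ K.map (F.map g) ≫ f'' ◁ (K.map₂ j.hom ≫ θ'.hom) =
    K.map₂ ((F.mapComp f g).hom ≫ i.hom ▷ F.map g ≫ f' ◁ j.hom) ≫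
      (K.mapComp f' g').hom ≫ θ.hom ▷ K.map g' ≫ f'' ◁ θ'.hom
  simp only [K.map₂_comp, K.map₂_whisker_left, K.map₂_whisker_right, Category.assoc,
    Iso.inv_hom_id_assoc, Bicategory.comp_whiskerRight, Bicategory.whiskerLeft_comp]
  rw [whisker_exchange_assoc]

theorem conj_comp_map {a b : A} {f g : a ⟶ b} {f' g' : F.obj a ⟶ F.obj b}
    {f'' g'' : K.obj (F.obj a) ⟶ K.obj (F.obj b)} (i : F.map f ≅ f') (j : F.map g ≅ g')
    (θ : K.map f' ≅ f'') (θ' : K.map g' ≅ g'') (α : f ⟶ g) :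
    (F.comp K).conj (K.map₂Iso i ≪≫ θ) (K.map₂Iso j ≪≫ θ') α =
      K.conj θ θ' (F.conj i j α) := by
  change (θ.inv ≫ K.map₂ i.inv) ≫ K.map₂ (F.map₂ α) ≫ K.map₂ j.hom ≫ θ'.hom =
    θ.inv ≫ K.map₂ (i.inv ≫ F.map₂ α ≫ j.hom) ≫ θ'.hom
  simp only [K.map₂_comp, Category.assoc]

theorem mapEquiv_comp {a b : A} (e : Bicategory.Equivalence a b) :
    (F.comp K).mapEquiv e = K.mapEquiv (F.mapEquiv e) := by
  refine Equivalence.mk_eq rfl rfl (Eq.trans ?_ (Category.comp_id _).symm)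
    (Eq.trans ?_ (Category.id_comp _).symm)
  · change ((K.mapId (F.obj a)).inv ≫ K.map₂ (F.mapId a).inv) ≫ K.map₂ (F.map₂ e.unit.hom) ≫
      K.map₂ (F.mapComp e.hom e.inv).hom ≫ (K.mapComp (F.map e.hom) (F.map e.inv)).hom =
      (K.mapId (F.obj a)).inv ≫ K.map₂ ((F.mapId a).inv ≫ F.map₂ e.unit.hom ≫
        (F.mapComp e.hom e.inv).hom) ≫ (K.mapComp (F.map e.hom) (F.map e.inv)).hom
    simp only [K.map₂_comp, Category.assoc]
  · change ((K.mapComp (F.map e.inv) (F.map e.hom)).inv ≫ K.map₂ (F.mapComp e.inv e.hom).inv) ≫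
      K.map₂ (F.map₂ e.counit.hom) ≫ K.map₂ (F.mapId b).hom ≫ (K.mapId (F.obj b)).hom =
      (K.mapComp (F.map e.inv) (F.map e.hom)).inv ≫ K.map₂ ((F.mapComp e.inv e.hom).inv ≫
        F.map₂ e.counit.hom ≫ (F.mapId b).hom) ≫ (K.mapId (F.obj b)).hom
    simp only [K.map₂_comp, Category.assoc]

/-- A replacement for a composite of pseudofunctors that is composed of two replacements. -/
def HorComp {a b : A} (t : (F.comp K).RepHor a b) (r : F.RepHor a b)
    (s : K.RepHor (F.obj a) (F.obj b)) : Prop :=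
  ∃ (k : K.obj (F.obj a) ⟶ K.obj (F.obj b)) (θ : K.map r.rep ≅ k),
    t = ⟨r.base, k, K.map₂Iso r.iso ≪≫ θ⟩ ∧ s = ⟨r.rep, k, θ⟩

/-- A replacement for a composite of pseudofunctors that is composed of two replacements. -/
def VerComp {a b : A} (t : (F.comp K).RepVer a b) (r : F.RepVer a b)
    (s : K.RepVer (F.obj a) (F.obj b)) : Prop :=
  ∃ (k : Bicategory.Equivalence (K.obj (F.obj a)) (K.obj (F.obj b)))
    (θ : K.map r.rep.hom ≅ k.hom),
    t = ⟨r.base, k, K.map₂Iso r.iso ≪≫ θ⟩ ∧ s = ⟨r.rep, k, θ⟩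

theorem verComp_map {a b : A} (e : Bicategory.Equivalence a b) :
    VerComp F K ⟨e, (F.comp K).mapEquiv e, Iso.refl _⟩ ⟨e, F.mapEquiv e, Iso.refl _⟩
      ⟨F.mapEquiv e, K.mapEquiv (F.mapEquiv e), Iso.refl _⟩ := by
  -- The two candidates for the replacement, the image under the composite and the iterated image,
  -- are identified by `mapEquiv_comp`.
  refine ⟨(F.comp K).mapEquiv e, Iso.refl _, congrArg (RepVer.mk _ _) ?_,
    RepVer.ext' rfl (F.mapEquiv_comp K e).symm ?_⟩
  · ext
    exact ((Category.comp_id _).trans (K.map₂_id _)).symm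
  · exact K.conj_id (Iso.refl (K.map (F.map e.hom)))

variable [Strict A] [Strict B]

theorem horComp_map {a b : A} (f : a ⟶ b) :
    HorComp F K ((F.comp K).repHor f) (F.repHor f) (K.repHor (F.map f)) := by
  refine ⟨K.map (F.map f), Iso.refl _, congrArg (RepHor.mk _ _) ?_, rfl⟩
  ext
  exact ((Category.comp_id _).trans (K.map₂_id _)).symm

variable [Strict C] {F K}

/-- Composability of replacements is a relation because the base of the replacement for `K` equals
the replacement for `F` only propositionally on paths. It holds on edges and is closed under
composition, hence holds on all paths. -/
theorem HorComp.hcomp {a b c : A} {t : (F.comp K).RepHor a b} {r : F.RepHor a b}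
    {s : K.RepHor (F.obj a) (F.obj b)} {t' : (F.comp K).RepHor b c} {r' : F.RepHor b c}
    {s' : K.RepHor (F.obj b) (F.obj c)} (h : HorComp F K t r s) (h' : HorComp F K t' r' s') :
    HorComp F K ((F.comp K).Rep.hcomp t t') (F.Rep.hcomp r r') (K.Rep.hcomp s s') := by
  obtain ⟨k, θ, rfl, rfl⟩ := h
  obtain ⟨k', θ', rfl, rfl⟩ := h'
  exact ⟨k ≫ k', K.compIso θ θ', congrArg (fun i => (⟨r.base ≫ r'.base, k ≫ k', i⟩ :
    (F.comp K).RepHor a c)) (F.compIso_comp K r.iso r'.iso θ θ'), rfl⟩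

theorem VerComp.vcomp {a b c : A} {t : (F.comp K).RepVer a b} {r : F.RepVer a b}
    {s : K.RepVer (F.obj a) (F.obj b)} {t' : (F.comp K).RepVer b c} {r' : F.RepVer b c}
    {s' : K.RepVer (F.obj b) (F.obj c)} (h : VerComp F K t r s) (h' : VerComp F K t' r' s') :
    VerComp F K ((F.comp K).Rep.vcomp t t') (F.Rep.vcomp r r') (K.Rep.vcomp s s') := by
  obtain ⟨k, θ, rfl, rfl⟩ := h
  obtain ⟨k', θ', rfl, rfl⟩ := h'
  exact ⟨k.comp k', K.compIso θ θ', congrArg (fun i => (⟨r.base.comp r'.base, k.comp k', i⟩ :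
    (F.comp K).RepVer a c)) (F.compIso_comp K r.iso r'.iso θ θ'), rfl⟩

/-- Once the boundary replacements are decomposed, the claim is that conjugating in two stages
equals conjugating by the composite isomorphisms. -/
theorem tSq_repImage_comp {a b c d : A} {tf : (F.comp K).RepHor a b}
    {tu : (F.comp K).RepVer a c} {tv : (F.comp K).RepVer b d} {tg : (F.comp K).RepHor c d}
    {rf : F.RepHor a b} {ru : F.RepVer a c} {rv : F.RepVer b d} {rg : F.RepHor c d}
    {sf : K.RepHor (F.obj a) (F.obj b)} {su : K.RepVer (F.obj a) (F.obj c)}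
    {sv : K.RepVer (F.obj b) (F.obj d)} {sg : K.RepHor (F.obj c) (F.obj d)}
    (hf : HorComp F K tf rf sf) (hu : VerComp F K tu ru su) (hv : VerComp F K tv rv sv)
    (hg : HorComp F K tg rg sg) {α : (F.comp K).Rep.Sq tf tu tv tg} {β : K.Rep.Sq sf su sv sg}
    {γ : F.Rep.Sq rf ru rv rg}
    (hα : (Hsim A).tSq (f := tf.base) (u := tu.base) (v := tv.base) (g := tg.base) α =
      (Hsim A).tSq (f := rf.base) (u := ru.base) (v := rv.base) (g := rg.base) γ)
    (hβ : (Hsim B).tSq (f := sf.base) (u := su.base) (v := sv.base) (g := sg.base) β =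
      (Hsim B).tSq (F.repImage.sq γ)) :
    (Hsim C).tSq ((F.comp K).repImage.sq α) = (Hsim C).tSq (K.repImage.sq β) := by
  obtain ⟨k₁, θ₁, rfl, rfl⟩ := hf
  obtain ⟨k₂, θ₂, rfl, rfl⟩ := hu
  obtain ⟨k₃, θ₃, rfl, rfl⟩ := hv
  obtain ⟨k₄, θ₄, rfl, rfl⟩ := hg
  obtain rfl : α = γ := eq_of_tSq (Z := Hsim A) hα
  obtain rfl : β = F.repImage.sq (f := rf) (u := ru) (v := rv) (g := rg) α :=
    eq_of_tSq (Z := Hsim B) hβ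
  refine congrArg (Hsim C).tSq ?_
  change (F.comp K).conj ((F.comp K).compIso (K.map₂Iso rf.iso ≪≫ θ₁) (K.map₂Iso rv.iso ≪≫ θ₃))
    ((F.comp K).compIso (K.map₂Iso ru.iso ≪≫ θ₂) (K.map₂Iso rg.iso ≪≫ θ₄)) α =
    K.conj (K.compIso θ₁ θ₃) (K.compIso θ₂ θ₄)
      (F.conj (F.compIso rf.iso rv.iso) (F.compIso ru.iso rg.iso) α)
  rw [compIso_comp, compIso_comp]
  exact conj_comp_map F K _ _ _ _ α

variable (F K)

theorem horComp_id (a : A) :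
    HorComp F K ((F.comp K).Rep.hid a) (F.Rep.hid a) (K.Rep.hid (F.obj a)) :=
  ⟨𝟙 _, K.mapId (F.obj a), rfl, rfl⟩

theorem verComp_id (a : A) :
    VerComp F K ((F.comp K).Rep.vid a) (F.Rep.vid a) (K.Rep.vid (F.obj a)) :=
  ⟨Equivalence.id _, K.mapId (F.obj a), rfl, rfl⟩

variable {T : Type} {h v : T → T → Prop} (G : DoubleFunctor (free T h v) (Hsim A))

theorem horComp_liftHor {x y : T} (p : RelPath h x y) :
    HorComp F K ((F.comp K).liftHor G p) (F.liftHor G p) (K.liftHor (F.postcomp G) p) := by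
  induction p with
  | nil => exact horComp_id F K _
  | cons p e ih =>
    refine HorComp.hcomp ih ?_
    have : (F.postcomp G).hor (.single e) = F.map (G.hor (.single e)) :=
      congrArg RepHor.rep (F.liftHor_single G e)
    rw [this]
    exact horComp_map F K _

theorem verComp_liftVer {x y : T} (p : RelPath v x y) :
    VerComp F K ((F.comp K).liftVer G p) (F.liftVer G p) (K.liftVer (F.postcomp G) p) := by
  induction p with
  | nil => exact verComp_id F K _
  | cons p e ih =>
    refine VerComp.vcomp ih ?_
    have : (F.postcomp G).ver (.single e) = F.mapEquiv (G.ver (.single e)) :=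
      congrArg RepVer.rep (F.liftVer_single G e)
    rw [this]
    exact verComp_map F K _

/-- Generators agree on both sides, and the compositor isomorphisms on paths compose as `HorComp`
and `VerComp` record, so the images of all squares agree. -/
theorem postcomp_comp : (F.comp K).postcomp G = K.postcomp (F.postcomp G) := by
  refine DoubleFunctor.eq_of_square fun f p q g => ?_
  refine tSq_repImage_comp (horComp_liftHor F K G f) (verComp_liftVer F K G p)
    (verComp_liftVer F K G q) (horComp_liftHor F K G g) (γ := (F.lift G).sq ()) ?_ ?_
  · exact tSq_eq_of_heq (((F.comp K).liftHor_base G f).trans (F.liftHor_base G f).symm)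
      (((F.comp K).liftVer_base G p).trans (F.liftVer_base G p).symm)
      (((F.comp K).liftVer_base G q).trans (F.liftVer_base G q).symm)
      (((F.comp K).liftHor_base G g).trans (F.liftHor_base G g).symm)
      ((cast_heq _ _).trans (cast_heq _ _).symm)
  · exact tSq_eq_of_heq (K.liftHor_base _ f) (K.liftVer_base _ p) (K.liftVer_base _ q)
      (K.liftHor_base _ g) (cast_heq _ _)

theorem nerveMap_comp : (F.comp K).nerveMap = F.nerveMap ≫ K.nerveMap := by
  have e : (F.comp K).nerveTriMap = F.nerveTriMap ≫ K.nerveTriMap := by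
    ext n G
    exact postcomp_comp F K G
  exact (congrArg (fun τ => Functor.curry.map τ) e).trans (Functor.curry.map_comp _ _)

end Comp

/-! ### Bijectivity -/

variable {A B : Type u} [Bicategory.{w, v} A] [Strict A] [Bicategory.{w, v} B] [Strict B]

theorem nerveMap_injective {F F' : StrictlyUnitaryPseudofunctor A B}
    (h : F.nerveMap = F'.nerveMap) : F = F' := by
  have e : F.nerveTriMap = F'.nerveTriMap := Functor.curry.map_injective h
  exact nerveHom_injective fun {i j k} G =>
    congrArg (fun τ : nerveTri A ⟶ nerveTri B => TypeCat.homEquiv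
      (τ.app (Opposite.op (i, j), Opposite.op k)) G) e

/-- Currying is full, so a map of bisimplicial spaces comes from a map of trisimplicial sets. The
latter is a `NerveHom`, whose pseudofunctor is the preimage. -/
theorem nerveMap_surjective (hA : IsGaunt A) (Ψ : bisimplicialNerve A ⟶ bisimplicialNerve B) :
    ∃ F : StrictlyUnitaryPseudofunctor A B, F.nerveMap = Ψ := by
  obtain ⟨τ, rfl⟩ := Functor.curry.map_surjective (X := nerveTri A) (Y := nerveTri B) Ψ
  let Φ : NerveHom A B :=
    { app := fun {i j k} => TypeCat.homEquiv (X := (nerveTri A).obj (Opposite.op (i, j),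
        Opposite.op k)) (τ.app (Opposite.op (i, j), Opposite.op k))
      nat := fun {i j k i' j' k'} α β γ G =>
        ConcreteCategory.congr_hom (τ.naturality
          (X := (Opposite.op (i', j'), Opposite.op k')) (Y := (Opposite.op (i, j), Opposite.op k))
          (Quiver.Hom.op (show (i, j) ⟶ (i', j') from (α, β)), γ.op)) G }
  refine ⟨Φ.toPseudofunctor hA, congrArg (fun τ => Functor.curry.map τ) ?_⟩
  ext n G
  exact nerveHom_toPseudofunctor hA Φ G

end CategoryTheory.StrictlyUnitaryPseudofunctor

theorem mainTheorem6 {A B : Type u} [Bicategory.{w, v} A] [Strict A] [Bicategory.{w, v} B]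
    [Strict B] (hA : IsGaunt A) :
    Function.Bijective (fun F : StrictlyUnitaryPseudofunctor A B =>
      (F.nerveMap : bisimplicialNerve A ⟶ bisimplicialNerve B)) ∧
    ∀ {A' B' : Type u} [Bicategory.{w, v} A'] [Strict A'] [Bicategory.{w, v} B'] [Strict B']
      (H : StrictlyUnitaryPseudofunctor A' A) (F : StrictlyUnitaryPseudofunctor A B)
      (K : StrictlyUnitaryPseudofunctor B B'),
      ((H.comp F).comp K).nerveMap = H.nerveMap ≫ F.nerveMap ≫ K.nerveMap := by
  refine ⟨⟨fun F F' h => StrictlyUnitaryPseudofunctor.nerveMap_injective h,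
    fun Ψ => StrictlyUnitaryPseudofunctor.nerveMap_surjective hA Ψ⟩, ?_⟩
  intro A' B' _ _ _ _ H F K
  rw [StrictlyUnitaryPseudofunctor.nerveMap_comp, StrictlyUnitaryPseudofunctor.nerveMap_comp,
    Category.assoc]
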